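/- For a real number $\xi$ and an integer $n\ge 1$, let $\lambda_n(\xi)$ (respectively $\widehat\lambda_n(\xi)$) be the supremum in $[-\infty,\infty]$ of the real numbers $\lambda$ for which the system \[ 1\le x\le X,\qquad \max_{1\le j\le n}|\xi^j x-y_j|\le X^{-\lambda} \] has a solution $(x,y_1,\dots,y_n)\in\mathbb Z^{n+1}$ for arbitrarily large real $X$ (respectively for all sufficiently large real $X$). Let $w_n(\xi)$ (respectively $\widehat w_n(\xi)$) be the supremum in $[-\infty,\infty]$ of the real numbers $w$ for which the system \[ 1\le \max_{1\le j\le n}|a_j|\le X,\qquad |a_0+a_1\xi+\cdots+a_n\xi^n|\le X^{-w} \] has a solution $(a_0,\dots,a_n)\in\mathbb Z^{n+1}$ for arbitrarily large real $X$ (respectively for all sufficiently large real $X$). Let $\xi$ be a transcendental real number with $\widehat\lambda_4(\xi)>1/3$. Then $\widehat\lambda_4(\xi)<1/2$ and $\lambda_4(\xi)<1$ (so that all denominators below are positive), \[ \frac{3\widehat\lambda_4(\xi)+1}{3\widehat\lambda_4(\xi)-1}\ \ge\ w_3(\xi)\ \ge\ \max\left\{\frac{3\widehat\lambda_4(\xi)}{1-2\widehat\lambda_4(\xi)},\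 \frac{3\lambda_4(\xi)+1}{1-\lambda_4(\xi)}\right\}, \qquad \widehat w_3(\xi)\ \ge\ \frac{3\widehat\lambda_4(\xi)+1}{1-\widehat\lambda_4(\xi)}, \] and \[ w_2(\xi)\ \le\ \frac{1}{\widehat\lambda_4(\xi)}\ <\ 3 . \] -/

import Mathlib

/-- The system `1 ≤ x ≤ X`, `max_{1 ≤ j ≤ n} |ξ^j x - y_j| ≤ X^(-l)` has an integer solution
`(x, y_1, …, y_n)`. The entry `y j` with `j : Fin n` is `y_{j+1}`. -/
def SimultaneousSolvable (n : ℕ) (ξ l X : ℝ) : Prop :=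
  ∃ (x : ℤ) (y : Fin n → ℤ), 1 ≤ x ∧ (x : ℝ) ≤ X ∧
    ∀ j : Fin n, |ξ ^ ((j : ℕ) + 1) * (x : ℝ) - (y j : ℝ)| ≤ X ^ (-l)

/-- The system `1 ≤ max_{1 ≤ j ≤ n} |a_j| ≤ X`, `|a_0 + a_1 ξ + ⋯ + a_n ξ^n| ≤ X^(-w)` has an
integer solution `(a_0, …, a_n)`. -/
def LinearFormSolvable (n : ℕ) (ξ w X : ℝ) : Prop :=
  ∃ a : Fin (n + 1) → ℤ, (∃ j : Fin n, 1 ≤ |a j.succ|) ∧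
    (∀ j : Fin n, |(a j.succ : ℝ)| ≤ X) ∧
    |∑ i : Fin (n + 1), (a i : ℝ) * ξ ^ (i : ℕ)| ≤ X ^ (-w)

/-- The ordinary exponent `λ_n(ξ)`: solvability for arbitrarily large `X`. -/
noncomputable def ordinaryLambda (n : ℕ) (ξ : ℝ) : EReal :=
  sSup ((fun l : ℝ => (l : EReal)) '' {l : ℝ | ∃ᶠ X in Filter.atTop, SimultaneousSolvable n ξ l X})

/-- The uniform exponent `λ̂_n(ξ)`: solvability for all sufficiently large `X`. -/
noncomputable def uniformLambda (n : ℕ) (ξ : ℝ) : EReal :=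
  sSup ((fun l : ℝ => (l : EReal)) '' {l : ℝ | ∀ᶠ X in Filter.atTop, SimultaneousSolvable n ξ l X})

/-- The ordinary exponent `w_n(ξ)`: solvability for arbitrarily large `X`. -/
noncomputable def ordinaryW (n : ℕ) (ξ : ℝ) : EReal :=
  sSup ((fun w : ℝ => (w : EReal)) '' {w : ℝ | ∃ᶠ X in Filter.atTop, LinearFormSolvable n ξ w X})

/-- The uniform exponent `ŵ_n(ξ)`: solvability for all sufficiently large `X`. -/
noncomputable def uniformW (n : ℕ) (ξ : ℝ) : EReal :=
  sSup ((fun w : ℝ => (w : EReal)) '' {w : ℝ | ∀ᶠ X in Filter.atTop, LinearFormSolvable n ξ w X})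

/-! ### Heights of integer polynomials and Dirichlet's theorem for cubics -/

open Polynomial Filter

/-! Write `H` for the height and fix `l > 1/3` admissible for the uniform simultaneous problem. An
integer point `x` with errors at most `L` acts on polynomials of degree at most 4 by `X ^ i ↦ x i`.
Its value at `P` is an integer within `O(H(P) L)` of `x 0 * P(ξ)`, hence zero once `x 0 * P(ξ)` and
`H(P) L` are small. A nonzero `x` cannot kill too many multiples of two coprime polynomials. Applied
to an irreducible `P` of degree at most 2 and a Dirichlet cubic, this shows `|R(ξ)| ≫ H(R)^(-ω)` for
all nonzero `R` of degree at most 2 and `1/l < ω < 3` (`exists_quadratic_lower_bound`), which bounds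
`w_2`.

Now let `P`, `Q` be consecutive minimal cubics and `e = |P(ξ)| ≪ H(Q)^(-3)`. The quadratic bound
forces `deg P = 3` and `P`, `Q` coprime. Because `l > 1/3`, each `x` with `x 0 ≤ Y ≍ 1/e` and error
at most `Y^(-l)` kills `P, XP, Q, XQ`. So `P` and `Q` lie in the rank two lattice orthogonal to `(x
0, …, x 3)` and `(x 1, …, x 4)`. Values at `ξ` on this lattice are controlled by `3 × 3` minors of
size `O(L^2)`, and minimality of `P` yields `H(Q) e ≪ e^(2l)`. The Sylvester determinant gives `1 ≪
H(P)^2 H(Q)^3 e`. These two inequalities (`exists_goodPair`) imply `l ≤ 2/5`, `w_3 ≤ 1/(3l-1)` and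
`ŵ_3 ≥ 1/(1-2l)`; the last two are stronger than what is claimed.

The lower bounds for `w_3` come from explicit cubics: a short vector orthogonal to both shifts of
one good point (`frequently_linearFormSolvable_of_ordinary`), and the cross product of these shifts
with a shift of the next minimal point (`frequently_linearFormSolvable_of_uniform`). Comparing the
former with the upper bound for `w_3` gives `λ_4 < 1`. -/

theorem abs_coeff_le_supNorm (P : ℤ[X]) (i : ℕ) : |(P.coeff i : ℝ)| ≤ P.supNorm := by
  have := P.le_supNorm i
  rwa [Int.norm_eq_abs] at this

theorem supNorm_le_of_coeff {P : ℤ[X]} {B : ℝ} (h : ∀ i, |(P.coeff i : ℝ)| ≤ B) :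
    P.supNorm ≤ B := by
  obtain ⟨i, hi⟩ := P.exists_eq_supNorm
  rw [hi, Int.norm_eq_abs]
  exact h i

theorem one_le_supNorm {P : ℤ[X]} (hP : P ≠ 0) : 1 ≤ P.supNorm := by
  have h : 1 ≤ |P.leadingCoeff| := Int.one_le_abs (leadingCoeff_ne_zero.mpr hP)
  have h2 := abs_coeff_le_supNorm P P.natDegree
  have h3 : (1 : ℝ) ≤ |(P.leadingCoeff : ℝ)| := by exact_mod_cast h
  exact h3.trans h2

theorem finite_supNorm_le (n : ℕ) (B : ℝ) :
    {P : ℤ[X] | P.natDegree ≤ n ∧ P.supNorm ≤ B}.Finite := by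
  let f : ℤ[X] → (Fin (n + 1) → ℤ) := fun P i => P.coeff i
  refine Set.Finite.of_finite_image (f := f)
    ((Set.finite_Icc (fun _ => -⌈B⌉) (fun _ => ⌈B⌉)).subset ?_) ?_
  · rintro _ ⟨P, ⟨-, hP⟩, rfl⟩
    have key : ∀ i, |P.coeff i| ≤ ⌈B⌉ := fun i => by
      have := ((abs_coeff_le_supNorm P i).trans hP).trans (Int.le_ceil B)
      exact_mod_cast this
    exact ⟨fun i => (abs_le.mp (key i)).1, fun i => (abs_le.mp (key i)).2⟩
  · rintro P ⟨hP, -⟩ Q ⟨hQ, -⟩ h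
    ext i
    by_cases hi : i < n + 1
    · exact congrFun h ⟨i, hi⟩
    · rw [coeff_eq_zero_of_natDegree_lt (by omega), coeff_eq_zero_of_natDegree_lt (by omega)]

theorem aeval_int_ne_zero {ξ : ℝ} (hξ : Transcendental ℚ ξ) {P : ℤ[X]} (hP : P ≠ 0) :
    aeval ξ P ≠ 0 := by
  have h : Transcendental ℤ ξ := fun h => hξ ((IsFractionRing.isAlgebraic_iff ℤ ℚ ℝ).mp h)
  exact fun h0 => hP ((transcendental_iff.mp h) P h0)

theorem exists_lower_bound_of_supNorm_le {ξ : ℝ} (hξ : Transcendental ℚ ξ) (n : ℕ) (B : ℝ) :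
    ∃ c : ℝ, 0 < c ∧ ∀ P : ℤ[X], P ≠ 0 → P.natDegree ≤ n → P.supNorm ≤ B → c ≤ |aeval ξ P| := by
  let s := {P : ℤ[X] | P.natDegree ≤ n ∧ P.supNorm ≤ B} \ {0}
  have hs : s.Finite := (finite_supNorm_le n B).subset Set.sdiff_subset
  by_cases hne : s.Nonempty
  · obtain ⟨P, hP, hmin⟩ := s.exists_min_image (fun P => |aeval ξ P|) hs hne
    exact ⟨|aeval ξ P|, abs_pos.mpr (aeval_int_ne_zero hξ hP.2),
      fun Q hQ hd hB => hmin Q ⟨⟨hd, hB⟩, hQ⟩⟩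
  · exact ⟨1, one_pos, fun Q hQ hd hB => (hne ⟨Q, ⟨hd, hB⟩, hQ⟩).elim⟩

theorem aeval_eq_sum_of_natDegree_le_three (ξ : ℝ) {P : ℤ[X]} (hP : P.natDegree ≤ 3) :
    aeval ξ P = P.coeff 0 + P.coeff 1 * ξ + P.coeff 2 * ξ ^ 2 + P.coeff 3 * ξ ^ 3 := by
  rw [aeval_eq_sum_range' (n := 4) (by omega)]
  simp [Finset.sum_range_succ]

theorem coeff_ofFn (r : Fin 4 → ℤ) (i : Fin 4) : (ofFn 4 r).coeff i = r i :=
  ofFn_coeff_eq_val_of_lt r i.2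

theorem natDegree_ofFn_le (r : Fin 4 → ℤ) : (ofFn 4 r).natDegree ≤ 3 :=
  Nat.le_of_lt_succ (ofFn_natDegree_lt (by norm_num) r)

/-- Pigeonhole: `(N + 1) ^ 3` triples of nonconstant coefficients against `N ^ 3` intervals for the
fractional part. Only the constant coefficient can exceed `N`; it is recovered from the value,
whence `C`. -/
theorem exists_cubic_dirichlet (ξ : ℝ) : ∃ C : ℝ, 1 ≤ C ∧ ∀ N : ℕ, 1 ≤ N →
    ∃ P : ℤ[X], P ≠ 0 ∧ P.natDegree ≤ 3 ∧ P.supNorm ≤ C * N ∧ |aeval ξ P| ≤ 1 / (N : ℝ) ^ 3 := by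
  refine ⟨|ξ| + |ξ| ^ 2 + |ξ| ^ 3 + 1, ?_, fun N hN => ?_⟩
  · have : 0 ≤ |ξ| + |ξ| ^ 2 + |ξ| ^ 3 := by positivity
    linarith
  have hN0 : (0 : ℝ) < N := by exact_mod_cast hN
  let val : (Fin 3 → Fin (N + 1)) → ℝ := fun a => ((a 0 : ℕ) : ℝ) * ξ + ((a 1 : ℕ) : ℝ) * ξ ^ 2
    + ((a 2 : ℕ) : ℝ) * ξ ^ 3
  have hlt : ∀ a, ⌊Int.fract (val a) * (N : ℝ) ^ 3⌋₊ < N ^ 3 := by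
    intro a
    rw [Nat.floor_lt (mul_nonneg (Int.fract_nonneg _) (by positivity))]
    push_cast
    have := Int.fract_lt_one (val a)
    have h3 : (0 : ℝ) < (N : ℝ) ^ 3 := by positivity
    nlinarith
  let f : (Fin 3 → Fin (N + 1)) → Fin (N ^ 3) := fun a => ⟨_, hlt a⟩
  obtain ⟨a, b, hab, hfab⟩ := Fintype.exists_ne_map_eq_of_card_lt f (by
    simp only [Fintype.card_pi, Fintype.card_fin, Finset.prod_const, Finset.card_univ]
    exact Nat.pow_lt_pow_left (Nat.lt_succ_self N) (by norm_num))
  have hfl : ⌊Int.fract (val a) * (N : ℝ) ^ 3⌋₊ = ⌊Int.fract (val b) * (N : ℝ) ^ 3⌋₊ :=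
    congrArg Fin.val hfab
  let d : Fin 3 → ℤ := fun i => ((a i : ℕ) : ℤ) - ((b i : ℕ) : ℤ)
  let m : ℤ := ⌊val b⌋ - ⌊val a⌋
  let r : Fin 4 → ℤ := ![m, d 0, d 1, d 2]
  let P : ℤ[X] := ofFn 4 r
  have c0 : P.coeff 0 = m := coeff_ofFn r 0
  have c1 : P.coeff 1 = d 0 := coeff_ofFn r 1
  have c2 : P.coeff 2 = d 1 := coeff_ofFn r 2
  have c3 : P.coeff 3 = d 2 := coeff_ofFn r 3
  have hdeg : P.natDegree ≤ 3 := natDegree_ofFn_le r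
  have hval : aeval ξ P = Int.fract (val a) - Int.fract (val b) := by
    rw [aeval_eq_sum_of_natDegree_le_three ξ hdeg, c0, c1, c2, c3]
    simp only [Int.fract, m, d, val]
    push_cast
    ring
  have hsmall : |aeval ξ P| ≤ 1 / (N : ℝ) ^ 3 := by
    have h3 : (0 : ℝ) < (N : ℝ) ^ 3 := by positivity
    have ha1 := Nat.floor_le (mul_nonneg (Int.fract_nonneg (val a)) h3.le)
    have hb1 := Nat.floor_le (mul_nonneg (Int.fract_nonneg (val b)) h3.le)
    have ha2 := Nat.lt_floor_add_one (Int.fract (val a) * (N : ℝ) ^ 3)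
    have hb2 := Nat.lt_floor_add_one (Int.fract (val b) * (N : ℝ) ^ 3)
    rw [hfl] at ha1 ha2
    rw [le_div_iff₀ h3, hval, ← abs_of_pos h3, ← abs_mul, abs_le]
    constructor <;> nlinarith
  have hd : ∀ i, |(d i : ℝ)| ≤ N := by
    intro i
    have h1 : ((a i : ℕ) : ℝ) ≤ N := by exact_mod_cast Nat.lt_succ_iff.mp (a i).2
    have h2 : ((b i : ℕ) : ℝ) ≤ N := by exact_mod_cast Nat.lt_succ_iff.mp (b i).2
    have h3 : (0 : ℝ) ≤ ((a i : ℕ) : ℝ) := by positivity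
    have h4 : (0 : ℝ) ≤ ((b i : ℕ) : ℝ) := by positivity
    simp only [d]
    push_cast
    rw [abs_le]
    constructor <;> linarith
  have hN1 : (1 : ℝ) ≤ N := by exact_mod_cast hN
  have hm : |(m : ℝ)| ≤ (|ξ| + |ξ| ^ 2 + |ξ| ^ 3 + 1) * N := by
    have e : (m : ℝ) = aeval ξ P - (d 0 * ξ + d 1 * ξ ^ 2 + d 2 * ξ ^ 3) := by
      rw [aeval_eq_sum_of_natDegree_le_three ξ hdeg, c0, c1, c2, c3]; ring
    have hv1 : |aeval ξ P| ≤ 1 := by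
      rw [hval]
      have := Int.fract_nonneg (val a)
      have := Int.fract_nonneg (val b)
      have := Int.fract_lt_one (val a)
      have := Int.fract_lt_one (val b)
      rw [abs_le]; constructor <;> linarith
    rw [e]
    have t0 : |(d 0 : ℝ) * ξ| ≤ N * |ξ| := by rw [abs_mul]; gcongr; exact hd 0
    have t1 : |(d 1 : ℝ) * ξ ^ 2| ≤ N * |ξ| ^ 2 := by rw [abs_mul, abs_pow]; gcongr; exact hd 1
    have t2 : |(d 2 : ℝ) * ξ ^ 3| ≤ N * |ξ| ^ 3 := by rw [abs_mul, abs_pow]; gcongr; exact hd 2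
    have s1 := abs_sub (aeval ξ P) (d 0 * ξ + d 1 * ξ ^ 2 + d 2 * ξ ^ 3)
    have s2 := abs_add_three ((d 0 : ℝ) * ξ) (d 1 * ξ ^ 2) (d 2 * ξ ^ 3)
    nlinarith
  refine ⟨P, ?_, hdeg, ?_, hsmall⟩
  · intro h0
    apply hab
    have hz : ∀ i, d i = 0 := by
      intro i
      fin_cases i
      · simpa [h0] using c1.symm
      · simpa [h0] using c2.symm
      · simpa [h0] using c3.symm
    funext i
    have := hz i
    simp only [d] at this
    apply Fin.ext
    omega
  · have hNC : (N : ℝ) ≤ (|ξ| + |ξ| ^ 2 + |ξ| ^ 3 + 1) * N := by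
      have : 0 ≤ (|ξ| + |ξ| ^ 2 + |ξ| ^ 3) * N := by positivity
      linarith
    refine supNorm_le_of_coeff fun i => ?_
    rcases lt_or_ge i 4 with hi | hi
    · interval_cases i
      · rw [c0]; exact hm
      · rw [c1]; exact (hd 0).trans hNC
      · rw [c2]; exact (hd 1).trans hNC
      · rw [c3]; exact (hd 2).trans hNC
    · rw [coeff_eq_zero_of_natDegree_lt (by omega)]
      simp only [Int.cast_zero, abs_zero]
      exact hN0.le.trans hNC

/-! ### Consecutive minimal cubic polynomials -/

/-- `P` minimizes `|P(ξ)|` among nonzero cubic integer polynomials of height at most `N`, and `Q`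
is the next such polynomial taking a smaller value. -/
structure MinimalPair (ξ C N : ℝ) (P Q : ℤ[X]) : Prop where
  left_ne_zero : P ≠ 0
  right_ne_zero : Q ≠ 0
  left_natDegree_le : P.natDegree ≤ 3
  right_natDegree_le : Q.natDegree ≤ 3
  left_supNorm_le : P.supNorm ≤ N
  lt_right_supNorm : N < Q.supNorm
  aeval_lt : |aeval ξ Q| < |aeval ξ P|
  aeval_le : ∀ R : ℤ[X], R ≠ 0 → R.natDegree ≤ 3 → R.supNorm < Q.supNorm →
    |aeval ξ P| ≤ |aeval ξ R|
  aeval_mul_le : |aeval ξ P| * Q.supNorm ^ 3 ≤ C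

/-- `Q` has least height among the cubics with value smaller than that of `P`, so nothing of height
below `Q.supNorm` beats `P`. Comparison with a Dirichlet polynomial just below that height gives the
cubic decay. -/
theorem exists_minimalPair {ξ : ℝ} (hξ : Transcendental ℚ ξ) :
    ∃ C N₀ : ℝ, 0 < C ∧ 1 ≤ N₀ ∧ ∀ N, N₀ ≤ N → ∃ P Q : ℤ[X], MinimalPair ξ C N P Q := by
  obtain ⟨C, hC1, hC⟩ := exists_cubic_dirichlet ξ
  refine ⟨(4 * C) ^ 3, 4 * C, by positivity, by linarith, fun N hN => ?_⟩
  have hN1 : 1 ≤ N := by linarith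
  have hsN : ({P : ℤ[X] | P.natDegree ≤ 3 ∧ P.supNorm ≤ N} \ {0}).Finite :=
    (finite_supNorm_le 3 N).subset Set.sdiff_subset
  have hne : ({P : ℤ[X] | P.natDegree ≤ 3 ∧ P.supNorm ≤ N} \ {0}).Nonempty := by
    refine ⟨Polynomial.C 1, ⟨⟨by simp, ?_⟩, by simp⟩⟩
    rw [supNorm_C]
    simpa using hN1
  obtain ⟨P, ⟨⟨hPd, hPN⟩, hP0⟩, hPmin⟩ := Set.exists_min_image _ (fun P => |aeval ξ P|) hsN hne
  have hP0 : P ≠ 0 := hP0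
  have hPpos : 0 < |aeval ξ P| := abs_pos.mpr (aeval_int_ne_zero hξ hP0)
  obtain ⟨Q₀, hQ₀0, hQ₀d, hQ₀v⟩ : ∃ Q : ℤ[X], Q ≠ 0 ∧ Q.natDegree ≤ 3 ∧
      |aeval ξ Q| < |aeval ξ P| := by
    obtain ⟨n, hn⟩ := exists_nat_gt (1 / |aeval ξ P|)
    have hn0 : (0 : ℝ) < n := lt_trans (by positivity) hn
    have hn1 : 1 ≤ n := by exact_mod_cast hn0
    obtain ⟨Q, h0, hd, -, hv⟩ := hC n hn1
    refine ⟨Q, h0, hd, lt_of_le_of_lt hv ?_⟩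
    rw [div_lt_comm₀ (by positivity) hPpos]
    refine lt_of_lt_of_le hn ?_
    have : (1 : ℝ) ≤ n := by exact_mod_cast hn1
    exact le_self_pow₀ this (by norm_num)
  have hsQ : {Q : ℤ[X] | (Q.natDegree ≤ 3 ∧ Q.supNorm ≤ Q₀.supNorm) ∧ Q ≠ 0 ∧
      |aeval ξ Q| < |aeval ξ P|}.Finite :=
    (finite_supNorm_le 3 Q₀.supNorm).subset fun Q h => h.1
  obtain ⟨Q, ⟨⟨hQd, hQle⟩, hQ0, hQv⟩, hQmin⟩ := Set.exists_min_image _ (fun Q => Q.supNorm) hsQ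
    ⟨Q₀, ⟨hQ₀d, le_rfl⟩, hQ₀0, hQ₀v⟩
  have hNQ : N < Q.supNorm := by
    by_contra! h
    exact absurd (hPmin Q ⟨⟨hQd, h⟩, hQ0⟩) (not_le.mpr hQv)
  have hmin : ∀ R : ℤ[X], R ≠ 0 → R.natDegree ≤ 3 → R.supNorm < Q.supNorm →
      |aeval ξ P| ≤ |aeval ξ R| := by
    intro R hR0 hRd hRQ
    by_contra! h
    exact absurd (hQmin R ⟨⟨hRd, (hRQ.le.trans hQle)⟩, hR0, h⟩) (not_le.mpr hRQ)
  refine ⟨P, Q, hP0, hQ0, hPd, hQd, hPN, hNQ, hQv, hmin, ?_⟩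
  set h := Q.supNorm with hh
  have hh4 : 4 * C < h := by linarith
  have hC0 : 0 < C := by linarith
  have hpos : 0 < h := by linarith
  -- `C * n ≤ h / 2 < h` makes the Dirichlet polynomial a competitor of `P`, while `h / n ≤ 4 * C`
  -- produces the constant `(4 * C) ^ 3`.
  let n := ⌊h / (2 * C)⌋₊
  have hn2 : h / (2 * C) < n + 1 := Nat.lt_floor_add_one _
  have hn1 : (n : ℝ) ≤ h / (2 * C) := Nat.floor_le (by positivity)
  have h2 : 2 < h / (2 * C) := by rw [lt_div_iff₀ (by positivity)]; linarith
  have hn0 : 1 ≤ n := by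
    have : (1 : ℝ) < n := by linarith
    exact_mod_cast this.le
  have hn4 : h / (4 * C) ≤ n := by
    have : h / (4 * C) = h / (2 * C) / 2 := by field_simp; ring
    rw [this]; linarith
  obtain ⟨R, hR0, hRd, hRh, hRv⟩ := hC n hn0
  have hRQ : R.supNorm < h := by
    refine lt_of_le_of_lt hRh ?_
    calc C * n ≤ C * (h / (2 * C)) := by gcongr
      _ = h / 2 := by field_simp
      _ < h := by linarith
  have hle := (hmin R hR0 hRd hRQ).trans hRv
  have hnpos : (0 : ℝ) < n := by exact_mod_cast hn0
  calc |aeval ξ P| * h ^ 3 ≤ 1 / (n : ℝ) ^ 3 * h ^ 3 := by gcongr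
    _ = (h / n) ^ 3 := by field_simp
    _ ≤ (4 * C) ^ 3 := by
      have : h / n ≤ 4 * C := by
        rw [div_le_iff₀ hnpos]
        rw [div_le_iff₀ (by positivity)] at hn4
        linarith
      gcongr

/-! ### Short vectors in the lattice orthogonal to two integer vectors -/

/-- The `2 × 2` minors of a pair of vectors. -/
def minor₂ {ι : Type*} (u v : ι → ℤ) (i j : ι) : ℤ := u i * v j - u j * v i

/-- The `3 × 3` minors of a real vector and a pair of integer vectors. -/
def minor₃ {ι : Type*} (z : ι → ℝ) (u v : ι → ℤ) (i j k : ι) : ℝ :=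
  z i * minor₂ u v j k - z j * minor₂ u v i k + z k * minor₂ u v i j

theorem card_quotient_range_toLin' (A : Matrix (Fin 2) (Fin 2) ℤ) (hA : A.det ≠ 0) :
    Nat.card ((Fin 2 → ℤ) ⧸ LinearMap.range (Matrix.toLin' A)) = A.det.natAbs := by
  have hinj : Function.Injective (Matrix.toLin' A) := by
    rw [← LinearMap.ker_eq_bot, LinearMap.ker_eq_bot']
    intro m hm
    by_contra h
    exact hA (Matrix.exists_mulVec_eq_zero_iff.mp ⟨m, h, by simpa using hm⟩)
  have h := Submodule.natAbs_det_equiv (LinearMap.range (Matrix.toLin' A))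
    (LinearEquiv.ofInjective (Matrix.toLin' A) hinj)
  rw [← h, ← LinearMap.det_toLin' A]
  congr 2

/-- A double pigeonhole: the image of `A` has `|det A|` cosets, and `g` sorts into `K` boxes. -/
theorem exists_congruent_of_card_lt {α : Type*} [Fintype α] (A : Matrix (Fin 2) (Fin 2) ℤ)
    (hA : A.det ≠ 0) (f : α → Fin 2 → ℤ) {K : ℕ} (g : α → Fin K)
    (h : A.det.natAbs * K < Fintype.card α) :
    ∃ x y, x ≠ y ∧ g x = g y ∧ ∃ m : Fin 2 → ℤ, A.mulVec m = f x - f y := by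
  classical
  have hc := card_quotient_range_toLin' A hA
  have : Finite ((Fin 2 → ℤ) ⧸ LinearMap.range (Matrix.toLin' A)) := by
    apply Nat.finite_of_card_ne_zero
    rw [hc]
    simpa using hA
  have := Fintype.ofFinite ((Fin 2 → ℤ) ⧸ LinearMap.range (Matrix.toLin' A))
  let F : α → ((Fin 2 → ℤ) ⧸ LinearMap.range (Matrix.toLin' A)) × Fin K := fun x =>
    (Submodule.Quotient.mk (f x), g x)
  obtain ⟨x, y, hxy, hF⟩ := Fintype.exists_ne_map_eq_of_card_lt F (by
    rw [Fintype.card_prod, Fintype.card_fin, ← Nat.card_eq_fintype_card, hc]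
    exact h)
  have h1 := congrArg Prod.fst hF
  have h2 := congrArg Prod.snd hF
  obtain ⟨m, hm⟩ := (Submodule.Quotient.eq _).mp h1
  exact ⟨x, y, hxy, h2, m, by simpa using hm⟩

/-- Cramer's rule: eliminating `r 0` and `r 1` leaves the value at `z` as a combination of the free
coordinates `r 2` and `r 3`. -/
theorem minor₂_mul_sum (u v : Fin 4 → ℤ) (z : Fin 4 → ℝ) (r : Fin 4 → ℤ)
    (hu : ∑ i, r i * u i = 0) (hv : ∑ i, r i * v i = 0) :
    (minor₂ u v 0 1 : ℝ) * ∑ i, (r i : ℝ) * z i =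
      r 2 * minor₃ z u v 0 1 2 + r 3 * minor₃ z u v 0 1 3 := by
  have hu' : ((∑ i, r i * u i : ℤ) : ℝ) = 0 := by rw [hu]; simp
  have hv' : ((∑ i, r i * v i : ℤ) : ℝ) = 0 := by rw [hv]; simp
  simp only [Fin.sum_univ_four, minor₂, minor₃] at *
  push_cast at *
  linear_combination (v 1 * z 0 - v 0 * z 1) * hu' + (u 0 * z 1 - u 1 * z 0) * hv'

theorem abs_le_of_mul_eq {m a b x y : ℤ} {s : ℝ} (hm : m ≠ 0) (ha : |a| ≤ |m|) (hb : |b| ≤ |m|)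
    (hx : |(x : ℝ)| ≤ s) (hy : |(y : ℝ)| ≤ s) {t : ℤ} (h : m * t = a * x + b * y) :
    |(t : ℝ)| ≤ 2 * s := by
  have hm' : (0 : ℝ) < |(m : ℝ)| := by positivity
  have ha' : |(a : ℝ)| ≤ |(m : ℝ)| := by exact_mod_cast ha
  have hb' : |(b : ℝ)| ≤ |(m : ℝ)| := by exact_mod_cast hb
  have h' : (m : ℝ) * t = a * x + b * y := by exact_mod_cast h
  have h1 : |(m : ℝ)| * |(t : ℝ)| ≤ |(m : ℝ)| * (2 * s) := by
    rw [← abs_mul, h']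
    calc |(a : ℝ) * x + b * y| ≤ |(a : ℝ)| * |(x : ℝ)| + |(b : ℝ)| * |(y : ℝ)| := by
          rw [← abs_mul, ← abs_mul]; exact abs_add_le _ _
      _ ≤ |(m : ℝ)| * s + |(m : ℝ)| * s := by gcongr
      _ = _ := by ring
  exact le_of_mul_le_mul_left h1 hm'

/-- An orthogonal vector is determined by `(r 2, r 3)`, subject only to a congruence modulo the
image of a `2 × 2` matrix of determinant `D`. Pigeonholing pairs in `[0, s]²` by congruence class
and by value plays the part of Minkowski's theorem. -/
theorem exists_small_orthogonal_aux (u v : Fin 4 → ℤ) (z : Fin 4 → ℝ) {E : ℝ} (hE : 0 < E)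
    (hM : minor₂ u v 0 1 ≠ 0) (hmax : ∀ i j, |minor₂ u v i j| ≤ |minor₂ u v 0 1|)
    (h₂ : |minor₃ z u v 0 1 2| ≤ E) (h₃ : |minor₃ z u v 0 1 3| ≤ E) {s : ℕ} (hs : 1 ≤ s)
    (hsM : |(minor₂ u v 0 1 : ℝ)| ≤ (s : ℝ) ^ 2) :
    ∃ r : Fin 4 → ℤ, r ≠ 0 ∧ ∑ i, r i * u i = 0 ∧ ∑ i, r i * v i = 0 ∧
      (∀ i, |(r i : ℝ)| ≤ 2 * s) ∧ |∑ i, (r i : ℝ) * z i| ≤ 16 * E / s := by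
  set D := minor₂ u v 0 1 with hD
  set t₂ := minor₃ z u v 0 1 2 with ht₂
  set t₃ := minor₃ z u v 0 1 3 with ht₃
  have hs0 : (0 : ℝ) < s := by exact_mod_cast hs
  have hsM' : D.natAbs ≤ s ^ 2 := by
    have : ((D.natAbs : ℕ) : ℝ) ≤ (s : ℝ) ^ 2 := by rwa [Nat.cast_natAbs, Int.cast_abs]
    exact_mod_cast this
  have hDpos : 0 < D.natAbs := by simpa [Int.natAbs_pos] using hM
  let A : Matrix (Fin 2) (Fin 2) ℤ := !![u 0, u 1; v 0, v 1]
  have hAdet : A.det = D := by rw [Matrix.det_fin_two_of, hD, minor₂]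
  -- The `(s + 1) ^ 2` pairs outnumber the `|D| * K ≤ s ^ 2` pigeonholes.
  let K := s ^ 2 / D.natAbs
  have hK : 1 ≤ K := (Nat.one_le_div_iff hDpos).mpr hsM'
  have hK0 : (0 : ℝ) < K := by exact_mod_cast hK
  have hKD : D.natAbs * K ≤ s ^ 2 := Nat.mul_div_le _ _
  let w : Fin (s + 1) × Fin (s + 1) → ℝ := fun a => ((a.1 : ℕ) : ℝ) * t₂ + ((a.2 : ℕ) : ℝ) * t₃
  have hw : ∀ a, |w a| ≤ 2 * s * E := by
    intro a
    have h1 : ((a.1 : ℕ) : ℝ) ≤ s := by exact_mod_cast Nat.lt_succ_iff.mp a.1.2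
    have h2 : ((a.2 : ℕ) : ℝ) ≤ s := by exact_mod_cast Nat.lt_succ_iff.mp a.2.2
    calc |w a| ≤ ((a.1 : ℕ) : ℝ) * |t₂| + ((a.2 : ℕ) : ℝ) * |t₃| := by
          refine (abs_add_le _ _).trans ?_
          rw [abs_mul, abs_mul, Nat.abs_cast, Nat.abs_cast]
      _ ≤ s * E + s * E := by gcongr
      _ = _ := by ring
  have hden : 0 < 8 * s * E := by positivity
  -- The values fill an interval of length `4 * s * E`; dividing by twice this length keeps the
  -- floor strictly below `K`.
  have hlt : ∀ a, ⌊(w a + 2 * s * E) * K / (8 * s * E)⌋₊ < K := by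
    intro a
    have h1 := abs_le.mp (hw a)
    rw [Nat.floor_lt (by apply div_nonneg _ hden.le; apply mul_nonneg <;> linarith),
      div_lt_iff₀ hden]
    nlinarith
  obtain ⟨a, b, hab, hg, m, hm⟩ := exists_congruent_of_card_lt A (by rw [hAdet]; exact hM)
    (fun a : Fin (s + 1) × Fin (s + 1) => ![((a.1 : ℕ) : ℤ) * u 2 + ((a.2 : ℕ) : ℤ) * u 3,
      ((a.1 : ℕ) : ℤ) * v 2 + ((a.2 : ℕ) : ℤ) * v 3]) (fun a => ⟨_, hlt a⟩) (by
      rw [hAdet, Fintype.card_prod, Fintype.card_fin]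
      nlinarith)
  have hfl := congrArg Fin.val hg
  simp only at hfl
  have hm0 : u 0 * m 0 + u 1 * m 1 = ((a.1 : ℕ) : ℤ) * u 2 + ((a.2 : ℕ) : ℤ) * u 3
      - (((b.1 : ℕ) : ℤ) * u 2 + ((b.2 : ℕ) : ℤ) * u 3) := by
    have := congrFun hm 0
    simpa [A, Matrix.mulVec, dotProduct, Fin.sum_univ_two] using this
  have hm1 : v 0 * m 0 + v 1 * m 1 = ((a.1 : ℕ) : ℤ) * v 2 + ((a.2 : ℕ) : ℤ) * v 3
      - (((b.1 : ℕ) : ℤ) * v 2 + ((b.2 : ℕ) : ℤ) * v 3) := by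
    have := congrFun hm 1
    simpa [A, Matrix.mulVec, dotProduct, Fin.sum_univ_two] using this
  let x : ℤ := ((a.1 : ℕ) : ℤ) - ((b.1 : ℕ) : ℤ)
  let y : ℤ := ((a.2 : ℕ) : ℤ) - ((b.2 : ℕ) : ℤ)
  have hdiff : ∀ p q : Fin (s + 1), |((((p : ℕ) : ℤ) - ((q : ℕ) : ℤ) : ℤ) : ℝ)| ≤ s := by
    intro p q
    have h1 : ((p : ℕ) : ℝ) ≤ s := by exact_mod_cast Nat.lt_succ_iff.mp p.2
    have h2 : ((q : ℕ) : ℝ) ≤ s := by exact_mod_cast Nat.lt_succ_iff.mp q.2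
    have h3 : (0 : ℝ) ≤ ((p : ℕ) : ℝ) := by positivity
    have h4 : (0 : ℝ) ≤ ((q : ℕ) : ℝ) := by positivity
    push_cast
    rw [abs_le]
    constructor <;> linarith
  have hx : |(x : ℝ)| ≤ s := hdiff a.1 b.1
  have hy : |(y : ℝ)| ≤ s := hdiff a.2 b.2
  let r : Fin 4 → ℤ := ![-m 0, -m 1, x, y]
  have hru : ∑ i, r i * u i = 0 := by
    simp only [Fin.sum_univ_four, r, x, y, Matrix.cons_val]
    linear_combination -hm0
  have hrv : ∑ i, r i * v i = 0 := by
    simp only [Fin.sum_univ_four, r, x, y, Matrix.cons_val]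
    linear_combination -hm1
  -- Cramer's rule expresses `-m 0` and `-m 1` through `x` and `y` with coefficients minor over `D`,
  -- at most 1 in absolute value because `D` is the largest minor.
  have hr0 : |((-m 0 : ℤ) : ℝ)| ≤ 2 * s := by
    refine abs_le_of_mul_eq hM (hmax 1 2) (hmax 1 3) hx hy ?_
    simp only [hD, minor₂, x, y]
    linear_combination v 1 * (-hm0) + u 1 * hm1
  have hr1 : |((-m 1 : ℤ) : ℝ)| ≤ 2 * s := by
    refine abs_le_of_mul_eq hM (hmax 2 0) (hmax 3 0) hx hy ?_
    simp only [hD, minor₂, x, y]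
    linear_combination v 0 * hm0 - u 0 * hm1
  refine ⟨r, ?_, hru, hrv, ?_, ?_⟩
  · intro h0
    apply hab
    have h2 := congrFun h0 2
    have h3 := congrFun h0 3
    simp only [r, x, y, Matrix.cons_val, Pi.zero_apply] at h2 h3
    ext <;> omega
  · intro i
    fin_cases i
    · exact hr0
    · exact hr1
    · exact hx.trans (by linarith)
    · exact hy.trans (by linarith)
  · have key := minor₂_mul_sum u v z r hru hrv
    have hwd : (r 2 : ℝ) * minor₃ z u v 0 1 2 + r 3 * minor₃ z u v 0 1 3 = w a - w b := by
      simp only [r, x, y, w, Matrix.cons_val]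
      push_cast
      ring
    rw [hwd, ← hD] at key
    have hnn : ∀ c, 0 ≤ (w c + 2 * s * E) * K / (8 * s * E) := by
      intro c
      have h1 := abs_le.mp (hw c)
      apply div_nonneg _ hden.le
      apply mul_nonneg <;> linarith
    have ha1 := Nat.floor_le (hnn a)
    have hb1 := Nat.floor_le (hnn b)
    have ha2 := Nat.lt_floor_add_one ((w a + 2 * s * E) * K / (8 * s * E))
    have hb2 := Nat.lt_floor_add_one ((w b + 2 * s * E) * K / (8 * s * E))
    rw [hfl] at ha1 ha2
    have hwab : |w a - w b| * K ≤ 8 * s * E := by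
      rw [← abs_of_pos hK0, ← abs_mul, abs_le]
      have e1 : (w a + 2 * s * E) * K / (8 * s * E) - (w b + 2 * s * E) * K / (8 * s * E)
        = (w a - w b) * K / (8 * s * E) := by ring
      have l1 : (w a - w b) * K / (8 * s * E) < 1 := by rw [← e1]; linarith
      have l2 : -1 < (w a - w b) * K / (8 * s * E) := by rw [← e1]; linarith
      rw [div_lt_iff₀ hden] at l1
      rw [lt_div_iff₀ hden] at l2
      constructor <;> linarith
    -- `K` is a rounded quotient that is at least 1, so rounding costs at most a factor 2.
    have hKs : (s : ℝ) ^ 2 ≤ 2 * (|(D : ℝ)| * K) := by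
      have h1 : s ^ 2 < D.natAbs * (K + 1) := by
        have := Nat.lt_mul_div_succ (s ^ 2) hDpos
        simpa using this
      have h2 : s ^ 2 ≤ 2 * (D.natAbs * K) := by nlinarith
      have h3 : ((s ^ 2 : ℕ) : ℝ) ≤ ((2 * (D.natAbs * K) : ℕ) : ℝ) := by exact_mod_cast h2
      push_cast at h3
      rwa [Nat.cast_natAbs, Int.cast_abs] at h3
    have hfin : |(D : ℝ)| * K * |∑ i, (r i : ℝ) * z i| ≤ 8 * s * E := by
      calc _ = |(D : ℝ) * ∑ i, (r i : ℝ) * z i| * K := by rw [abs_mul]; ring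
        _ = |w a - w b| * K := by rw [key]
        _ ≤ _ := hwab
    rw [le_div_iff₀ hs0]
    have h1 : (s : ℝ) ^ 2 * |∑ i, (r i : ℝ) * z i| ≤ 16 * s * E := by
      have := mul_le_mul_of_nonneg_right hKs (abs_nonneg (∑ i, (r i : ℝ) * z i))
      nlinarith
    nlinarith [abs_nonneg (∑ i, (r i : ℝ) * z i)]

theorem exists_perm_fin_four : ∀ i j : Fin 4, i ≠ j → ∃ σ : Equiv.Perm (Fin 4), σ 0 = i ∧ σ 1 = j := by
  decide

/-- Short vectors with small value at `z` in the rank two lattice orthogonal to `u` and `v`. -/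
theorem exists_small_orthogonal (u v : Fin 4 → ℤ) (z : Fin 4 → ℝ) {E : ℝ} (hE : 0 < E)
    (hne : ∃ i j, minor₂ u v i j ≠ 0) (h₃ : ∀ i j k, |minor₃ z u v i j k| ≤ E) :
    ∃ i j, minor₂ u v i j ≠ 0 ∧
      (∀ s : ℕ, 1 ≤ s → |(minor₂ u v i j : ℝ)| ≤ (s : ℝ) ^ 2 →
        ∃ r : Fin 4 → ℤ, r ≠ 0 ∧ ∑ i, r i * u i = 0 ∧ ∑ i, r i * v i = 0 ∧
          (∀ i, |(r i : ℝ)| ≤ 2 * s) ∧ |∑ i, (r i : ℝ) * z i| ≤ 16 * E / s) ∧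
      (∀ (r : Fin 4 → ℤ) (B : ℝ), ∑ i, r i * u i = 0 → ∑ i, r i * v i = 0 →
        (∀ i, |(r i : ℝ)| ≤ B) → |(minor₂ u v i j : ℝ)| * |∑ i, (r i : ℝ) * z i| ≤ 2 * B * E) := by
  obtain ⟨⟨i, j⟩, hmax⟩ := Finite.exists_max (fun p : Fin 4 × Fin 4 => |minor₂ u v p.1 p.2|)
  have hM : minor₂ u v i j ≠ 0 := by
    obtain ⟨i', j', h'⟩ := hne
    have := hmax (i', j')
    simp only at this
    intro h0
    rw [h0, abs_zero, abs_nonpos_iff] at this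
    exact h' this
  have hij : i ≠ j := by
    rintro rfl
    apply hM
    simp [minor₂]
  -- Permuting coordinates brings the largest minor to position `(0, 1)`.
  obtain ⟨σ, rfl, rfl⟩ := exists_perm_fin_four i j hij
  refine ⟨σ 0, σ 1, hM, fun s hs hsM => ?_, fun r B hu hv hB => ?_⟩
  · obtain ⟨r, hr0, hru, hrv, hr, hrz⟩ := exists_small_orthogonal_aux (u ∘ σ) (v ∘ σ) (z ∘ σ) hE hM
      (fun i j => hmax (σ i, σ j)) (h₃ _ _ _) (h₃ _ _ _) hs hsM
    refine ⟨r ∘ σ.symm, ?_, ?_, ?_, fun i => hr _, ?_⟩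
    · intro h0
      apply hr0
      funext i
      simpa using congrFun h0 (σ i)
    · rw [← Equiv.sum_comp σ]; simpa using hru
    · rw [← Equiv.sum_comp σ]; simpa using hrv
    · rw [← Equiv.sum_comp σ]; simpa using hrz
  · rw [← Equiv.sum_comp σ] at hu hv ⊢
    have key := minor₂_mul_sum (u ∘ σ) (v ∘ σ) (z ∘ σ) (r ∘ σ) hu hv
    have key' : (minor₂ u v (σ 0) (σ 1) : ℝ) * ∑ i, (r (σ i) : ℝ) * z (σ i) =
      r (σ 2) * minor₃ z u v (σ 0) (σ 1) (σ 2) + r (σ 3) * minor₃ z u v (σ 0) (σ 1) (σ 3) := key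
    rw [← abs_mul, key']
    calc _ ≤ |(r (σ 2) : ℝ)| * |minor₃ z u v (σ 0) (σ 1) (σ 2)|
          + |(r (σ 3) : ℝ)| * |minor₃ z u v (σ 0) (σ 1) (σ 3)| := by
          rw [← abs_mul, ← abs_mul]; exact abs_add_le _ _
      _ ≤ B * E + B * E := by
        have hB0 : 0 ≤ B := (abs_nonneg _).trans (hB 0)
        gcongr
        · exact hB _
        · exact h₃ _ _ _
        · exact hB _
        · exact h₃ _ _ _
      _ = _ := by ring

/-! ### Integer points as functionals on polynomials of degree at most 4 -/

/-- The value at `P` of the linear functional sending `X ^ i` to `x i` for `i ≤ 4`. -/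
def pairing (x : ℕ → ℤ) (P : ℤ[X]) : ℤ := ∑ i ∈ Finset.range 5, P.coeff i * x i

/-- `x` approximates `x 0 • (1, ξ, …, ξ ^ 4)` with error at most `L`. -/
def IsApprox (ξ : ℝ) (x : ℕ → ℤ) (L : ℝ) : Prop :=
  1 ≤ x 0 ∧ ∀ i < 5, |ξ ^ i * x 0 - x i| ≤ L

theorem IsApprox.nonneg {ξ L : ℝ} {x : ℕ → ℤ} (h : IsApprox ξ x L) : 0 ≤ L :=
  (abs_nonneg _).trans (h.2 0 (by norm_num))

theorem IsApprox.mono {ξ L L' : ℝ} {x : ℕ → ℤ} (h : IsApprox ξ x L) (hL : L ≤ L') :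
    IsApprox ξ x L' := ⟨h.1, fun i hi => (h.2 i hi).trans hL⟩

theorem abs_pairing_sub_le {ξ L : ℝ} {x : ℕ → ℤ} (h : IsApprox ξ x L) {P : ℤ[X]}
    (hP : P.natDegree ≤ 4) : |(pairing x P : ℝ) - x 0 * aeval ξ P| ≤ 5 * P.supNorm * L := by
  have e : (pairing x P : ℝ) - x 0 * aeval ξ P
      = ∑ i ∈ Finset.range 5, (P.coeff i : ℝ) * (x i - ξ ^ i * x 0) := by
    rw [aeval_eq_sum_range' (n := 5) (by omega), pairing]
    push_cast
    rw [Finset.mul_sum, ← Finset.sum_sub_distrib]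
    refine Finset.sum_congr rfl fun i _ => ?_
    simp only [zsmul_eq_mul]
    ring
  rw [e]
  calc _ ≤ ∑ i ∈ Finset.range 5, |(P.coeff i : ℝ) * (x i - ξ ^ i * x 0)| :=
        Finset.abs_sum_le_sum_abs _ _
    _ ≤ ∑ i ∈ Finset.range 5, P.supNorm * L := by
        refine Finset.sum_le_sum fun i hi => ?_
        rw [abs_mul, abs_sub_comm]
        exact mul_le_mul (abs_coeff_le_supNorm P i) (h.2 i (Finset.mem_range.mp hi))
          (abs_nonneg _) P.supNorm_nonneg
    _ = _ := by simp; ring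

theorem supNorm_X_pow_mul_le (P : ℤ[X]) (j : ℕ) : (X ^ j * P).supNorm ≤ P.supNorm := by
  refine supNorm_le_of_coeff fun i => ?_
  rw [coeff_X_pow_mul']
  split_ifs
  · exact abs_coeff_le_supNorm P _
  · simpa using P.supNorm_nonneg

theorem abs_pow_le_one_add (ξ : ℝ) {i n : ℕ} (h : i ≤ n) : |ξ| ^ i ≤ (1 + |ξ|) ^ n := by
  have h0 := abs_nonneg ξ
  exact (pow_le_pow_left₀ h0 (by linarith) i).trans (pow_le_pow_right₀ (by linarith) h)

/-- An integer of absolute value below 1 is zero. The shift by `X ^ j` does not increase the height,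
and multiplies the value at `ξ` by at most `(1 + |ξ|) ^ 4`. -/
theorem pairing_X_pow_mul_eq_zero {ξ L : ℝ} {x : ℕ → ℤ} (h : IsApprox ξ x L) {P : ℤ[X]} {j : ℕ}
    (hj : j + P.natDegree ≤ 4)
    (hlt : x 0 * ((1 + |ξ|) ^ 4 * |aeval ξ P|) + 5 * P.supNorm * L < 1) :
    pairing x (X ^ j * P) = 0 := by
  have hdeg : (X ^ j * P).natDegree ≤ 4 := natDegree_mul_le.trans (by rwa [natDegree_X_pow])
  have h1 := abs_pairing_sub_le h hdeg
  have hL := h.nonneg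
  have hx0 : (0 : ℝ) ≤ x 0 := by exact_mod_cast zero_le_one.trans h.1
  have h2 : 5 * (X ^ j * P).supNorm * L ≤ 5 * P.supNorm * L := by
    gcongr
    exact supNorm_X_pow_mul_le P j
  have h3 : |(x 0 : ℝ) * aeval ξ (X ^ j * P)| ≤ x 0 * ((1 + |ξ|) ^ 4 * |aeval ξ P|) := by
    rw [map_mul, map_pow, aeval_X, abs_mul, abs_mul, abs_pow, abs_of_nonneg hx0]
    gcongr
    exact abs_pow_le_one_add ξ (by omega)
  have h4 : |(pairing x (X ^ j * P) : ℝ)| < 1 := by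
    have := abs_sub_abs_le_abs_sub (pairing x (X ^ j * P) : ℝ) (x 0 * aeval ξ (X ^ j * P))
    linarith
  exact Int.abs_lt_one_iff.mp (by exact_mod_cast h4)

/-- The rational extension of `pairing`. -/
noncomputable def pairingRat (x : ℕ → ℤ) : ℚ[X] →ₗ[ℚ] ℚ :=
  ∑ i ∈ Finset.range 5, (x i : ℚ) • lcoeff ℚ i

theorem pairingRat_map (x : ℕ → ℤ) (P : ℤ[X]) :
    pairingRat x (P.map (Int.castRingHom ℚ)) = pairing x P := by
  simp [pairingRat, pairing, mul_comm]

theorem pairingRat_X_pow (x : ℕ → ℤ) {i : ℕ} (hi : i < 5) : pairingRat x (X ^ i) = x i := by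
  simp only [pairingRat, LinearMap.sum_apply, LinearMap.smul_apply, lcoeff_apply, coeff_X_pow,
    smul_eq_mul, mul_ite, mul_one, mul_zero]
  rw [Finset.sum_ite_eq' (Finset.range 5) i (fun j => (x j : ℚ)), if_pos (Finset.mem_range.mpr hi)]

theorem pairingRat_mul_eq_zero {x : ℕ → ℤ} {P : ℤ[X]} {n : ℕ}
    (h : ∀ j ≤ n, pairing x (X ^ j * P) = 0) {A : ℚ[X]} (hA : A.natDegree ≤ n) :
    pairingRat x (A * P.map (Int.castRingHom ℚ)) = 0 := by
  rw [A.as_sum_range_C_mul_X_pow, Finset.sum_mul, map_sum]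
  refine Finset.sum_eq_zero fun j hj => ?_
  have hj' : j ≤ n := by have := Finset.mem_range.mp hj; omega
  have e : C (A.coeff j) * X ^ j * P.map (Int.castRingHom ℚ)
      = A.coeff j • (X ^ j * P).map (Int.castRingHom ℚ) := by
    rw [Polynomial.map_mul, Polynomial.map_pow, map_X, smul_eq_C_mul, mul_assoc]
  rw [e, map_smul, pairingRat_map, h j hj']
  simp

theorem natDegree_map_rat (P : ℤ[X]) : (P.map (Int.castRingHom ℚ)).natDegree = P.natDegree :=
  natDegree_map_eq_of_injective (Int.castRingHom ℚ).injective_int P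

theorem map_rat_eq_zero_iff {P : ℤ[X]} : P.map (Int.castRingHom ℚ) = 0 ↔ P = 0 :=
  Polynomial.map_eq_zero_iff (Int.castRingHom ℚ).injective_int

/-- The listed multiples span all polynomials of degree at most 4 over `ℚ`: in a Bézout relation for
`X ^ i`, reduce the cofactor of `Q` modulo `P`; the degree of the cofactor of `P` is then forced to
be small. -/
theorem eq_zero_of_pairing_eq_zero {x : ℕ → ℤ} {P Q : ℤ[X]}
    (hc : IsCoprime (P.map (Int.castRingHom ℚ)) (Q.map (Int.castRingHom ℚ)))
    (hP1 : 1 ≤ P.natDegree) (hdeg : P.natDegree + Q.natDegree ≤ 5) (hP4 : P.natDegree ≤ 4)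
    (hP : ∀ j, j + P.natDegree ≤ 4 → pairing x (X ^ j * P) = 0)
    (hQ : ∀ j, j + 1 ≤ P.natDegree → pairing x (X ^ j * Q) = 0) {i : ℕ} (hi : i < 5) : x i = 0 := by
  obtain ⟨U, V, hUV⟩ := hc
  set p := P.map (Int.castRingHom ℚ) with hp
  set q := Q.map (Int.castRingHom ℚ) with hq
  have hpd : p.natDegree = P.natDegree := natDegree_map_rat P
  have hqd : q.natDegree = Q.natDegree := natDegree_map_rat Q
  let B : ℚ[X] := (V * X ^ i) % p
  let A : ℚ[X] := U * X ^ i + q * ((V * X ^ i) / p)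
  have hB : B.natDegree < p.natDegree := natDegree_mod_lt _ (by omega)
  have hAB : A * p + B * q = X ^ i := by
    have h1 := EuclideanDomain.div_add_mod (V * X ^ i) p
    calc A * p + B * q = U * p * X ^ i + (p * ((V * X ^ i) / p) + (V * X ^ i) % p) * q := by
          simp only [A, B]; ring
      _ = (U * p + V * q) * X ^ i := by rw [h1]; ring
      _ = X ^ i := by rw [hUV, one_mul]
  have hp0 : p ≠ 0 := by
    intro h0
    rw [h0, natDegree_zero] at hpd
    omega
  have hA : A.natDegree ≤ 4 - P.natDegree := by
    by_cases hA0 : A = 0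
    · simp [hA0]
    have h1 : (A * p).natDegree ≤ 4 := by
      rw [eq_sub_of_add_eq hAB]
      refine (natDegree_sub_le _ _).trans (max_le ?_ ?_)
      · rw [natDegree_X_pow]; omega
      · exact natDegree_mul_le.trans (by omega)
    rw [natDegree_mul hA0 hp0, hpd] at h1
    omega
  have h1 := pairingRat_mul_eq_zero (x := x) (P := P) (n := 4 - P.natDegree)
    (fun j hj => hP j (by omega)) hA
  have h2 := pairingRat_mul_eq_zero (x := x) (P := Q) (n := P.natDegree - 1)
    (fun j hj => hQ j (by omega)) (A := B) (by omega)
  have h3 := pairingRat_X_pow x hi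
  rw [← hAB, map_add, h1, h2, add_zero] at h3
  exact_mod_cast h3.symm

/-! ### Independence of multiples of coprime polynomials and the Sylvester determinant -/

/-- By coprimality `P` divides `V` over `ℚ`, which the degrees allow only for `V = 0`. -/
theorem eq_zero_of_mul_add_mul_eq_zero {P Q U V : ℤ[X]}
    (hc : IsCoprime (P.map (Int.castRingHom ℚ)) (Q.map (Int.castRingHom ℚ)))
    (hV : V.natDegree < P.natDegree) (h : U * P + V * Q = 0) : U = 0 ∧ V = 0 := by
  have hP0 : P ≠ 0 := by rintro rfl; simp at hV
  have hV0 : V = 0 := by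
    by_contra hV0
    have h1 : P.map (Int.castRingHom ℚ) ∣
        V.map (Int.castRingHom ℚ) * Q.map (Int.castRingHom ℚ) := by
      rw [← Polynomial.map_mul, eq_neg_of_add_eq_zero_right h, ← neg_mul, Polynomial.map_mul]
      exact dvd_mul_left _ _
    have h2 := natDegree_le_of_dvd (hc.dvd_of_dvd_mul_right h1) (map_rat_eq_zero_iff.not.mpr hV0)
    rw [natDegree_map_rat, natDegree_map_rat] at h2
    omega
  rw [hV0, zero_mul, add_zero] at h
  exact ⟨(mul_eq_zero.mp h).resolve_right hP0, hV0⟩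

theorem det_coeff_ne_zero {n : ℕ} (F : Fin n → ℤ[X]) (hdeg : ∀ i, (F i).natDegree < n)
    (hind : ∀ c : Fin n → ℤ, ∑ i, C (c i) * F i = 0 → c = 0) :
    (Matrix.of fun i j : Fin n => (F i).coeff j).det ≠ 0 := by
  intro h0
  obtain ⟨c, hc, hc0⟩ := Matrix.exists_vecMul_eq_zero_iff.mpr h0
  refine hc (hind c ?_)
  ext k
  rw [finsetSum_coeff, coeff_zero]
  simp only [coeff_C_mul]
  by_cases hk : k < n
  · have := congrFun hc0 ⟨k, hk⟩
    simpa [Matrix.vecMul, dotProduct] using this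
  · refine Finset.sum_eq_zero fun i _ => ?_
    rw [coeff_eq_zero_of_natDegree_lt (by have := hdeg i; omega), mul_zero]

theorem natDegree_X_pow_mul_le {P : ℤ[X]} {j n : ℕ} (h : j + P.natDegree ≤ n) :
    (X ^ j * P).natDegree ≤ n := natDegree_mul_le.trans (by rwa [natDegree_X_pow])

/-- Two functionals that vanish on `P, X P, Q, X Q` are proportional. -/
theorem mul_eq_mul_of_pairing_eq_zero {x x' : ℕ → ℤ} {P Q : ℤ[X]}
    (hc : IsCoprime (P.map (Int.castRingHom ℚ)) (Q.map (Int.castRingHom ℚ)))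
    (hPd : P.natDegree = 3) (hQd : Q.natDegree ≤ 3) (hx0 : x 0 ≠ 0)
    (hP : ∀ j < 2, pairing x (X ^ j * P) = 0) (hQ : ∀ j < 2, pairing x (X ^ j * Q) = 0)
    (hP' : ∀ j < 2, pairing x' (X ^ j * P) = 0) (hQ' : ∀ j < 2, pairing x' (X ^ j * Q) = 0)
    {i : ℕ} (hi : i < 5) : x 0 * x' i = x' 0 * x i := by
  let F : Fin 5 → ℤ[X] := ![X ^ 0 * P, X ^ 1 * P, X ^ 0 * Q, X ^ 1 * Q, 1]
  have hdet := det_coeff_ne_zero F (by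
    intro i
    refine Nat.lt_succ_of_le ?_
    fin_cases i
    · exact natDegree_X_pow_mul_le (by omega)
    · exact natDegree_X_pow_mul_le (by omega)
    · exact natDegree_X_pow_mul_le (by omega)
    · exact natDegree_X_pow_mul_le (by omega)
    · simp [F]) (by
    intro c hsum
    -- The functional `x` kills the four multiples of `P` and `Q` but takes the value `x 0 ≠ 0` at
    -- the polynomial 1.
    have h4 : c 4 = 0 := by
      have h := congrArg (pairingRat x) (congrArg (Polynomial.map (Int.castRingHom ℚ)) hsum)
      rw [pairingRat_map, pairingRat_map] at h
      have hlin : pairing x (∑ i, C (c i) * F i) = ∑ i, c i * pairing x (F i) := by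
        simp only [pairing, finsetSum_coeff, coeff_C_mul, Finset.mul_sum, Finset.sum_mul]
        rw [Finset.sum_comm]
        exact Finset.sum_congr rfl fun i _ => Finset.sum_congr rfl fun j _ => by ring
      rw [hlin] at h
      have e1 : pairing x 1 = x 0 := by simp [pairing, coeff_one]
      have e0 : pairing x 0 = 0 := by simp [pairing]
      simp only [Fin.sum_univ_five, F, Matrix.cons_val, hP 0 (by norm_num), hP 1 (by norm_num),
        hQ 0 (by norm_num), hQ 1 (by norm_num), e1, e0, mul_zero, zero_add] at h
      have h' : c 4 * x 0 = 0 := by exact_mod_cast h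
      exact (mul_eq_zero.mp h').resolve_right hx0
    have hUV : (C (c 0) + C (c 1) * X) * P + (C (c 2) + C (c 3) * X) * Q = 0 := by
      rw [← hsum]
      simp only [Fin.sum_univ_five, F, Matrix.cons_val, h4, C_0]
      ring
    obtain ⟨hU, hV⟩ := eq_zero_of_mul_add_mul_eq_zero hc (by
      have : (C (c 2) + C (c 3) * X : ℤ[X]).natDegree ≤ 1 := by compute_degree
      omega) hUV
    have co : ∀ a b : ℤ, (C a + C b * X : ℤ[X]) = 0 → a = 0 ∧ b = 0 := by
      intro a b h
      have h0 := congrArg (fun p => coeff p 0) h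
      have h1 := congrArg (fun p => coeff p 1) h
      simp only [coeff_add, coeff_C_mul, coeff_X, coeff_C, coeff_zero] at h0 h1
      constructor
      · simpa using h0
      · simpa using h1
    obtain ⟨h0, h1⟩ := co _ _ hU
    obtain ⟨h2, h3⟩ := co _ _ hV
    funext i
    fin_cases i <;> assumption)
  -- The combination `x 0 • x' - x' 0 • x` is annihilated by all five independent rows: by 1 by
  -- construction, by the others by hypothesis.
  have hz := Matrix.eq_zero_of_mulVec_eq_zero hdet (v := fun i : Fin 5 => x 0 * x' i - x' 0 * x i) (by
    funext k
    have hk : ∀ G : ℤ[X], ∑ i : Fin 5, G.coeff i * (x 0 * x' i - x' 0 * x i)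
        = x 0 * pairing x' G - x' 0 * pairing x G := by
      intro G
      rw [pairing, pairing, Finset.sum_range, Finset.sum_range, Finset.mul_sum, Finset.mul_sum,
        ← Finset.sum_sub_distrib]
      exact Finset.sum_congr rfl fun i _ => by ring
    have e1 : ∀ y, pairing y 1 = y 0 := fun y => by
      simp [pairing, coeff_one]
    simp only [Matrix.mulVec, dotProduct, Matrix.of_apply, Pi.zero_apply]
    rw [hk]
    fin_cases k
    · change x 0 * pairing x' (X ^ 0 * P) - x' 0 * pairing x (X ^ 0 * P) = 0
      rw [hP 0 (by norm_num), hP' 0 (by norm_num)]; ring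
    · change x 0 * pairing x' (X ^ 1 * P) - x' 0 * pairing x (X ^ 1 * P) = 0
      rw [hP 1 (by norm_num), hP' 1 (by norm_num)]; ring
    · change x 0 * pairing x' (X ^ 0 * Q) - x' 0 * pairing x (X ^ 0 * Q) = 0
      rw [hQ 0 (by norm_num), hQ' 0 (by norm_num)]; ring
    · change x 0 * pairing x' (X ^ 1 * Q) - x' 0 * pairing x (X ^ 1 * Q) = 0
      rw [hQ 1 (by norm_num), hQ' 1 (by norm_num)]; ring
    · change x 0 * pairing x' 1 - x' 0 * pairing x 1 = 0
      rw [e1, e1]; ring)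
  have := congrFun hz ⟨i, hi⟩
  simpa [sub_eq_zero] using this

/-- A Liouville type inequality from the Sylvester determinant of two coprime polynomials. -/
theorem one_le_mul_abs_aeval {ξ : ℝ} {P Q : ℤ[X]}
    (hc : IsCoprime (P.map (Int.castRingHom ℚ)) (Q.map (Int.castRingHom ℚ)))
    (hPd : P.natDegree = 3) (hQd : Q.natDegree ≤ 3) (hQ0 : Q ≠ 0) (hP : aeval ξ P ≠ 0)
    (hQP : |aeval ξ Q| ≤ |aeval ξ P|) (hH : P.supNorm ≤ Q.supNorm) :
    1 ≤ 720 * (1 + |ξ|) ^ 24 * (P.supNorm ^ 2 * Q.supNorm ^ 3 * |aeval ξ P|) := by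
  have hP0 : P ≠ 0 := by rintro rfl; simp at hPd
  set h := P.supNorm with hh
  set k := Q.supNorm with hk
  have hh1 : 1 ≤ h := one_le_supNorm hP0
  have hk1 : 1 ≤ k := one_le_supNorm hQ0
  set e := |aeval ξ P| with he
  have he0 : 0 < e := abs_pos.mpr hP
  let F : Fin 6 → ℤ[X] := ![X ^ 0 * P, X ^ 1 * P, X ^ 2 * P, X ^ 0 * Q, X ^ 1 * Q, X ^ 2 * Q]
  have hFdeg : ∀ i, (F i).natDegree ≤ 5 := by
    intro i
    fin_cases i <;> exact natDegree_X_pow_mul_le (by omega)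
  have hdet := det_coeff_ne_zero F (fun i => Nat.lt_succ_of_le (hFdeg i)) (by
    intro c hsum
    have hUV : (C (c 0) + C (c 1) * X + C (c 2) * X ^ 2) * P
        + (C (c 3) + C (c 4) * X + C (c 5) * X ^ 2) * Q = 0 := by
      rw [← hsum]
      simp only [Fin.sum_univ_six, F, Matrix.cons_val]
      ring
    obtain ⟨hU, hV⟩ := eq_zero_of_mul_add_mul_eq_zero hc (by
      have : (C (c 3) + C (c 4) * X + C (c 5) * X ^ 2 : ℤ[X]).natDegree ≤ 2 := by compute_degree
      omega) hUV
    have co : ∀ a b d : ℤ, (C a + C b * X + C d * X ^ 2 : ℤ[X]) = 0 → a = 0 ∧ b = 0 ∧ d = 0 := by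
      intro a b d h
      have h0 := congrArg (fun p => coeff p 0) h
      have h1 := congrArg (fun p => coeff p 1) h
      have h2 := congrArg (fun p => coeff p 2) h
      simp only [coeff_add, coeff_C_mul, coeff_X, coeff_C, coeff_zero, coeff_X_pow] at h0 h1 h2
      refine ⟨?_, ?_, ?_⟩
      · simpa using h0
      · simpa using h1
      · simpa using h2
    obtain ⟨h0, h1, h2⟩ := co _ _ _ hU
    obtain ⟨h3, h4, h5⟩ := co _ _ _ hV
    funext i
    fin_cases i <;> assumption)
  set S := (Matrix.of fun i j : Fin 6 => (F i).coeff j) with hS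
  let SR : Matrix (Fin 6) (Fin 6) ℝ := S.map (Int.castRingHom ℝ)
  have hSR : SR.det = (S.det : ℝ) := (RingHom.map_det (Int.castRingHom ℝ) S).symm
  -- Adding `ξ ^ j` times column `j` to column 0 replaces the constant coefficients by values at `ξ`
  -- and keeps the determinant.
  let T := SR.updateCol 0 (fun i => aeval ξ (F i))
  have hT : T.det = (S.det : ℝ) := by
    have h1 := Matrix.det_updateCol_sum SR 0 (fun j : Fin 6 => ξ ^ (j : ℕ))
    simp only [Fin.val_zero, pow_zero, one_smul] at h1
    rw [← hSR, ← h1]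
    have hfun : (fun i => aeval ξ (F i)) = fun k => ∑ i : Fin 6, ξ ^ (i : ℕ) • SR k i := by
      funext i
      rw [aeval_eq_sum_range' (n := 6) (Nat.lt_succ_of_le (hFdeg i)), Finset.sum_range]
      refine Finset.sum_congr rfl fun j _ => ?_
      simp [SR, S, mul_comm]
    simp only [T, hfun]
  -- This scaling makes every entry at most `K`. In column 0 the rows of `Q` use both `|Q(ξ)| ≤ e`
  -- and `h ≤ k`. The bound `6! * K ^ 6` for the determinant then gives the constant.
  let row : Fin 6 → ℝ := ![h⁻¹, h⁻¹, h⁻¹, k⁻¹, k⁻¹, k⁻¹]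
  let col : Fin 6 → ℝ := ![h / e, 1, 1, 1, 1, 1]
  let B : Matrix (Fin 6) (Fin 6) ℝ := Matrix.of fun i j => col j * (row i * T i j)
  have hBdet : B.det = (h / e) * ((h⁻¹) ^ 3 * (k⁻¹) ^ 3 * (S.det : ℝ)) := by
    have e1 : B.det = (∏ j, col j) * (Matrix.of fun i j => row i * T i j).det :=
      Matrix.det_mul_row col _
    rw [e1, Matrix.det_mul_column, hT]
    simp only [Fin.prod_univ_six, row, col, Matrix.cons_val]
    ring
  set K := (1 + |ξ|) ^ 4 with hK
  have hK1 : 1 ≤ K := one_le_pow₀ (by linarith [abs_nonneg ξ])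
  have hcol0 : ∀ j < 3, |ξ| ^ j ≤ K := fun j hj => abs_pow_le_one_add ξ (by omega)
  have hPcol : ∀ j < 3, |h / e * (h⁻¹ * aeval ξ (X ^ j * P))| ≤ K := by
    intro j hj
    rw [map_mul, map_pow, aeval_X, abs_mul, abs_mul, abs_mul, abs_pow, ← he,
      abs_of_pos (show 0 < h / e by positivity), abs_of_pos (show 0 < h⁻¹ by positivity)]
    calc _ = |ξ| ^ j := by field_simp
      _ ≤ K := hcol0 j hj
  have hQcol : ∀ j < 3, |h / e * (k⁻¹ * aeval ξ (X ^ j * Q))| ≤ K := by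
    intro j hj
    rw [map_mul, map_pow, aeval_X, abs_mul, abs_mul, abs_mul, abs_pow,
      abs_of_pos (show 0 < h / e by positivity), abs_of_pos (show 0 < k⁻¹ by positivity)]
    calc _ ≤ h / e * (h⁻¹ * (|ξ| ^ j * e)) := by gcongr
      _ = |ξ| ^ j := by field_simp
      _ ≤ K := hcol0 j hj
  have hent : ∀ (G : ℤ[X]) (j n : ℕ) (t : ℝ), G.supNorm = t → 1 ≤ t →
      |t⁻¹ * ((X ^ j * G).coeff n : ℝ)| ≤ K := by
    rintro G j n t ht ht1
    rw [abs_mul, abs_of_pos (show 0 < t⁻¹ by positivity), inv_mul_le_iff₀ (by linarith)]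
    have h1 := (abs_coeff_le_supNorm (X ^ j * G) n).trans (supNorm_X_pow_mul_le G j)
    rw [ht] at h1
    nlinarith
  have hB : ∀ i j, |B i j| ≤ K := by
    intro i j
    by_cases hj : j = 0
    · subst hj
      change |h / e * (row i * T i 0)| ≤ K
      have hTi : T i 0 = aeval ξ (F i) := by simp [T]
      rw [hTi]
      fin_cases i
      · exact hPcol 0 (by norm_num)
      · exact hPcol 1 (by norm_num)
      · exact hPcol 2 (by norm_num)
      · exact hQcol 0 (by norm_num)
      · exact hQcol 1 (by norm_num)
      · exact hQcol 2 (by norm_num)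
    · have hTi : T i j = ((F i).coeff j : ℝ) := by simp [T, hj, SR, S]
      have hcol : col j = 1 := by
        fin_cases j
        · exact (hj rfl).elim
        all_goals rfl
      change |col j * (row i * T i j)| ≤ K
      rw [hcol, one_mul, hTi]
      fin_cases i
      · exact hent P 0 j h rfl hh1
      · exact hent P 1 j h rfl hh1
      · exact hent P 2 j h rfl hh1
      · exact hent Q 0 j k rfl hk1
      · exact hent Q 1 j k rfl hk1
      · exact hent Q 2 j k rfl hk1
  have hle := Matrix.det_le (A := B) (abv := AbsoluteValue.abs) (x := K) hB
  rw [Fintype.card_fin, AbsoluteValue.abs_apply, hBdet] at hle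
  have hdet1 : (1 : ℝ) ≤ |(S.det : ℝ)| := by
    have := Int.one_le_abs hdet
    exact_mod_cast this
  have hfac : Nat.factorial 6 = 720 := rfl
  rw [hfac, abs_mul, abs_mul, abs_of_pos (show 0 < h / e by positivity),
    abs_of_pos (show 0 < h⁻¹ ^ 3 * k⁻¹ ^ 3 by positivity), hK, ← pow_mul] at hle
  have hle2 : h / e * (h⁻¹ ^ 3 * k⁻¹ ^ 3) ≤ 720 * (1 + |ξ|) ^ 24 := by
    have h3 : h / e * (h⁻¹ ^ 3 * k⁻¹ ^ 3 * 1) ≤ h / e * (h⁻¹ ^ 3 * k⁻¹ ^ 3 * |(S.det : ℝ)|) := by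
      gcongr
    rw [mul_one] at h3
    refine h3.trans (hle.trans (le_of_eq ?_))
    norm_num
  calc (1 : ℝ) = h / e * (h⁻¹ ^ 3 * k⁻¹ ^ 3) * (h ^ 2 * k ^ 3 * e) := by field_simp
    _ ≤ _ := by gcongr

/-! ### Comparison of height and Mahler measure -/

/-- The Mahler measure of an integer polynomial. -/
noncomputable def intMahler (P : ℤ[X]) : ℝ := (P.map (Int.castRingHom ℂ)).mahlerMeasure

theorem supNorm_map_complex (P : ℤ[X]) : (P.map (Int.castRingHom ℂ)).supNorm = P.supNorm := by
  rw [supNorm_eq_iSup, supNorm_eq_iSup]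
  congr 1
  funext i
  simp [Int.norm_eq_abs]

theorem natDegree_map_complex (P : ℤ[X]) : (P.map (Int.castRingHom ℂ)).natDegree = P.natDegree :=
  natDegree_map_eq_of_injective (Int.castRingHom ℂ).injective_int P

theorem intMahler_mul (P Q : ℤ[X]) : intMahler (P * Q) = intMahler P * intMahler Q := by
  rw [intMahler, Polynomial.map_mul, mahlerMeasure_mul, intMahler, intMahler]

theorem one_le_intMahler {P : ℤ[X]} (hP : P ≠ 0) : 1 ≤ intMahler P :=
  one_le_mahlerMeasure_of_ne_zero hP

/-- The factor is `√(deg P + 1) ≤ √4`. -/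
theorem intMahler_le {P : ℤ[X]} (hP : P.natDegree ≤ 3) : intMahler P ≤ 2 * P.supNorm := by
  have h := mahlerMeasure_le_sqrt_natDegree_add_one_mul_supNorm (P.map (Int.castRingHom ℂ))
  rw [supNorm_map_complex, natDegree_map_complex] at h
  refine h.trans ?_
  have h2 : √((P.natDegree : ℝ) + 1) ≤ 2 := by
    rw [Real.sqrt_le_left (by norm_num)]
    have : (P.natDegree : ℝ) ≤ 3 := by exact_mod_cast hP
    linarith
  exact mul_le_mul_of_nonneg_right h2 P.supNorm_nonneg

/-- The factor 3 is the largest binomial coefficient in degree at most 3. With multiplicativity of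
the Mahler measure, this makes heights multiplicative up to constants. -/
theorem supNorm_le_intMahler {P : ℤ[X]} (hP : P.natDegree ≤ 3) : P.supNorm ≤ 3 * intMahler P := by
  have h := supNorm_le_choose_natDegree_div_two_mul_mahlerMeasure (P.map (Int.castRingHom ℂ))
  rw [supNorm_map_complex, natDegree_map_complex] at h
  refine h.trans ?_
  have h2 : (P.natDegree.choose (P.natDegree / 2) : ℝ) ≤ 3 := by
    have : P.natDegree.choose (P.natDegree / 2) ≤ 3 := by
      interval_cases P.natDegree <;> decide
    exact_mod_cast this
  exact mul_le_mul_of_nonneg_right h2 (mahlerMeasure_nonneg _)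

/-! ### Lower bounds for values of polynomials of degree at most 2 -/

theorem eventually_mul_rpow_neg_lt (A : ℝ) {δ ε : ℝ} (hδ : 0 < δ) (hε : 0 < ε) :
    ∀ᶠ t : ℝ in atTop, A * t ^ (-δ) < ε := by
  have h := (tendsto_rpow_neg_atTop hδ).const_mul A
  rw [mul_zero] at h
  exact h.eventually_lt_const hε

theorem exists_isApprox_of_solvable {ξ l X : ℝ} (hX : 1 ≤ X)
    (h : SimultaneousSolvable 4 ξ l X) :
    ∃ x : ℕ → ℤ, (x 0 : ℝ) ≤ X ∧ IsApprox ξ x (X ^ (-l)) := by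
  obtain ⟨x, y, h1, h2, h3⟩ := h
  -- Indices above 4 receive the default `x`; `IsApprox` does not constrain them.
  refine ⟨fun i => if h : 1 ≤ i ∧ i < 5 then y ⟨i - 1, by omega⟩ else x, by simpa using h2,
    by simpa using h1, fun i hi => ?_⟩
  rcases Nat.eq_zero_or_pos i with rfl | hi0
  · simp
    positivity
  · have := h3 ⟨i - 1, by omega⟩
    simp only [show i - 1 + 1 = i by omega] at this
    simp [hi, Nat.one_le_iff_ne_zero.mpr hi0.ne']
    simpa [Nat.one_le_iff_ne_zero.mpr hi0.ne'] using this

/-- If `|P(ξ)| < t ^ (-ω)` with `t` the height of `P`, a good point with `x 0 ≤ t ^ ω'` kills all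
multiples of `P` of degree at most 4. A Dirichlet cubic `Q` of height about `t ^ (ω / 3)` is killed
as well and is coprime to `P`, so the point would be zero. -/
theorem exists_irreducible_quadratic_bound {ξ l ω : ℝ} (hl : 0 < l)
    (hS : ∀ᶠ X in atTop, SimultaneousSolvable 4 ξ l X) (h1 : 1 < ω * l) (h3 : ω < 3) :
    ∃ H₀ : ℝ, ∀ P : ℤ[X], Irreducible P → 1 ≤ P.natDegree → P.natDegree ≤ 2 →
      H₀ ≤ P.supNorm → P.supNorm ^ (-ω) ≤ |aeval ξ P| := by
  obtain ⟨C, hC1, hC⟩ := exists_cubic_dirichlet ξ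
  have hω0 : 0 < ω := by
    by_contra! h
    nlinarith
  -- For `X = t ^ ω'`, the condition `ω' < ω` makes `X * |P(ξ)|` small, and `ω' * l > 1` makes `t *
  -- X ^ (-l)` small.
  obtain ⟨ω', hω'1, hω'2⟩ : ∃ ω', 1 / l < ω' ∧ ω' < ω := exists_between (by
    rw [div_lt_iff₀ hl]; exact h1)
  have hω'l : 1 < ω' * l := by rwa [div_lt_iff₀ hl] at hω'1
  have hω'0 : 0 < ω' := lt_trans (by positivity) hω'1
  set K := (1 + |ξ|) ^ 4 with hK
  have ev := (tendsto_rpow_atTop hω'0).eventually hS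
  have ev1 := eventually_mul_rpow_neg_lt (8 * K) (δ := ω - ω') (ε := 1 / 2) (by linarith) (by norm_num)
  have ev2 := eventually_mul_rpow_neg_lt 5 (δ := ω' * l - 1) (ε := 1 / 2) (by linarith) (by norm_num)
  have ev3 := eventually_mul_rpow_neg_lt (5 * C) (δ := ω' * l - ω / 3) (ε := 1 / 2) (by linarith)
    (by norm_num)
  have ev4 := eventually_mul_rpow_neg_lt (6 * C) (δ := 1 - ω / 3) (ε := 1) (by linarith)
    (by norm_num)
  obtain ⟨H₀, hH₀⟩ := eventually_atTop.mp
    (((ev.and ev1).and (ev2.and ev3)).and (ev4.and (eventually_ge_atTop 1)))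
  refine ⟨H₀, fun P hirr hd1 hd2 hPH => ?_⟩
  by_contra! hlt
  obtain ⟨⟨⟨hs, e1⟩, e2, e3⟩, e4, ht1⟩ := hH₀ _ hPH
  set t := P.supNorm with ht
  have ht0 : 0 < t := by linarith
  have hX1 : 1 ≤ t ^ ω' := Real.one_le_rpow ht1 hω'0.le
  obtain ⟨x, hxX, hx⟩ := exists_isApprox_of_solvable hX1 hs
  rw [← Real.rpow_mul ht0.le] at hx
  have hx0 : (0 : ℝ) ≤ x 0 := by exact_mod_cast zero_le_one.trans hx.1
  have hY1 : 1 ≤ t ^ (ω / 3) := Real.one_le_rpow ht1 (by linarith)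
  set N := ⌊t ^ (ω / 3)⌋₊ with hN
  have hN1 : 1 ≤ N := Nat.one_le_floor_iff _ |>.mpr hY1
  have hNle : (N : ℝ) ≤ t ^ (ω / 3) := Nat.floor_le (by positivity)
  have hNge : t ^ (ω / 3) ≤ 2 * N := by
    have := Nat.lt_floor_add_one (t ^ (ω / 3))
    have h1N : (1 : ℝ) ≤ N := by exact_mod_cast hN1
    linarith
  obtain ⟨Q, hQ0, hQd, hQH, hQv⟩ := hC N hN1
  have hN0 : (0 : ℝ) < N := by exact_mod_cast hN1
  have hQH' : Q.supNorm ≤ C * t ^ (ω / 3) := hQH.trans (by gcongr)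
  have hQv' : |aeval ξ Q| ≤ 8 * t ^ (-ω) := by
    refine hQv.trans ?_
    have h8 : t ^ ω ≤ 8 * (N : ℝ) ^ 3 := by
      have e : t ^ ω = (t ^ (ω / 3)) ^ 3 := by
        rw [← Real.rpow_natCast, ← Real.rpow_mul ht0.le]
        congr 1
        push_cast
        ring
      calc t ^ ω = (t ^ (ω / 3)) ^ 3 := e
        _ ≤ (2 * N) ^ 3 := by gcongr
        _ = _ := by ring
    rw [Real.rpow_neg ht0.le, div_le_iff₀ (by positivity)]
    have hp : 0 < t ^ ω := by positivity
    calc (1 : ℝ) = (t ^ ω)⁻¹ * t ^ ω := by field_simp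
      _ ≤ (t ^ ω)⁻¹ * (8 * (N : ℝ) ^ 3) := by gcongr
      _ = _ := by ring
  have hK0 : 0 < K := by positivity
  have hmul : t ^ ω' * t ^ (-ω) = t ^ (-(ω - ω')) := by
    rw [← Real.rpow_add ht0]; congr 1; ring
  have hPz : ∀ j, j + P.natDegree ≤ 4 → pairing x (X ^ j * P) = 0 := by
    intro j hj
    refine pairing_X_pow_mul_eq_zero hx hj ?_
    have a1 : (x 0 : ℝ) * (K * |aeval ξ P|) ≤ t ^ ω' * (K * t ^ (-ω)) := by gcongr
    have a2 : 5 * t * t ^ (ω' * -l) = 5 * t ^ (-(ω' * l - 1)) := by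
      rw [mul_assoc]
      nth_rewrite 1 [← Real.rpow_one t]
      rw [← Real.rpow_add ht0]
      congr 2
      ring
    have a3 : t ^ ω' * (K * t ^ (-ω)) = K * t ^ (-(ω - ω')) := by rw [← hmul]; ring
    have a4 : K * t ^ (-(ω - ω')) ≤ 8 * K * t ^ (-(ω - ω')) := by
      have : 0 ≤ K * t ^ (-(ω - ω')) := by positivity
      linarith
    rw [a2]
    linarith
  have hQz : ∀ j, j + 1 ≤ P.natDegree → pairing x (X ^ j * Q) = 0 := by
    intro j hj
    refine pairing_X_pow_mul_eq_zero hx (by omega) ?_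
    have a1 : (x 0 : ℝ) * (K * |aeval ξ Q|) ≤ t ^ ω' * (K * (8 * t ^ (-ω))) := by gcongr
    have a2 : 5 * (C * t ^ (ω / 3)) * t ^ (ω' * -l) = 5 * C * t ^ (-(ω' * l - ω / 3)) := by
      rw [show 5 * (C * t ^ (ω / 3)) * t ^ (ω' * -l) = 5 * C * (t ^ (ω / 3) * t ^ (ω' * -l)) by ring,
        ← Real.rpow_add ht0]
      congr 2
      ring
    have a3 : t ^ ω' * (K * (8 * t ^ (-ω))) = 8 * K * t ^ (-(ω - ω')) := by rw [← hmul]; ring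
    have a4 : 5 * Q.supNorm * t ^ (ω' * -l) ≤ 5 * (C * t ^ (ω / 3)) * t ^ (ω' * -l) := by gcongr
    linarith
  -- A nonzero cubic multiple of `P` has height `≫ t`, whereas `Q` has height `≪ t ^ (ω / 3)` and `ω
  -- < 3`.
  have hndvd : ¬ P ∣ Q := by
    rintro ⟨S, rfl⟩
    have hS0 : S ≠ 0 := right_ne_zero_of_mul hQ0
    have b1 := supNorm_le_intMahler (P := P) (by omega)
    have b2 := intMahler_le hQd
    rw [intMahler_mul] at b2
    have b3 := one_le_intMahler hS0
    have b4 := one_le_intMahler hirr.ne_zero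
    have b5 : t ≤ 6 * C * t ^ (ω / 3) := by nlinarith
    have b6 : t = t ^ (1 - ω / 3) * t ^ (ω / 3) := by
      rw [← Real.rpow_add ht0]; simp
    have b7 : t ^ (1 - ω / 3) ≤ 6 * C := by
      nth_rewrite 1 [b6] at b5
      exact le_of_mul_le_mul_right b5 (by positivity)
    rw [Real.rpow_neg ht0.le, ← div_eq_mul_inv, div_lt_one (by positivity)] at e4
    linarith
  have hprim : P.IsPrimitive := hirr.isPrimitive (by omega)
  have hcop : IsCoprime (P.map (Int.castRingHom ℚ)) (Q.map (Int.castRingHom ℚ)) := by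
    rw [((IsPrimitive.Int.irreducible_iff_irreducible_map_cast hprim).mp hirr).coprime_iff_not_dvd]
    intro h
    exact hndvd ((IsPrimitive.Int.dvd_iff_map_cast_dvd_map_cast P Q hprim).mpr h)
  have := eq_zero_of_pairing_eq_zero hcop hd1 (by omega) (by omega) hPz hQz (i := 0) (by norm_num)
  have := hx.1
  omega

/-- The bound passes from irreducible factors to products once the height is replaced by the
multiplicative Mahler measure. -/
theorem exists_quadratic_lower_bound {ξ l ω : ℝ} (hξ : Transcendental ℚ ξ) (hl : 0 < l)
    (hS : ∀ᶠ X in atTop, SimultaneousSolvable 4 ξ l X) (h1 : 1 < ω * l) (h3 : ω < 3) :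
    ∃ c : ℝ, 0 < c ∧ ∀ R : ℤ[X], R ≠ 0 → R.natDegree ≤ 2 → c * R.supNorm ^ (-ω) ≤ |aeval ξ R| := by
  have hω0 : 0 < ω := by
    by_contra! h
    nlinarith
  obtain ⟨H₀, hH₀⟩ := exists_irreducible_quadratic_bound hl hS h1 h3
  obtain ⟨c₀, hc₀, hc₀'⟩ := exists_lower_bound_of_supNorm_le hξ 2 H₀
  let c : ℝ := min c₀ 1
  have hc0 : 0 < c := lt_min hc₀ one_pos
  have hc1 : c ≤ 1 := min_le_right _ _
  have hpow1 : ∀ {y : ℝ}, 1 ≤ y → y ^ (-ω) ≤ 1 := fun hy =>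
    Real.rpow_le_one_of_one_le_of_nonpos hy (by linarith)
  have hirr : ∀ P : ℤ[X], Irreducible P → 1 ≤ P.natDegree → P.natDegree ≤ 2 →
      c * P.supNorm ^ (-ω) ≤ |aeval ξ P| := by
    intro P hP hd1 hd2
    have hH1 := one_le_supNorm hP.ne_zero
    have hH0 : 0 ≤ P.supNorm ^ (-ω) := by have := P.supNorm_nonneg; positivity
    rcases le_total H₀ P.supNorm with h | h
    · refine le_trans ?_ (hH₀ P hP hd1 hd2 h)
      nlinarith
    · refine le_trans ?_ (hc₀' P hP.ne_zero hd2 h)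
      have := hpow1 hH1
      have : c ≤ c₀ := min_le_left _ _
      nlinarith
  let d : ℝ := c * 3 ^ (-ω)
  have h3ω : (3 : ℝ) ^ (-ω) ≤ 1 := hpow1 (by norm_num)
  have h3ω0 : (0 : ℝ) < 3 ^ (-ω) := by positivity
  have hd0 : 0 < d := by positivity
  have hd1 : d ≤ 1 := by simp only [d]; nlinarith
  -- The constant is charged by degree, because the number of constant factors is unbounded; these
  -- cost nothing, their values being at least 1.
  have key : ∀ R : ℤ[X], R ≠ 0 → R.natDegree ≤ 2 →
      d ^ R.natDegree * intMahler R ^ (-ω) ≤ |aeval ξ R| := by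
    have hconst : ∀ R : ℤ[X], R ≠ 0 → R.natDegree = 0 →
        d ^ R.natDegree * intMahler R ^ (-ω) ≤ |aeval ξ R| := by
      intro R hR0 hR
      rw [hR, pow_zero, one_mul]
      refine (hpow1 (one_le_intMahler hR0)).trans ?_
      rw [eq_C_of_natDegree_eq_zero hR] at hR0 ⊢
      have h0 : R.coeff 0 ≠ 0 := fun h => hR0 (by rw [h, C_0])
      have := Int.one_le_abs h0
      rw [aeval_C]
      simp only [algebraMap_int_eq, Int.coe_castRingHom]
      exact_mod_cast this
    intro R
    induction R using WfDvdMonoid.induction_on_irreducible with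
    | zero => intro h; exact (h rfl).elim
    | unit u hu =>
      intro h0 _
      exact hconst u h0 (natDegree_eq_zero_of_isUnit hu)
    | mul a i ha0 hi ih =>
      intro h0 hdeg
      rw [natDegree_mul hi.ne_zero ha0] at hdeg
      have iha := ih ha0 (by omega)
      have hirr' : d ^ i.natDegree * intMahler i ^ (-ω) ≤ |aeval ξ i| := by
        rcases Nat.eq_zero_or_pos i.natDegree with h | h
        · exact hconst i hi.ne_zero h
        · refine le_trans ?_ (hirr i hi h (by omega))
          have hM1 := one_le_intMahler hi.ne_zero
          have hH1 := one_le_supNorm hi.ne_zero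
          have hd' : d ^ i.natDegree ≤ d := pow_le_of_le_one hd0.le hd1 (by omega)
          have hMH : 3 ^ (-ω) * intMahler i ^ (-ω) ≤ i.supNorm ^ (-ω) := by
            rw [← Real.mul_rpow (by norm_num) (by linarith)]
            exact Real.rpow_le_rpow_of_nonpos (by linarith) (supNorm_le_intMahler (by omega))
              (by linarith)
          calc d ^ i.natDegree * intMahler i ^ (-ω) ≤ d * intMahler i ^ (-ω) := by
                gcongr
            _ = c * (3 ^ (-ω) * intMahler i ^ (-ω)) := by simp only [d]; ring
            _ ≤ _ := by gcongr
      have hMa := one_le_intMahler ha0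
      have hMi := one_le_intMahler hi.ne_zero
      rw [natDegree_mul hi.ne_zero ha0, intMahler_mul, map_mul, abs_mul,
        Real.mul_rpow (by linarith) (by linarith), pow_add]
      calc d ^ i.natDegree * d ^ a.natDegree * (intMahler i ^ (-ω) * intMahler a ^ (-ω))
          = (d ^ i.natDegree * intMahler i ^ (-ω)) * (d ^ a.natDegree * intMahler a ^ (-ω)) := by ring
        _ ≤ _ := by
          have : 0 ≤ intMahler a ^ (-ω) := Real.rpow_nonneg (by linarith) _
          gcongr
  refine ⟨d ^ 2 * 2 ^ (-ω), by positivity, fun R hR0 hRd => le_trans ?_ (key R hR0 hRd)⟩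
  have hM1 := one_le_intMahler hR0
  have hH1 := one_le_supNorm hR0
  have h1 : 2 ^ (-ω) * R.supNorm ^ (-ω) ≤ intMahler R ^ (-ω) := by
    rw [← Real.mul_rpow (by norm_num) (by linarith)]
    exact Real.rpow_le_rpow_of_nonpos (by linarith) (intMahler_le (by omega)) (by linarith)
  have h2 : d ^ 2 ≤ d ^ R.natDegree := pow_le_pow_of_le_one hd0.le hd1 hRd
  have h3 : 0 ≤ R.supNorm ^ (-ω) := Real.rpow_nonneg (by linarith) _
  rw [mul_assoc]
  exact mul_le_mul h2 h1 (by positivity) (by positivity)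

/-! ### Coprimality of minimal pairs -/

/-- Gauss's lemma: clear denominators in a common irreducible factor over `ℚ` and take the primitive
part. -/
theorem exists_common_factor {P Q : ℤ[X]} (hP0 : P ≠ 0)
    (h : ¬ IsCoprime (P.map (Int.castRingHom ℚ)) (Q.map (Int.castRingHom ℚ))) :
    ∃ A : ℤ[X], 1 ≤ A.natDegree ∧ A ∣ P ∧ A ∣ Q := by
  obtain ⟨g, hg, hgP, hgQ⟩ : ∃ g : ℚ[X], Irreducible g ∧ g ∣ P.map (Int.castRingHom ℚ) ∧
      g ∣ Q.map (Int.castRingHom ℚ) := by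
    by_contra! hcon
    exact h (isCoprime_of_irreducible_dvd (fun hh => hP0 (map_rat_eq_zero_iff.mp hh.1)) hcon)
  obtain ⟨b, hb, hbg⟩ := IsLocalization.integerNormalization_spec (nonZeroDivisors ℤ) g
  set G := IsLocalization.integerNormalization (nonZeroDivisors ℤ) g with hG
  have hb0 : (b : ℚ) ≠ 0 := by exact_mod_cast nonZeroDivisors.ne_zero hb
  have hbg' : G.map (Int.castRingHom ℚ) = C (b : ℚ) * g := by
    rw [← smul_eq_C_mul]
    rw [algebraMap_int_eq] at hbg
    rw [hbg, Int.cast_smul_eq_zsmul]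
  have hdegG : G.natDegree = g.natDegree := by
    rw [← natDegree_map_rat, hbg', natDegree_C_mul hb0]
  have hdvd : G.primPart.map (Int.castRingHom ℚ) ∣ g := by
    have h1 : G.primPart.map (Int.castRingHom ℚ) ∣ C (b : ℚ) * g := by
      rw [← hbg']
      exact map_dvd (mapRingHom (Int.castRingHom ℚ)) (primPart_dvd G)
    exact (IsUnit.dvd_mul_left (isUnit_C.mpr hb0.isUnit)).mp h1
  refine ⟨G.primPart, ?_, ?_, ?_⟩
  · rw [natDegree_primPart, hdegG]
    exact hg.natDegree_pos
  · rw [IsPrimitive.Int.dvd_iff_map_cast_dvd_map_cast _ _ G.isPrimitive_primPart]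
    exact hdvd.trans hgP
  · rw [IsPrimitive.Int.dvd_iff_map_cast_dvd_map_cast _ _ G.isPrimitive_primPart]
    exact hdvd.trans hgQ

/-- If `P` had degree at most 2, or shared a factor with `Q`, the lower bounds in degree at most 2
would give `|P(ξ)| ≫ H(Q)^(-ω)` with `ω < 3`, against the decay `H(Q)^(-3)`. A common factor of
degree 3 is excluded separately. -/
theorem minimalPair_coprime {ξ c ω C : ℝ} (hc : 0 < c) (hω0 : 0 < ω) (h3 : ω < 3)
    (hlow : ∀ R : ℤ[X], R ≠ 0 → R.natDegree ≤ 2 → c * R.supNorm ^ (-ω) ≤ |aeval ξ R|) :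
    ∃ N₁ : ℝ, ∀ N, N₁ ≤ N → ∀ P Q : ℤ[X], MinimalPair ξ C N P Q →
      P.natDegree = 3 ∧ IsCoprime (P.map (Int.castRingHom ℚ)) (Q.map (Int.castRingHom ℚ)) := by
  have ev1 := eventually_mul_rpow_neg_lt C (δ := 3 - ω) (ε := c) (by linarith) hc
  have ev2 := eventually_mul_rpow_neg_lt C (δ := 3 - ω) (ε := c ^ 2 * 18 ^ (-ω)) (by linarith)
    (by positivity)
  obtain ⟨N₁, hN₁⟩ := eventually_atTop.mp (ev1.and ev2)
  refine ⟨N₁, fun N hN P Q hPQ => ?_⟩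
  obtain ⟨e1, e2⟩ := hN₁ Q.supNorm (hN.trans hPQ.lt_right_supNorm.le)
  have hPQH : P.supNorm < Q.supNorm := hPQ.left_supNorm_le.trans_lt hPQ.lt_right_supNorm
  have hP1 := one_le_supNorm hPQ.left_ne_zero
  have hQ1 := one_le_supNorm hPQ.right_ne_zero
  set t := Q.supNorm with ht
  have ht0 : 0 < t := by linarith
  have hval : |aeval ξ P| ≤ C * t ^ (-(3 - ω)) * t ^ (-ω) := by
    rw [mul_assoc, ← Real.rpow_add ht0, show -(3 - ω) + -ω = -((3 : ℕ) : ℝ) by push_cast; ring,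
      Real.rpow_neg ht0.le, Real.rpow_natCast, ← div_eq_mul_inv, le_div_iff₀ (by positivity)]
    exact hPQ.aeval_mul_le
  have htω : 0 < t ^ (-ω) := by positivity
  have hdeg : P.natDegree = 3 := by
    by_contra hne
    have h1 := hlow P hPQ.left_ne_zero (by have := hPQ.left_natDegree_le; omega)
    have h2 : t ^ (-ω) ≤ P.supNorm ^ (-ω) :=
      Real.rpow_le_rpow_of_nonpos (by linarith) hPQH.le (by linarith)
    have h3 : C * t ^ (-(3 - ω)) * t ^ (-ω) < c * t ^ (-ω) := by gcongr
    have h4 : c * t ^ (-ω) ≤ c * P.supNorm ^ (-ω) := by gcongr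
    linarith
  refine ⟨hdeg, ?_⟩
  by_contra hcop
  obtain ⟨A, hA1, ⟨B, hB⟩, ⟨B', hB'⟩⟩ :=
    exists_common_factor hPQ.left_ne_zero hcop
  have hP0 := hPQ.left_ne_zero
  have hQ0 := hPQ.right_ne_zero
  rw [hB] at hP0
  rw [hB'] at hQ0
  have hA0 := left_ne_zero_of_mul hP0
  have hB0 := right_ne_zero_of_mul hP0
  have hB'0 := right_ne_zero_of_mul hQ0
  have hdB : A.natDegree + B.natDegree = 3 := by rw [← natDegree_mul hA0 hB0, ← hB, hdeg]
  have hdB' : A.natDegree + B'.natDegree ≤ 3 := by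
    rw [← natDegree_mul hA0 hB'0, ← hB']; exact hPQ.right_natDegree_le
  by_cases hA3 : A.natDegree = 3
  -- `P` and `Q` are integer multiples of the same cubic, so the larger height of `Q` would come
  -- with a larger value.
  · have hBc := eq_C_of_natDegree_eq_zero (show B.natDegree = 0 by omega)
    have hB'c := eq_C_of_natDegree_eq_zero (show B'.natDegree = 0 by omega)
    set b := B.coeff 0
    set b' := B'.coeff 0
    have hsup : ∀ k : ℤ, (A * Polynomial.C k).supNorm = A.supNorm * |(k : ℝ)| := by
      intro k
      rw [supNorm_eq_iSup, supNorm_eq_iSup, Real.iSup_mul_of_nonneg (abs_nonneg _)]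
      congr 1
      funext i
      rw [coeff_mul_C, norm_mul, Int.norm_eq_abs k]
    have hv : ∀ k : ℤ, |aeval ξ (A * Polynomial.C k)| = |aeval ξ A| * |(k : ℝ)| := by
      intro k
      rw [map_mul, aeval_C, abs_mul]
      simp
    have g1 := hPQ.aeval_lt
    rw [hB, hB', hBc, hB'c, hv, hv] at g1
    have g2 := hPQH
    rw [ht, hB, hB', hBc, hB'c, hsup, hsup] at g2
    have g3 := lt_of_mul_lt_mul_left g1 (abs_nonneg _)
    have g4 := lt_of_mul_lt_mul_left g2 A.supNorm_nonneg
    linarith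
  · have lA := hlow A hA0 (by omega)
    have lB := hlow B hB0 (by omega)
    have hA1 := one_le_supNorm hA0
    have hB1 := one_le_supNorm hB0
    have hAB : A.supNorm * B.supNorm ≤ 18 * t := by
      have mA := supNorm_le_intMahler (P := A) (by omega)
      have mB := supNorm_le_intMahler (P := B) (by omega)
      have mP := intMahler_le hPQ.left_natDegree_le
      rw [hB, intMahler_mul, ← hB] at mP
      calc A.supNorm * B.supNorm ≤ (3 * intMahler A) * (3 * intMahler B) :=
            mul_le_mul mA mB (by linarith) (by linarith)
        _ = 9 * (intMahler A * intMahler B) := by ring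
        _ ≤ 9 * (2 * P.supNorm) := by gcongr
        _ ≤ 18 * t := by linarith
    have h18 : 18 ^ (-ω) * t ^ (-ω) ≤ A.supNorm ^ (-ω) * B.supNorm ^ (-ω) := by
      rw [← Real.mul_rpow (by norm_num) ht0.le, ← Real.mul_rpow (by linarith) (by linarith)]
      exact Real.rpow_le_rpow_of_nonpos (by positivity) hAB (by linarith)
    have hlowP : c ^ 2 * 18 ^ (-ω) * t ^ (-ω) ≤ |aeval ξ P| := by
      calc c ^ 2 * 18 ^ (-ω) * t ^ (-ω) = c ^ 2 * (18 ^ (-ω) * t ^ (-ω)) := by ring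
        _ ≤ c ^ 2 * (A.supNorm ^ (-ω) * B.supNorm ^ (-ω)) := by gcongr
        _ = (c * A.supNorm ^ (-ω)) * (c * B.supNorm ^ (-ω)) := by ring
        _ ≤ |aeval ξ A| * |aeval ξ B| := by
          have : 0 ≤ B.supNorm ^ (-ω) := Real.rpow_nonneg (by linarith) _
          gcongr
        _ = |aeval ξ P| := by rw [hB, map_mul, abs_mul]
    have hup : C * t ^ (-(3 - ω)) * t ^ (-ω) < c ^ 2 * 18 ^ (-ω) * t ^ (-ω) := by gcongr
    linarith

/-! ### Minors of the two shifts of an approximation point -/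

theorem abs_mul_sub_mul_le {a b c d x y : ℝ} (ha : |a| ≤ x) (hb : |b| ≤ y) (hc : |c| ≤ x)
    (hd : |d| ≤ y) : |a * b - c * d| ≤ 2 * (x * y) := by
  have hx : 0 ≤ x := (abs_nonneg _).trans ha
  calc |a * b - c * d| ≤ |a| * |b| + |c| * |d| := by
        rw [← abs_mul, ← abs_mul]; exact abs_sub _ _
    _ ≤ x * y + x * y := by gcongr
    _ = _ := by ring

/-- Modulo multiples of the row `ξ ^ i`, the two shifts of `x` are the error rows up to sign, so the
determinant is quadratic in the errors. -/
theorem IsApprox.abs_minor₃_le {ξ L : ℝ} {x : ℕ → ℤ} (h : IsApprox ξ x L) (i j k : Fin 4) :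
    |minor₃ (fun i : Fin 4 => ξ ^ (i : ℕ)) (fun i : Fin 4 => x i) (fun i : Fin 4 => x (i + 1)) i j k|
      ≤ 6 * (1 + |ξ|) ^ 4 * L ^ 2 := by
  have hz : ∀ i : Fin 4, |ξ ^ (i : ℕ)| ≤ (1 + |ξ|) ^ 4 := fun i => by
    rw [abs_pow]; exact abs_pow_le_one_add ξ i.2.le
  obtain ⟨e, he⟩ : ∃ e : ℕ → ℝ, ∀ i, e i = ξ ^ i * x 0 - x i := ⟨_, fun _ => rfl⟩
  have heL : ∀ i : Fin 4, |e i| ≤ L := fun i => by rw [he]; exact h.2 i (by omega)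
  have heL' : ∀ i : Fin 4, |e (i + 1)| ≤ L := fun i => by rw [he]; exact h.2 (i + 1) (by omega)
  have hx : ∀ i, (x i : ℝ) = ξ ^ i * x 0 - e i := fun i => by rw [he]; ring
  have key : minor₃ (fun i : Fin 4 => ξ ^ (i : ℕ)) (fun i : Fin 4 => x i)
      (fun i : Fin 4 => x (i + 1)) i j k
      = ξ ^ (i : ℕ) * (e j * e (k + 1) - e k * e (j + 1))
        + ξ ^ (j : ℕ) * (e k * e (i + 1) - e i * e (k + 1))
        + ξ ^ (k : ℕ) * (e i * e (j + 1) - e j * e (i + 1)) := by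
    simp only [minor₃, minor₂]
    push_cast
    rw [hx i, hx j, hx k, hx (i + 1), hx (j + 1), hx (k + 1)]
    ring
  have hterm : ∀ i j k : Fin 4, |ξ ^ (i : ℕ) * (e j * e (k + 1) - e k * e (j + 1))|
      ≤ (1 + |ξ|) ^ 4 * (2 * (L * L)) := by
    intro i j k
    rw [abs_mul]
    exact mul_le_mul (hz i) (abs_mul_sub_mul_le (heL j) (heL' k) (heL k) (heL' j)) (abs_nonneg _)
      (by positivity)
  rw [key]
  refine (abs_add_three _ _ _).trans ?_
  have := hterm i j k
  have := hterm j k i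
  have := hterm k i j
  nlinarith

/-- Both shifts are nearly proportional to the row `ξ ^ i`: the terms in `x 0 ^ 2` cancel. -/
theorem IsApprox.abs_minor₂_le {ξ L : ℝ} {x : ℕ → ℤ} (h : IsApprox ξ x L) (hL : L ≤ 1)
    (i j : Fin 4) :
    |(minor₂ (fun i : Fin 4 => x i) (fun i : Fin 4 => x (i + 1)) i j : ℝ)|
      ≤ 6 * (1 + |ξ|) ^ 4 * (x 0 * L) := by
  have hL0 := h.nonneg
  have hx1 : (1 : ℝ) ≤ x 0 := by exact_mod_cast h.1
  obtain ⟨e, he⟩ : ∃ e : ℕ → ℝ, ∀ i, e i = ξ ^ i * x 0 - x i := ⟨_, fun _ => rfl⟩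
  have heL : ∀ i < 5, |e i| ≤ L := fun i hi => by rw [he]; exact h.2 i hi
  have hx : ∀ i, (x i : ℝ) = ξ ^ i * x 0 - e i := fun i => by rw [he]; ring
  set B := (1 + |ξ|) ^ 4 with hB
  have hB1 : 1 ≤ B := one_le_pow₀ (by linarith [abs_nonneg ξ])
  have hz : ∀ i < 5, |ξ ^ i| ≤ B := fun i hi => by
    rw [abs_pow]; exact abs_pow_le_one_add ξ (by omega)
  have key : (minor₂ (fun i : Fin 4 => x i) (fun i : Fin 4 => x (i + 1)) i j : ℝ)
      = x 0 * ((ξ ^ (j : ℕ) * e (i + 1) - ξ ^ (i : ℕ) * e (j + 1))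
        + (ξ ^ ((i : ℕ) + 1) * e j - ξ ^ ((j : ℕ) + 1) * e i))
        + (e i * e (j + 1) - e j * e (i + 1)) := by
    simp only [minor₂]
    push_cast
    rw [hx i, hx j, hx (i + 1), hx (j + 1)]
    ring
  have t1 := abs_mul_sub_mul_le (hz j (by omega)) (heL (i + 1) (by omega)) (hz i (by omega))
    (heL (j + 1) (by omega))
  have t2 := abs_mul_sub_mul_le (hz (i + 1) (by omega)) (heL j (by omega)) (hz (j + 1) (by omega))
    (heL i (by omega))
  have t3 := abs_mul_sub_mul_le (heL i (by omega)) (heL (j + 1) (by omega)) (heL j (by omega))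
    (heL (i + 1) (by omega))
  rw [key]
  refine (abs_add_le _ _).trans ?_
  rw [abs_mul, abs_of_pos (show (0 : ℝ) < x 0 by linarith)]
  have t4 := (abs_add_le (ξ ^ (j : ℕ) * e (i + 1) - ξ ^ (i : ℕ) * e (j + 1))
    (ξ ^ ((i : ℕ) + 1) * e j - ξ ^ ((j : ℕ) + 1) * e i)).trans (add_le_add t1 t2)
  have t5 : L * L ≤ B * (x 0 * L) := by
    have : L ≤ B * x 0 := by nlinarith
    nlinarith
  nlinarith [mul_le_mul_of_nonneg_left t4 (show (0 : ℝ) ≤ x 0 by linarith)]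

theorem pairing_X_pow_mul {x : ℕ → ℤ} {P : ℤ[X]} (hP : P.natDegree ≤ 3) :
    pairing x (X ^ 0 * P) = ∑ i : Fin 4, P.coeff i * x i ∧
      pairing x (X ^ 1 * P) = ∑ i : Fin 4, P.coeff i * x (i + 1) := by
  have h4 : P.coeff 4 = 0 := coeff_eq_zero_of_natDegree_lt (by omega)
  constructor
  · simp [pairing, Finset.sum_range_succ, Fin.sum_univ_four, h4]
  · simp [pairing, Finset.sum_range_succ, Fin.sum_univ_four, coeff_X_mul]

theorem pairing_eq_eval_of_minor₂ {x : ℕ → ℤ} (hx0 : x 0 ≠ 0)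
    (h : ∀ i j, minor₂ (fun i : Fin 4 => x i) (fun i : Fin 4 => x (i + 1)) i j = 0) :
    ∀ j < 5, (x j : ℚ) = x 0 * ((x 1 : ℚ) / x 0) ^ j := by
  have hx0' : (x 0 : ℚ) ≠ 0 := by exact_mod_cast hx0
  intro j
  induction j with
  | zero => simp
  | succ j ih =>
    intro hj
    have ih := ih (by omega)
    have h0 := h 0 ⟨j, by omega⟩
    simp only [minor₂] at h0
    have h1 : (x 0 : ℚ) * x (j + 1) = x j * x 1 := by
      have : x 0 * x (j + 1) - x j * x 1 = 0 := h0
      exact_mod_cast sub_eq_zero.mp this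
    have h2 : (x (j + 1) : ℚ) = x j * ((x 1 : ℚ) / x 0) := by
      field_simp
      linarith
    rw [h2, pow_succ, ← mul_assoc, ← ih]

/-- Otherwise `x` is a geometric progression, pairing with it is evaluation at `x 1 / x 0` up to a
factor, and `P` and `Q` share a rational root. -/
theorem exists_minor₂_ne_zero {x : ℕ → ℤ} (hx0 : x 0 ≠ 0) {P Q : ℤ[X]}
    (hc : IsCoprime (P.map (Int.castRingHom ℚ)) (Q.map (Int.castRingHom ℚ)))
    (hPd : P.natDegree ≤ 3) (hQd : Q.natDegree ≤ 3) (hP : pairing x (X ^ 0 * P) = 0)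
    (hQ : pairing x (X ^ 0 * Q) = 0) :
    ∃ i j, minor₂ (fun i : Fin 4 => x i) (fun i : Fin 4 => x (i + 1)) i j ≠ 0 := by
  by_contra! hcon
  have hg := pairing_eq_eval_of_minor₂ hx0 hcon
  have hx0' : (x 0 : ℚ) ≠ 0 := by exact_mod_cast hx0
  have hev : ∀ F : ℤ[X], F.natDegree ≤ 3 → pairing x (X ^ 0 * F) = 0 →
      (F.map (Int.castRingHom ℚ)).eval ((x 1 : ℚ) / x 0) = 0 := by
    intro F hF h0
    have h1 : (pairing x (X ^ 0 * F) : ℚ)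
        = x 0 * (F.map (Int.castRingHom ℚ)).eval ((x 1 : ℚ) / x 0) := by
      rw [pow_zero, one_mul, eval_eq_sum_range' (n := 5) (by rw [natDegree_map_rat]; omega),
        pairing, Finset.mul_sum]
      push_cast
      refine Finset.sum_congr rfl fun j hj => ?_
      rw [hg j (Finset.mem_range.mp hj), coeff_map]
      simp only [Int.coe_castRingHom]
      ring
    rw [h0] at h1
    simpa [hx0'] using h1.symm
  obtain ⟨U, V, hUV⟩ := hc
  have := congrArg (eval ((x 1 : ℚ) / x 0)) hUV
  rw [eval_add, eval_mul, eval_mul, hev P hPd hP, hev Q hQd hQ] at this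
  simp at this

theorem aeval_ofFn (ξ : ℝ) (r : Fin 4 → ℤ) :
    aeval ξ (ofFn 4 r) = ∑ i, (r i : ℝ) * ξ ^ (i : ℕ) := by
  rw [aeval_eq_sum_range' (n := 4) (ofFn_natDegree_lt (by norm_num) r), Finset.sum_range]
  refine Finset.sum_congr rfl fun i _ => ?_
  rw [coeff_ofFn]
  simp

theorem supNorm_ofFn_le {r : Fin 4 → ℤ} {B : ℝ} (h : ∀ i, |(r i : ℝ)| ≤ B) :
    (ofFn 4 r).supNorm ≤ B := by
  refine supNorm_le_of_coeff fun i => ?_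
  by_cases hi : i < 4
  · have := coeff_ofFn r ⟨i, hi⟩
    simp only at this
    rw [this]
    exact h _
  · rw [ofFn_coeff_eq_zero_of_ge _ (by omega)]
    simpa using (abs_nonneg _).trans (h 0)

theorem ofFn_ne_zero {r : Fin 4 → ℤ} (h : r ≠ 0) : ofFn 4 r ≠ 0 := by
  intro h0
  apply h
  funext i
  rw [← coeff_ofFn r i, h0]
  simp

/-- `P` lies in the lattice orthogonal to both shifts of `x`. If the covolume is small, the lattice
contains a vector shorter than `Q` with value `O(L^2 / H(Q))`, and `P` is minimal. If it is large,
the bound valid for every lattice vector already applies to `P`. -/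
theorem MinimalPair.supNorm_mul_abs_aeval_le {ξ C N L : ℝ} {P Q : ℤ[X]} {x : ℕ → ℤ}
    (hPQ : MinimalPair ξ C N P Q) (hN : 4 ≤ N)
    (hc : IsCoprime (P.map (Int.castRingHom ℚ)) (Q.map (Int.castRingHom ℚ)))
    (hx : IsApprox ξ x L) (hL : 0 < L)
    (hP : ∀ j < 2, pairing x (X ^ j * P) = 0) (hQ : pairing x (X ^ 0 * Q) = 0) :
    Q.supNorm * |aeval ξ P| ≤ 768 * (1 + |ξ|) ^ 4 * L ^ 2 := by
  have hx0 : x 0 ≠ 0 := by have := hx.1; omega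
  have hE : 0 < 6 * (1 + |ξ|) ^ 4 * L ^ 2 := by positivity
  obtain ⟨i, j, hM, hsmall, hgen⟩ := exists_small_orthogonal (fun i : Fin 4 => x i)
    (fun i : Fin 4 => x (i + 1)) (fun i : Fin 4 => ξ ^ (i : ℕ)) hE
    (exists_minor₂_ne_zero hx0 hc hPQ.left_natDegree_le hPQ.right_natDegree_le
      (hP 0 (by norm_num)) hQ) hx.abs_minor₃_le
  set E := 6 * (1 + |ξ|) ^ 4 * L ^ 2 with hEdef
  set H := Q.supNorm with hH
  have hH4 : 4 < H := hN.trans_lt hPQ.lt_right_supNorm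
  have hPH : P.supNorm ≤ H := hPQ.left_supNorm_le.trans hPQ.lt_right_supNorm.le
  -- Vectors of height at most `2 * s ≤ H / 2` stay below `Q`, hence compete with `P`.
  let s := ⌊H / 4⌋₊
  have hs1 : 1 ≤ s := (Nat.one_le_floor_iff _).mpr (by linarith)
  have hs1' : (1 : ℝ) ≤ s := by exact_mod_cast hs1
  have hsle : (s : ℝ) ≤ H / 4 := Nat.floor_le (by linarith)
  have hsge : H / 8 ≤ s := by
    have := Nat.lt_floor_add_one (H / 4)
    have : H / 4 < s + 1 := this
    linarith
  suffices h : H * |aeval ξ P| ≤ 128 * E by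
    calc _ ≤ 128 * E := h
      _ = _ := by rw [hEdef]; ring
  by_cases hMs : |(minor₂ (fun i : Fin 4 => x i) (fun i : Fin 4 => x (i + 1)) i j : ℝ)| ≤ (s : ℝ) ^ 2
  · obtain ⟨r, hr0, -, -, hrs, hrv⟩ := hsmall s hs1 hMs
    have h1 := hPQ.aeval_le (ofFn 4 r) (ofFn_ne_zero hr0) (natDegree_ofFn_le r)
      ((supNorm_ofFn_le hrs).trans_lt (by linarith))
    rw [aeval_ofFn] at h1
    have h2 := h1.trans hrv
    rw [le_div_iff₀ (by linarith)] at h2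
    nlinarith [abs_nonneg (aeval ξ P)]
  · push Not at hMs
    have hP01 := pairing_X_pow_mul (x := x) hPQ.left_natDegree_le
    have h1 := hgen (fun i => P.coeff i) H (by rw [← hP01.1]; exact hP 0 (by norm_num))
      (by rw [← hP01.2]; exact hP 1 (by norm_num))
      (fun i => (abs_coeff_le_supNorm P i).trans hPH)
    have h2 : aeval ξ P = ∑ i : Fin 4, (P.coeff i : ℝ) * ξ ^ (i : ℕ) := by
      rw [aeval_eq_sum_range' (n := 4) (by have := hPQ.left_natDegree_le; omega), Finset.sum_range]
      simp
    rw [← h2] at h1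
    have h3 : (s : ℝ) ^ 2 * |aeval ξ P| ≤ 2 * H * E :=
      (mul_le_mul_of_nonneg_right hMs.le (abs_nonneg _)).trans h1
    have h4 : (H / 8) ^ 2 * |aeval ξ P| ≤ 2 * H * E := by
      refine le_trans ?_ h3
      gcongr
    have h5 : H * (H * |aeval ξ P|) ≤ H * (128 * E) := by nlinarith
    exact le_of_mul_le_mul_left h5 (by linarith)

/-! ### Good pairs and the upper bounds for the exponents -/

/-- A minimal pair of cubic polynomials together with the properties that follow from the uniform
solvability of the simultaneous approximation system with exponent `l`. -/
structure GoodPair (ξ l K N Y : ℝ) (P Q : ℤ[X]) : Prop where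
  left_supNorm_le : P.supNorm ≤ N
  lt_right_supNorm : N < Q.supNorm
  le_bound : N ≤ Y
  left_natDegree : P.natDegree = 3
  right_natDegree_le : Q.natDegree ≤ 3
  coprime : IsCoprime (P.map (Int.castRingHom ℚ)) (Q.map (Int.castRingHom ℚ))
  aeval_pos : 0 < |aeval ξ P|
  aeval_le : ∀ R : ℤ[X], R ≠ 0 → R.natDegree ≤ 3 → R.supNorm < Q.supNorm →
    |aeval ξ P| ≤ |aeval ξ R|
  pairing_eq_zero : ∀ x : ℕ → ℤ, IsApprox ξ x (Y ^ (-l)) → (x 0 : ℝ) ≤ Y →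
    ∀ j < 2, pairing x (X ^ j * P) = 0 ∧ pairing x (X ^ j * Q) = 0
  supNorm_mul_le : Q.supNorm * |aeval ξ P| ≤ K * |aeval ξ P| ^ (2 * l)
  one_le : 1 ≤ K * (P.supNorm ^ 2 * Q.supNorm ^ 3 * |aeval ξ P|)

-- With `Y ≍ 1 / e`, the term `x 0 * e` stays below a constant, and `H(Q) Y^(-l) ≪ H(Q)^(1-3l)`
-- tends to 0. This needs `l > 1/3`, as does the existence of `ω` between `1/l` and 3.
set_option maxHeartbeats 800000 in
theorem exists_goodPair {ξ l : ℝ} (hξ : Transcendental ℚ ξ) (hl : 1 / 3 < l)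
    (hS : ∀ᶠ X in atTop, SimultaneousSolvable 4 ξ l X) :
    ∃ K : ℝ, 0 < K ∧ ∀ᶠ N in atTop, ∃ (Y : ℝ) (P Q : ℤ[X]), GoodPair ξ l K N Y P Q := by
  have hl0 : 0 < l := by linarith
  obtain ⟨ω, hω1, hω3⟩ : ∃ ω, 1 / l < ω ∧ ω < 3 := exists_between (by
    rw [div_lt_iff₀ hl0]; linarith)
  have hω0 : 0 < ω := lt_trans (by positivity) hω1
  obtain ⟨c, hc, hlow⟩ := exists_quadratic_lower_bound hξ hl0 hS
    (by rwa [div_lt_iff₀ hl0] at hω1) hω3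
  obtain ⟨C, N₀, hC0, -, hpair⟩ := exists_minimalPair hξ
  obtain ⟨N₁, hN₁⟩ := minimalPair_coprime (C := C) hc hω0 hω3 hlow
  set B := (1 + |ξ|) ^ 4 with hB
  have hB0 : 0 < B := by positivity
  have ev1 := eventually_mul_rpow_neg_lt (20 * (4 * B * C) ^ l) (δ := 3 * l - 1) (ε := 1)
    (by linarith) one_pos
  obtain ⟨N₂, hN₂⟩ := eventually_atTop.mp ev1
  obtain ⟨N₃, hN₃⟩ := eventually_atTop.mp hS
  obtain ⟨K, hK1, hK2⟩ : ∃ K, 768 * B * ((4 * B) ^ l) ^ 2 ≤ K ∧ 720 * (1 + |ξ|) ^ 24 ≤ K :=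
    ⟨_, le_max_left _ _, le_max_right _ _⟩
  refine ⟨K, lt_of_lt_of_le (by positivity) hK2, ?_⟩
  filter_upwards [eventually_ge_atTop N₀, eventually_ge_atTop N₁, eventually_ge_atTop N₂,
    eventually_ge_atTop N₃, eventually_ge_atTop 4, eventually_ge_atTop (4 * B * C)]
    with N h0 h1 h2 h3 h4 h5
  obtain ⟨P, Q, hPQ⟩ := hpair N h0
  obtain ⟨hPd, hcop⟩ := hN₁ N h1 P Q hPQ
  have hP0 := aeval_int_ne_zero hξ hPQ.left_ne_zero
  set e := |aeval ξ P| with he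
  have he0 : 0 < e := abs_pos.mpr hP0
  set H := Q.supNorm with hH
  have hNH := hPQ.lt_right_supNorm
  have hH0 : 0 < H := by linarith
  have hPH : P.supNorm ≤ H := hPQ.left_supNorm_le.trans hNH.le
  -- This gives `x 0 * (B * e) ≤ 1/4`; together with `5 * H * Y ^ (-l) ≤ 1/4` the pairings are less
  -- than 1 in absolute value.
  let Y : ℝ := (4 * B * e)⁻¹
  have hY0 : 0 < Y := by positivity
  have hYl : Y ^ (-l) = (4 * B * e) ^ l := by
    simp only [Y]
    rw [Real.inv_rpow (by positivity), ← Real.rpow_neg (by positivity), neg_neg]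
  have heC : e * H ^ 3 ≤ C := hPQ.aeval_mul_le
  have hNY : N ≤ Y := by
    simp only [Y]
    rw [le_inv_comm₀ (by linarith) (by positivity), inv_eq_one_div, le_div_iff₀ (by linarith)]
    have a1 : e * N ^ 3 ≤ C := le_trans (by gcongr) heC
    have a2 : 4 * B * (e * N ^ 3) ≤ N := le_trans (by gcongr) h5
    have a3 : (4 * B * e * N) * N ^ 2 ≤ 1 * N ^ 2 := by nlinarith
    exact le_of_mul_le_mul_right a3 (by nlinarith)
  have h20 : 20 * H * Y ^ (-l) ≤ 1 := by
    have b1 := (hN₂ H (h2.trans hNH.le)).le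
    have b2 : e ≤ C * H ^ (-3 : ℝ) := by
      rw [Real.rpow_neg hH0.le, ← div_eq_mul_inv, le_div_iff₀ (by positivity)]
      exact_mod_cast heC
    rw [hYl]
    calc 20 * H * (4 * B * e) ^ l ≤ 20 * H * (4 * B * (C * H ^ (-3 : ℝ))) ^ l := by gcongr
      _ = 20 * (4 * B * C) ^ l * (H ^ (1 : ℝ) * H ^ (-3 * l)) := by
        rw [← mul_assoc (4 * B), Real.mul_rpow (by positivity) (by positivity),
          ← Real.rpow_mul hH0.le, Real.rpow_one]
        ring
      _ = 20 * (4 * B * C) ^ l * H ^ (-(3 * l - 1)) := by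
        rw [← Real.rpow_add hH0]
        congr 2
        ring
      _ ≤ 1 := b1
  have hvan : ∀ x : ℕ → ℤ, IsApprox ξ x (Y ^ (-l)) → (x 0 : ℝ) ≤ Y →
      ∀ j < 2, pairing x (X ^ j * P) = 0 ∧ pairing x (X ^ j * Q) = 0 := by
    intro x hx hxY j hj
    have hx0 : (0 : ℝ) ≤ x 0 := by exact_mod_cast zero_le_one.trans hx.1
    have hxe : (x 0 : ℝ) * (B * e) ≤ 1 / 4 := by
      calc (x 0 : ℝ) * (B * e) ≤ Y * (B * e) := by gcongr
        _ = 1 / 4 := by simp only [Y]; field_simp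
    have hYl0 : 0 ≤ Y ^ (-l) := by positivity
    constructor
    · refine pairing_X_pow_mul_eq_zero hx (by omega) ?_
      have : 5 * P.supNorm * Y ^ (-l) ≤ 5 * H * Y ^ (-l) := by gcongr
      rw [← hB, ← he]
      linarith
    · refine pairing_X_pow_mul_eq_zero hx (by have := hPQ.right_natDegree_le; omega) ?_
      have : (x 0 : ℝ) * (B * |aeval ξ Q|) ≤ x 0 * (B * e) := by
        gcongr
        exact hPQ.aeval_lt.le
      rw [← hB]
      linarith
  obtain ⟨x, hxY, hx⟩ := exists_isApprox_of_solvable (by linarith) (hN₃ Y (h3.trans hNY))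
  have hx2 := hvan x hx hxY
  refine ⟨Y, P, Q, hPQ.left_supNorm_le, hNH, hNY, hPd, hPQ.right_natDegree_le, hcop, he0,
    hPQ.aeval_le, hvan, ?_, ?_⟩
  · have hm := hPQ.supNorm_mul_abs_aeval_le h4 hcop hx (by positivity) (fun j hj => (hx2 j hj).1)
      (hx2 0 (by norm_num)).2
    refine hm.trans ?_
    rw [hYl, Real.mul_rpow (by positivity) he0.le, mul_pow, ← hB, ← mul_assoc]
    have e2 : (e ^ l) ^ 2 = e ^ (2 * l) := by
      rw [← Real.rpow_natCast, ← Real.rpow_mul he0.le]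
      congr 1
      push_cast
      ring
    rw [e2]
    gcongr
  · refine (one_le_mul_abs_aeval hcop hPd hPQ.right_natDegree_le hPQ.right_ne_zero hP0
      hPQ.aeval_lt.le hPH).trans ?_
    have : 0 ≤ P.supNorm := P.supNorm_nonneg
    exact mul_le_mul_of_nonneg_right hK2 (by positivity)

theorem SimultaneousSolvable.mono {n : ℕ} {ξ l l' X : ℝ} (h : SimultaneousSolvable n ξ l X)
    (hX : 1 ≤ X) (hl : l' ≤ l) : SimultaneousSolvable n ξ l' X := by
  obtain ⟨x, y, h1, h2, h3⟩ := h
  exact ⟨x, y, h1, h2, fun j => (h3 j).trans (Real.rpow_le_rpow_of_exponent_le hX (by linarith))⟩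

theorem eventually_solvable_mono {n : ℕ} {ξ l l' : ℝ}
    (h : ∀ᶠ X in atTop, SimultaneousSolvable n ξ l X) (hl : l' ≤ l) :
    ∀ᶠ X in atTop, SimultaneousSolvable n ξ l' X := by
  filter_upwards [h, eventually_ge_atTop 1] with X hX h1
  exact hX.mono h1 hl

theorem frequently_solvable_mono {n : ℕ} {ξ l l' : ℝ}
    (h : ∃ᶠ X in atTop, SimultaneousSolvable n ξ l X) (hl : l' ≤ l) :
    ∃ᶠ X in atTop, SimultaneousSolvable n ξ l' X :=
  (h.and_eventually (eventually_ge_atTop 1)).mono fun _ hX => hX.1.mono hX.2 hl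

theorem GoodPair.right_supNorm_le {ξ l K N Y : ℝ} {P Q : ℤ[X]} (h : GoodPair ξ l K N Y P Q) :
    Q.supNorm ≤ K * |aeval ξ P| ^ (-(1 - 2 * l)) := by
  have he := h.aeval_pos
  have h1 := h.supNorm_mul_le
  have h2 : |aeval ξ P| ^ (2 * l) = |aeval ξ P| ^ (-(1 - 2 * l)) * |aeval ξ P| := by
    nth_rewrite 3 [← Real.rpow_one |aeval ξ P|]
    rw [← Real.rpow_add he]
    congr 1
    ring
  rw [h2, ← mul_assoc] at h1
  exact le_of_mul_le_mul_right h1 he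

/-- The determinant bound gives `1/e ≪ H^5` for `H = H(Q)`; inserted in `H ≪ e^(-(1-2m))` it yields
`H ≪ H^(5-10m)`, impossible for large `H` if `m > 2/5`. -/
theorem uniform_exponent_le {ξ l : ℝ} (hξ : Transcendental ℚ ξ)
    (hS : ∀ᶠ X in atTop, SimultaneousSolvable 4 ξ l X) : l ≤ 2 / 5 := by
  by_contra! hl
  -- Taking `m` below `1/2` keeps the exponent `1 - 2 * m` positive.
  obtain ⟨m, hm1, hm2⟩ : ∃ m, 2 / 5 < m ∧ m < min l (1 / 2) :=
    exists_between (lt_min hl (by norm_num))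
  have hml := (lt_min_iff.mp hm2).1
  have hm3 := (lt_min_iff.mp hm2).2
  obtain ⟨K, hK, hev⟩ := exists_goodPair hξ (by linarith) (eventually_solvable_mono hS hml.le)
  have ev1 := eventually_mul_rpow_neg_lt (K * K ^ (1 - 2 * m)) (δ := 10 * m - 4) (ε := 1)
    (by linarith) one_pos
  obtain ⟨T, hT⟩ := eventually_atTop.mp ev1
  obtain ⟨N, ⟨Y, P, Q, h⟩, hNT, hN1⟩ := (hev.and ((eventually_ge_atTop T).and
    (eventually_ge_atTop 1))).exists
  have h1 := h.right_supNorm_le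
  have hNH := h.lt_right_supNorm
  have hPH := h.left_supNorm_le.trans hNH.le
  have he := h.aeval_pos
  have h2 := h.one_le
  have hP0 := P.supNorm_nonneg
  set H := Q.supNorm with hH
  set e := |aeval ξ P| with hedef
  have hH0 : 0 < H := by linarith
  have h3 : 1 ≤ K * H ^ 5 * e := by
    refine h2.trans ?_
    calc K * (P.supNorm ^ 2 * H ^ 3 * e) ≤ K * (H ^ 2 * H ^ 3 * e) := by gcongr
      _ = _ := by ring
  have h4 : e⁻¹ ≤ K * H ^ 5 := by
    rw [inv_eq_one_div, div_le_iff₀ he]; exact h3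
  have h5 : e ^ (-(1 - 2 * m)) ≤ (K * H ^ 5) ^ (1 - 2 * m) := by
    rw [Real.rpow_neg he.le, ← Real.inv_rpow he.le]
    exact Real.rpow_le_rpow (by positivity) h4 (by linarith)
  have h6 : (K * H ^ 5) ^ (1 - 2 * m) = K ^ (1 - 2 * m) * H ^ (-(10 * m - 4)) * H := by
    rw [Real.mul_rpow hK.le (by positivity), ← Real.rpow_natCast, ← Real.rpow_mul hH0.le, mul_assoc]
    nth_rewrite 3 [← Real.rpow_one H]
    rw [← Real.rpow_add hH0]
    congr 2
    push_cast
    ring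
  have h7 := hT H (hNT.trans hNH.le)
  have h8 : H ≤ K * (K ^ (1 - 2 * m) * H ^ (-(10 * m - 4)) * H) := by
    rw [← h6]
    exact h1.trans (by gcongr)
  nlinarith

/-- The system demands a nonzero nonconstant coefficient; a value below 1 excludes nonzero constant
polynomials. -/
theorem linearFormSolvable_of_polynomial {n : ℕ} {ξ w X : ℝ} {P : ℤ[X]} (hP0 : P ≠ 0)
    (hd : P.natDegree ≤ n) (hH : P.supNorm ≤ X) (hv : |aeval ξ P| ≤ X ^ (-w))
    (h1 : |aeval ξ P| < 1) : LinearFormSolvable n ξ w X := by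
  refine ⟨fun i => P.coeff i, ?_, fun j => (abs_coeff_le_supNorm P _).trans hH, ?_⟩
  · by_contra! hcon
    have hz : ∀ i, 1 ≤ i → P.coeff i = 0 := by
      intro i hi
      by_cases hin : i ≤ n
      · have := hcon ⟨i - 1, by omega⟩
        simp only [Fin.val_succ] at this
        rw [show i - 1 + 1 = i by omega] at this
        exact Int.abs_lt_one_iff.mp this
      · exact coeff_eq_zero_of_natDegree_lt (by omega)
    have hd0 : P.natDegree = 0 := by
      by_contra hne
      exact hP0 (leadingCoeff_eq_zero.mp (hz _ (by omega)))
    rw [eq_C_of_natDegree_eq_zero hd0] at h1 hP0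
    have h0 : P.coeff 0 ≠ 0 := fun h => hP0 (by rw [h, C_0])
    rw [aeval_C] at h1
    have h2 := Int.one_le_abs h0
    have h3 : (1 : ℝ) ≤ |(P.coeff 0 : ℝ)| := by exact_mod_cast h2
    simp only [algebraMap_int_eq, Int.coe_castRingHom] at h1
    linarith
  · have e : ∑ i : Fin (n + 1), (P.coeff i : ℝ) * ξ ^ (i : ℕ) = aeval ξ P := by
      rw [aeval_eq_sum_range' (n := n + 1) (by omega), Finset.sum_range]
      simp
    rw [e]
    exact hv

/-- The system leaves `a 0` unbounded, but a small value bounds it by the other coefficients; this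
accounts for `A`. -/
theorem exists_polynomial_of_linearFormSolvable (n : ℕ) (ξ : ℝ) :
    ∃ A : ℝ, 1 ≤ A ∧ ∀ w X : ℝ, 0 ≤ w → 1 ≤ X → LinearFormSolvable n ξ w X →
      ∃ P : ℤ[X], P ≠ 0 ∧ P.natDegree ≤ n ∧ P.supNorm ≤ A * X ∧ |aeval ξ P| ≤ X ^ (-w) := by
  have hs0 : 0 ≤ ∑ j : Fin n, |ξ| ^ ((j : ℕ) + 1) := by positivity
  refine ⟨1 + ∑ j : Fin n, |ξ| ^ ((j : ℕ) + 1), by linarith, ?_⟩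
  rintro w X hw hX ⟨a, ⟨j, hj⟩, haX, hv⟩
  have hco : ∀ i : Fin (n + 1), (ofFn (n + 1) a).coeff i = a i := fun i =>
    ofFn_coeff_eq_val_of_lt a i.2
  have hdeg : (ofFn (n + 1) a).natDegree < n + 1 := ofFn_natDegree_lt (by omega) a
  have hval : aeval ξ (ofFn (n + 1) a) = ∑ i : Fin (n + 1), (a i : ℝ) * ξ ^ (i : ℕ) := by
    rw [aeval_eq_sum_range' (n := n + 1) hdeg, Finset.sum_range]
    refine Finset.sum_congr rfl fun i _ => ?_
    rw [hco]
    simp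
  have hX1 : X ^ (-w) ≤ X := by
    have := Real.rpow_le_one_of_one_le_of_nonpos hX (show -w ≤ 0 by linarith)
    linarith
  refine ⟨ofFn (n + 1) a, ?_, by omega, ?_, by rw [hval]; exact hv⟩
  · intro h0
    have := hco j.succ
    rw [h0, coeff_zero] at this
    rw [← this] at hj
    norm_num at hj
  · refine supNorm_le_of_coeff fun i => ?_
    have hXA : X ≤ (1 + ∑ j : Fin n, |ξ| ^ ((j : ℕ) + 1)) * X := by nlinarith
    by_cases hi : i < n + 1
    · have hc := hco ⟨i, hi⟩
      simp only at hc
      rw [hc]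
      rcases Nat.eq_zero_or_pos i with rfl | hi0
      · rw [Fin.sum_univ_succ] at hv
        simp only [Fin.val_zero, pow_zero, mul_one, Fin.val_succ] at hv
        have h1 : |∑ j : Fin n, (a j.succ : ℝ) * ξ ^ ((j : ℕ) + 1)|
            ≤ X * ∑ j : Fin n, |ξ| ^ ((j : ℕ) + 1) := by
          refine (Finset.abs_sum_le_sum_abs _ _).trans ?_
          rw [Finset.mul_sum]
          refine Finset.sum_le_sum fun j _ => ?_
          rw [abs_mul, abs_pow]
          gcongr
          exact haX j
        have h2 : |(a 0 : ℝ)| ≤ X ^ (-w) + X * ∑ j : Fin n, |ξ| ^ ((j : ℕ) + 1) := by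
          have := abs_sub (a 0 + ∑ j : Fin n, (a j.succ : ℝ) * ξ ^ ((j : ℕ) + 1))
            (∑ j : Fin n, (a j.succ : ℝ) * ξ ^ ((j : ℕ) + 1))
          rw [add_sub_cancel_right] at this
          linarith
        change |(a 0 : ℝ)| ≤ _
        linarith
      · obtain ⟨k, rfl⟩ : ∃ k, i = k + 1 := ⟨i - 1, by omega⟩
        exact (haX ⟨k, by omega⟩).trans hXA
    · rw [coeff_eq_zero_of_natDegree_lt (by omega)]
      simp only [Int.cast_zero, abs_zero]
      linarith

/-- If `X ^ (-w)` dominates a constant multiple of `X ^ (-v)` frequently, then `w ≤ v`. -/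
theorem le_of_frequently_le_mul_rpow {A v w : ℝ}
    (h : ∃ᶠ X : ℝ in atTop, X ^ (-v) ≤ A * X ^ (-w)) : w ≤ v := by
  by_contra! hlt
  have ev := eventually_mul_rpow_neg_lt A (δ := w - v) (ε := 1) (by linarith) one_pos
  obtain ⟨X, h1, h2, h3⟩ := (h.and_eventually (ev.and (eventually_gt_atTop 0))).exists
  have h4 : X ^ (-w) = X ^ (-(w - v)) * X ^ (-v) := by
    rw [← Real.rpow_add h3]; congr 1; ring
  have h5 : 0 < X ^ (-v) := by positivity
  rw [h4] at h1
  nlinarith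

/-- A solution `R` at level `X` gives `e ≤ X^(-w)` for the pair at that level. Eliminating `H(Q)`
from the two inequalities of a good pair leaves `1 ≪ X^2 e^(6l-2)`. -/
theorem cubic_exponent_le {ξ l w : ℝ} (hξ : Transcendental ℚ ξ) (hl : 1 / 3 < l)
    (hS : ∀ᶠ X in atTop, SimultaneousSolvable 4 ξ l X)
    (hw : ∃ᶠ X in atTop, LinearFormSolvable 3 ξ w X) : w ≤ 1 / (3 * l - 1) := by
  have hl0 : 0 < 3 * l - 1 := by linarith
  rcases lt_or_ge w 0 with hw0 | hw0
  · exact hw0.le.trans (by positivity)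
  obtain ⟨A, hA1, hA⟩ := exists_polynomial_of_linearFormSolvable 3 ξ
  obtain ⟨K, hK, hev⟩ := exists_goodPair hξ hl hS
  obtain ⟨T, hT⟩ := eventually_atTop.mp hev
  have hA0 : 0 < A := by linarith
  have key : ∃ᶠ X : ℝ in atTop, X ^ (-(2 : ℝ)) ≤ K ^ 4 * A ^ 2 * X ^ (-(w * (6 * l - 2))) := by
    refine (hw.and_eventually ((eventually_ge_atTop 1).and (eventually_ge_atTop T))).mono ?_
    rintro X ⟨hX, hX1, hXT⟩
    obtain ⟨R, hR0, hRd, hRH, hRv⟩ := hA w X hw0 hX1 hX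
    have hX0 : 0 < X := by linarith
    -- At level `A * X` the height of `R` is below that of `Q`, so `P` is at least as small as `R`
    -- at `ξ`.
    obtain ⟨Y, P, Q, h⟩ := hT (A * X) (by nlinarith)
    have he := h.aeval_pos
    have h1 := h.right_supNorm_le
    have h2 := h.one_le
    have h3 := (h.aeval_le R hR0 hRd (hRH.trans_lt h.lt_right_supNorm)).trans hRv
    have hP := h.left_supNorm_le
    have hP0 := P.supNorm_nonneg
    have hQ0 := Q.supNorm_nonneg
    set e := |aeval ξ P| with hedef
    have h4 : e * (e ^ (-(1 - 2 * l))) ^ 3 = e ^ (6 * l - 2) := by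
      rw [← Real.rpow_natCast, ← Real.rpow_mul he.le]
      nth_rewrite 1 [← Real.rpow_one e]
      rw [← Real.rpow_add he]
      congr 1
      push_cast
      ring
    have h5 : e ^ (6 * l - 2) ≤ X ^ (-(w * (6 * l - 2))) := by
      calc e ^ (6 * l - 2) ≤ (X ^ (-w)) ^ (6 * l - 2) :=
            Real.rpow_le_rpow he.le h3 (by linarith)
        _ = _ := by rw [← Real.rpow_mul hX0.le]; congr 1; ring
    have h6 : 1 ≤ K ^ 4 * A ^ 2 * X ^ 2 * X ^ (-(w * (6 * l - 2))) := by
      calc 1 ≤ K * (P.supNorm ^ 2 * Q.supNorm ^ 3 * e) := h2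
        _ ≤ K * ((A * X) ^ 2 * (K * e ^ (-(1 - 2 * l))) ^ 3 * e) := by gcongr
        _ = K ^ 4 * A ^ 2 * X ^ 2 * (e * (e ^ (-(1 - 2 * l))) ^ 3) := by ring
        _ ≤ _ := by rw [h4]; gcongr
    have h7 : X ^ (-(2 : ℝ)) * X ^ 2 = 1 := by
      rw [Real.rpow_neg hX0.le, Real.rpow_two]
      field_simp
    calc X ^ (-(2 : ℝ)) = X ^ (-(2 : ℝ)) * 1 := by ring
      _ ≤ X ^ (-(2 : ℝ)) * (K ^ 4 * A ^ 2 * X ^ 2 * X ^ (-(w * (6 * l - 2)))) := by gcongr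
      _ = (X ^ (-(2 : ℝ)) * X ^ 2) * (K ^ 4 * A ^ 2 * X ^ (-(w * (6 * l - 2)))) := by ring
      _ = _ := by rw [h7, one_mul]
  have := le_of_frequently_le_mul_rpow key
  rw [le_div_iff₀ hl0]
  linarith

theorem quadratic_exponent_le {ξ l w : ℝ} (hξ : Transcendental ℚ ξ) (hl : 1 / 3 < l)
    (hS : ∀ᶠ X in atTop, SimultaneousSolvable 4 ξ l X)
    (hw : ∃ᶠ X in atTop, LinearFormSolvable 2 ξ w X) : w ≤ 1 / l := by
  by_contra! hlt
  have hl0 : 0 < l := by linarith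
  have hw0 : 0 < w := lt_trans (by positivity) hlt
  obtain ⟨ω, hω1, hω2⟩ : ∃ ω, 1 / l < ω ∧ ω < min w 3 := exists_between (lt_min hlt (by
    rw [div_lt_iff₀ hl0]; linarith))
  have hωw := (lt_min_iff.mp hω2).1
  have hω0 : 0 < ω := lt_trans (by positivity) hω1
  obtain ⟨c, hc, hlow⟩ := exists_quadratic_lower_bound hξ hl0 hS
    (by rwa [div_lt_iff₀ hl0] at hω1) (lt_min_iff.mp hω2).2
  obtain ⟨A, hA1, hA⟩ := exists_polynomial_of_linearFormSolvable 2 ξ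
  have hA0 : 0 < A := by linarith
  refine absurd (le_of_frequently_le_mul_rpow (A := (c * A ^ (-ω))⁻¹) (v := ω) (w := w) ?_)
    (not_le.mpr hωw)
  refine (hw.and_eventually (eventually_ge_atTop 1)).mono ?_
  rintro X ⟨hX, hX1⟩
  obtain ⟨R, hR0, hRd, hRH, hRv⟩ := hA w X hw0.le hX1 hX
  have hX0 : 0 < X := by linarith
  have h1 := (hlow R hR0 hRd).trans hRv
  have hR1 := one_le_supNorm hR0
  have h2 : A ^ (-ω) * X ^ (-ω) ≤ R.supNorm ^ (-ω) := by
    rw [← Real.mul_rpow hA0.le hX0.le]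
    exact Real.rpow_le_rpow_of_nonpos (by linarith) hRH (by linarith)
  rw [le_inv_mul_iff₀ (by positivity)]
  calc c * A ^ (-ω) * X ^ (-ω) = c * (A ^ (-ω) * X ^ (-ω)) := by ring
    _ ≤ c * R.supNorm ^ (-ω) := by gcongr
    _ ≤ _ := h1

/-! ### Lower bounds for the exponents of cubic linear forms -/

/-- At each level `X` the polynomial `P` itself is a solution, since `X < H(Q) ≪ e^(-(1-2l))`. -/
theorem eventually_linearFormSolvable {ξ l w : ℝ} (hξ : Transcendental ℚ ξ) (hl : 1 / 3 < l)
    (hl2 : l < 1 / 2) (hS : ∀ᶠ X in atTop, SimultaneousSolvable 4 ξ l X)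
    (hw : w * (1 - 2 * l) < 1) : ∀ᶠ X in atTop, LinearFormSolvable 3 ξ w X := by
  obtain ⟨K, hK, hev⟩ := exists_goodPair hξ hl hS
  have h12 : 0 < 1 - 2 * l := by linarith
  have ev1 := eventually_mul_rpow_neg_lt (K ^ (1 / (1 - 2 * l))) (δ := 1 / (1 - 2 * l) - w) (ε := 1)
    (by rw [sub_pos, lt_div_iff₀ h12]; exact hw) one_pos
  filter_upwards [hev, ev1, eventually_ge_atTop 1, eventually_gt_atTop K] with X hX h1 hX1 hXK
  obtain ⟨Y, P, Q, h⟩ := hX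
  have hX0 : 0 < X := by linarith
  have he := h.aeval_pos
  have h2 := h.lt_right_supNorm.le.trans h.right_supNorm_le
  have hP0 : P ≠ 0 := by rintro rfl; simp at he
  have h3 : |aeval ξ P| ^ (1 - 2 * l) ≤ K / X := by
    rw [Real.rpow_neg he.le, ← div_eq_mul_inv, le_div_iff₀ (by positivity)] at h2
    rw [le_div_iff₀ hX0]
    linarith
  have h4 : |aeval ξ P| ≤ (K / X) ^ (1 / (1 - 2 * l)) := by
    have := Real.rpow_le_rpow (by positivity) h3 (show 0 ≤ 1 / (1 - 2 * l) by positivity)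
    rwa [← Real.rpow_mul he.le, mul_one_div_cancel h12.ne', Real.rpow_one] at this
  refine linearFormSolvable_of_polynomial hP0 h.left_natDegree.le h.left_supNorm_le ?_ ?_
  · refine h4.trans ?_
    have e : (K / X) ^ (1 / (1 - 2 * l))
        = K ^ (1 / (1 - 2 * l)) * X ^ (-(1 / (1 - 2 * l) - w)) * X ^ (-w) := by
      rw [Real.div_rpow hK.le hX0.le, mul_assoc, ← Real.rpow_add hX0, div_eq_mul_inv,
        ← Real.rpow_neg hX0.le]
      congr 2
      ring
    rw [e]
    have : 0 < X ^ (-w) := by positivity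
    nlinarith
  · refine h4.trans_lt (Real.rpow_lt_one (by positivity) ?_ (by positivity))
    rw [div_lt_one hX0]
    exact hXK

theorem exists_cubed_lower_bound {ξ l : ℝ} (hξ : Transcendental ℚ ξ) (hl : 1 / 3 < l)
    (hS : ∀ᶠ X in atTop, SimultaneousSolvable 4 ξ l X) :
    ∃ c : ℝ, 0 < c ∧ ∀ R : ℤ[X], R ≠ 0 → R.natDegree ≤ 2 → c ≤ R.supNorm ^ 3 * |aeval ξ R| := by
  have hl0 : 0 < l := by linarith
  obtain ⟨ω, hω1, hω3⟩ : ∃ ω, 1 / l < ω ∧ ω < 3 := exists_between (by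
    rw [div_lt_iff₀ hl0]; linarith)
  obtain ⟨c, hc, hlow⟩ := exists_quadratic_lower_bound hξ hl0 hS
    (by rwa [div_lt_iff₀ hl0] at hω1) hω3
  refine ⟨c, hc, fun R hR0 hRd => ?_⟩
  have h1 := hlow R hR0 hRd
  have hR1 := one_le_supNorm hR0
  have h2 : 1 ≤ R.supNorm ^ 3 * R.supNorm ^ (-ω) := by
    rw [← Real.rpow_natCast, ← Real.rpow_add (by linarith)]
    exact Real.one_le_rpow hR1 (by push_cast; linarith)
  have h3 : 0 < R.supNorm ^ 3 := by positivity
  calc c ≤ c * (R.supNorm ^ 3 * R.supNorm ^ (-ω)) := le_mul_of_one_le_right hc.le h2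
    _ = R.supNorm ^ 3 * (c * R.supNorm ^ (-ω)) := by ring
    _ ≤ _ := by gcongr

theorem aeval_linear (ξ : ℝ) (a b : ℤ) : aeval ξ (C a * X - C b : ℤ[X]) = ξ * a - b := by
  simp [mul_comm]

theorem supNorm_linear_le {a b : ℤ} {B : ℝ} (ha : |(a : ℝ)| ≤ B) (hb : |(b : ℝ)| ≤ B) :
    (C a * X - C b : ℤ[X]).supNorm ≤ B := by
  have hB : 0 ≤ B := (abs_nonneg _).trans ha
  refine supNorm_le_of_coeff fun i => ?_
  rw [coeff_sub, coeff_C_mul, coeff_X, coeff_C]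
  rcases i with _ | _ | i
  · simpa using hb
  · simpa using ha
  · simpa using hB

theorem linear_ne_zero {a : ℤ} (b : ℤ) (ha : a ≠ 0) : (C a * X - C b : ℤ[X]) ≠ 0 := by
  intro h
  have := congrArg (fun p => coeff p 1) h
  simp only [coeff_sub, coeff_C_mul, coeff_X_one, mul_one, coeff_C_succ, sub_zero, coeff_zero] at this
  exact ha this

theorem natDegree_linear_le' (a b : ℤ) : (C a * X - C b : ℤ[X]).natDegree ≤ 1 := by
  compute_degree

theorem IsApprox.abs_le {ξ L : ℝ} {x : ℕ → ℤ} (h : IsApprox ξ x L) (hL : L ≤ 1) :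
    |(x 1 : ℝ)| ≤ (|ξ| + 1) * x 0 := by
  have hx1 : (1 : ℝ) ≤ x 0 := by exact_mod_cast h.1
  have h1 := h.2 1 (by norm_num)
  rw [pow_one, abs_sub_comm] at h1
  have h2 := abs_sub_abs_le_abs_sub (x 1 : ℝ) (ξ * x 0)
  rw [abs_mul, abs_of_pos (show (0 : ℝ) < x 0 by linarith)] at h2
  nlinarith

/-- Points with `x 0 < T` are excluded because `|ξ * x 0 - x 1|` is then bounded below. Replacing
`X` by `x 0` only weakens the error bound. -/
theorem exists_large_isApprox {ξ m : ℝ} (hξ : Transcendental ℚ ξ) (hm : 0 < m)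
    (hF : ∃ᶠ X in atTop, SimultaneousSolvable 4 ξ m X) (T : ℝ) :
    ∃ x : ℕ → ℤ, T ≤ x 0 ∧ IsApprox ξ x ((x 0 : ℝ) ^ (-m)) := by
  obtain ⟨c, hc, hlow⟩ := exists_lower_bound_of_supNorm_le hξ 1 ((|ξ| + 1) * T)
  have ev := eventually_mul_rpow_neg_lt 1 hm hc
  obtain ⟨X, hX, h1, hX1⟩ := (hF.and_eventually (ev.and (eventually_ge_atTop 1))).exists
  obtain ⟨x, hxX, hx⟩ := exists_isApprox_of_solvable hX1 hX
  have hx1 : (1 : ℝ) ≤ x 0 := by exact_mod_cast hx.1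
  refine ⟨x, ?_, hx.mono (Real.rpow_le_rpow_of_nonpos (by linarith) hxX (by linarith))⟩
  by_contra! hlt
  have hL1 : X ^ (-m) ≤ 1 := Real.rpow_le_one_of_one_le_of_nonpos hX1 (by linarith)
  have h0 := abs_nonneg ξ
  have hb := hx.abs_le hL1
  have h2 := hlow (C (x 0) * Polynomial.X - C (x 1)) (linear_ne_zero _ (by have := hx.1; omega))
    (natDegree_linear_le' _ _) (supNorm_linear_le (by rw [_root_.abs_of_pos (by linarith)]; nlinarith)
      (hb.trans (by gcongr)))
  rw [aeval_linear] at h2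
  have h3 := hx.2 1 (by norm_num)
  rw [pow_one] at h3
  linarith

/-- If all minors vanish, `x` is a geometric progression of ratio `u / v` in lowest terms. Its
length forces `v ^ 3 ∣ x 0 / v`, so `|ξ * v - u| ≤ L / v ^ 3`, too small for a linear polynomial. -/
theorem minor₂_ne_zero_of_isApprox {ξ L c : ℝ} {x : ℕ → ℤ}
    (hlow : ∀ R : ℤ[X], R ≠ 0 → R.natDegree ≤ 2 → c ≤ R.supNorm ^ 3 * |aeval ξ R|)
    (hx : IsApprox ξ x L) (hL : L ≤ 1) (hLc : (|ξ| + 1) ^ 3 * L < c) :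
    ∃ i j, minor₂ (fun i : Fin 4 => x i) (fun i : Fin 4 => x (i + 1)) i j ≠ 0 := by
  by_contra! hcon
  have hx0 : x 0 ≠ 0 := by have := hx.1; omega
  have hx0' : (x 0 : ℚ) ≠ 0 := by exact_mod_cast hx0
  have hpos : 0 < x 0 := hx.1
  have h4 := pairing_eq_eval_of_minor₂ hx0 hcon 4 (by norm_num)
  have h4' : x 0 ^ 3 * x 4 = x 1 ^ 4 := by
    have : (x 0 : ℚ) ^ 3 * x 4 = (x 1 : ℚ) ^ 4 := by
      rw [h4]; field_simp
    exact_mod_cast this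
  obtain ⟨v, hv⟩ := Int.gcd_dvd_left (a := x 0) (b := x 1)
  obtain ⟨u, hu⟩ := Int.gcd_dvd_right (a := x 0) (b := x 1)
  set g : ℤ := ((x 0).gcd (x 1) : ℤ) with hg
  have hg0 : 0 < g := by
    exact Int.natCast_pos.mpr (Int.gcd_pos_of_ne_zero_left _ hx0)
  have hv0 : 0 < v := by
    rw [hv] at hpos
    exact pos_of_mul_pos_right hpos hg0.le
  have hcop : IsCoprime v u := by
    have h := Int.isCoprime_iff_gcd_eq_one.mpr
      (Int.gcd_div_gcd_div_gcd (i := x 0) (j := x 1) (Int.gcd_pos_of_ne_zero_left _ hx0))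
    rwa [← hg, Int.ediv_eq_of_eq_mul_right hg0.ne' hv, Int.ediv_eq_of_eq_mul_right hg0.ne' hu] at h
  -- Cancel `g ^ 3` in `x 0 ^ 3 * x 4 = x 1 ^ 4` and use that `v` and `u` are coprime.
  have hdvd : v ^ 3 ∣ g := by
    rw [hv, hu] at h4'
    have h5 : g ^ 3 * (v ^ 3 * x 4) = g ^ 3 * (g * u ^ 4) := by linear_combination h4'
    have h6 : v ^ 3 * x 4 = g * u ^ 4 := mul_left_cancel₀ (by positivity) h5
    exact (hcop.pow (m := 3) (n := 4)).dvd_of_dvd_mul_right ⟨x 4, h6.symm⟩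
  have hvg : (v : ℝ) ^ 3 ≤ g := by exact_mod_cast Int.le_of_dvd hg0 hdvd
  have hgR : (0 : ℝ) < g := by exact_mod_cast hg0
  have hvR : (0 : ℝ) < v := by exact_mod_cast hv0
  have hx0R : (x 0 : ℝ) = g * v := by exact_mod_cast hv
  have hx1R : (x 1 : ℝ) = g * u := by exact_mod_cast hu
  have hu1 : |(u : ℝ)| ≤ (|ξ| + 1) * v := by
    have h1 := hx.abs_le hL
    rw [hx0R, hx1R, abs_mul, abs_of_pos hgR] at h1
    have : (g : ℝ) * |(u : ℝ)| ≤ g * ((|ξ| + 1) * v) := by linarith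
    exact le_of_mul_le_mul_left this hgR
  have hval : (g : ℝ) * |ξ * v - u| ≤ L := by
    have h1 := hx.2 1 (by norm_num)
    rw [pow_one, hx0R, hx1R] at h1
    rw [← abs_of_pos hgR, ← abs_mul]
    rwa [show ξ * (g * v) - g * u = (g : ℝ) * (ξ * v - u) by ring] at h1
  have hsup := supNorm_linear_le (a := v) (b := u) (B := (|ξ| + 1) * v)
    (by rw [abs_of_pos hvR]; nlinarith [abs_nonneg ξ]) hu1
  have h1 := hlow (C v * X - C u) (linear_ne_zero _ hv0.ne')
    ((natDegree_linear_le' v u).trans (by norm_num))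
  rw [aeval_linear] at h1
  have hs0 := supNorm_nonneg (C v * X - C u : ℤ[X])
  have h2 : (C v * X - C u : ℤ[X]).supNorm ^ 3 * |ξ * v - u| ≤ (|ξ| + 1) ^ 3 * L := by
    calc _ ≤ ((|ξ| + 1) * v) ^ 3 * |ξ * v - u| := by gcongr
      _ = (|ξ| + 1) ^ 3 * ((v : ℝ) ^ 3 * |ξ * v - u|) := by ring
      _ ≤ (|ξ| + 1) ^ 3 * (g * |ξ * v - u|) := by gcongr
      _ ≤ _ := by gcongr
  linarith

/-- Let `y = x 0` and `L = y^(-m)`. The orthogonal lattice has covolume `≪ y L`, hence a vector of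
height `≪ y^((1-m)/2)`. Orthogonality to `x` gives it a value `≪ y^((1-m)/2) L / y = y^(-(3m+1)/2)`,
and the quotient of exponents is `(3m+1)/(1-m)`. -/
theorem frequently_linearFormSolvable_of_ordinary {ξ l m w : ℝ} (hξ : Transcendental ℚ ξ)
    (hl : 1 / 3 < l) (hS : ∀ᶠ X in atTop, SimultaneousSolvable 4 ξ l X) (hm0 : 0 < m) (hm1 : m < 1)
    (hF : ∃ᶠ X in atTop, SimultaneousSolvable 4 ξ m X) (hw : w * (1 - m) < 3 * m + 1) :
    ∃ᶠ X in atTop, LinearFormSolvable 3 ξ w X := by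
  obtain ⟨c, hc, hlow⟩ := exists_cubed_lower_bound hξ hl hS
  set B := (1 + |ξ|) ^ 4 with hB
  have hB0 : 0 < B := by positivity
  set A := 4 * √(6 * B) with hA
  have hA0 : 0 < A := by positivity
  have hα : 0 < (1 - m) / 2 := by linarith
  have ev1 := eventually_mul_rpow_neg_lt ((|ξ| + 1) ^ 3) hm0 hc
  have ev2 := eventually_mul_rpow_neg_lt (5 * A * A ^ w) (δ := (3 * m + 1) / 2 - w * ((1 - m) / 2))
    (ε := 1) (by linarith) one_pos
  have ev3 := eventually_mul_rpow_neg_lt (5 * A) (δ := (3 * m + 1) / 2) (ε := 1) (by linarith) one_pos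
  have ev4 := ((tendsto_rpow_atTop hα).const_mul_atTop hA0)
  rw [frequently_atTop]
  intro T
  obtain ⟨T', hT'⟩ := eventually_atTop.mp
    (((ev1.and ev2).and (ev3.and (ev4.eventually_ge_atTop T))).and (eventually_ge_atTop 1))
  obtain ⟨x, hxT, hx⟩ := exists_large_isApprox hξ hm0 hF T'
  obtain ⟨⟨⟨e1, e2⟩, e3, e4⟩, hy1⟩ := hT' _ hxT
  set y : ℝ := (x 0 : ℝ) with hy
  have hy0 : 0 < y := by linarith
  set L := y ^ (-m) with hL
  have hL1 : L ≤ 1 := Real.rpow_le_one_of_one_le_of_nonpos hy1 (by linarith)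
  have hL0 : 0 < L := by positivity
  obtain ⟨i, j, hM, hsmall, -⟩ := exists_small_orthogonal (fun i : Fin 4 => x i)
    (fun i : Fin 4 => x (i + 1)) (fun i : Fin 4 => ξ ^ (i : ℕ)) (show 0 < 6 * B * L ^ 2 by positivity)
    (minor₂_ne_zero_of_isApprox hlow hx hL1 e1) hx.abs_minor₃_le
  have hMle := hx.abs_minor₂_le hL1 i j
  set M := |(minor₂ (fun i : Fin 4 => x i) (fun i : Fin 4 => x (i + 1)) i j : ℝ)| with hMdef
  have hM1 : 1 ≤ M := by
    have := Int.one_le_abs hM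
    rw [hMdef]
    exact_mod_cast this
  have hsq1 : 1 ≤ √M := Real.one_le_sqrt.mpr hM1
  have hs := Nat.le_ceil √M
  have hs' := Nat.ceil_lt_add_one (Real.sqrt_nonneg M)
  -- The least integer `s` with `M ≤ s ^ 2` gives the shortest vector. The value estimate of the
  -- lattice lemma is dropped in favour of orthogonality.
  obtain ⟨r, hr0, hru, hrv, hrs, -⟩ := hsmall ⌈√M⌉₊ (Nat.one_le_ceil_iff.mpr (by linarith)) (by
    calc M = √M ^ 2 := (Real.sq_sqrt (by linarith)).symm
      _ ≤ _ := by gcongr)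
  have hyL : √(y * L) = y ^ ((1 - m) / 2) := by
    rw [hL, Real.sqrt_eq_rpow]
    nth_rewrite 1 [← Real.rpow_one y]
    rw [← Real.rpow_add hy0, ← Real.rpow_mul hy0.le]
    congr 1
    ring
  have hsqM : √M ≤ √(6 * B) * y ^ ((1 - m) / 2) := by
    rw [← hyL, ← Real.sqrt_mul (by positivity)]
    exact Real.sqrt_le_sqrt hMle
  have hsup : (ofFn 4 r).supNorm ≤ A * y ^ ((1 - m) / 2) := by
    refine supNorm_ofFn_le fun i => (hrs i).trans ?_
    rw [hA]
    linarith
  have hdeg := natDegree_ofFn_le r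
  have hpz : pairing x (ofFn 4 r) = 0 := by
    have h := (pairing_X_pow_mul (x := x) hdeg).1
    rw [pow_zero, one_mul] at h
    rw [h, ← hru]
    exact Finset.sum_congr rfl fun i _ => by rw [coeff_ofFn]
  have hval : |aeval ξ (ofFn 4 r)| ≤ 5 * A * y ^ (-((3 * m + 1) / 2)) := by
    have h := abs_pairing_sub_le hx (P := ofFn 4 r) (by omega)
    rw [hpz, Int.cast_zero, zero_sub, abs_neg, abs_mul, ← hy, abs_of_pos hy0] at h
    have e : 5 * (A * y ^ ((1 - m) / 2)) * L = y * (5 * A * y ^ (-((3 * m + 1) / 2))) := by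
      rw [hL, show 5 * (A * y ^ ((1 - m) / 2)) * y ^ (-m) = 5 * A * (y ^ ((1 - m) / 2) * y ^ (-m))
        by ring, show y * (5 * A * y ^ (-((3 * m + 1) / 2)))
          = 5 * A * (y ^ (1 : ℝ) * y ^ (-((3 * m + 1) / 2))) by rw [Real.rpow_one]; ring,
        ← Real.rpow_add hy0, ← Real.rpow_add hy0]
      congr 2
      ring
    have h2 : 5 * (ofFn 4 r).supNorm * L ≤ 5 * (A * y ^ ((1 - m) / 2)) * L := by gcongr
    rw [e] at h2
    exact le_of_mul_le_mul_left (h.trans h2) hy0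
  refine ⟨A * y ^ ((1 - m) / 2), e4, linearFormSolvable_of_polynomial (ofFn_ne_zero hr0) hdeg hsup
    (hval.trans ?_) (hval.trans_lt e3)⟩
  rw [Real.mul_rpow hA0.le (by positivity), ← Real.rpow_mul hy0.le, Real.rpow_neg hA0.le,
    le_inv_mul_iff₀ (by positivity)]
  have e : A ^ w * (5 * A * y ^ (-((3 * m + 1) / 2)))
      = 5 * A * A ^ w * y ^ (-((3 * m + 1) / 2 - w * ((1 - m) / 2))) * y ^ ((1 - m) / 2 * -w) := by
    rw [mul_assoc (5 * A * A ^ w), ← Real.rpow_add hy0,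
      show -((3 * m + 1) / 2 - w * ((1 - m) / 2)) + (1 - m) / 2 * -w = -((3 * m + 1) / 2) by ring]
    ring
  rw [e]
  have : 0 < y ^ ((1 - m) / 2 * -w) := by positivity
  nlinarith

/-! ### Cross products of approximation points -/

/-- The `3 × 3` minors of three integer vectors. -/
def intMinor₃ {ι : Type*} (c u v : ι → ℤ) (i j k : ι) : ℤ :=
  c i * minor₂ u v j k - c j * minor₂ u v i k + c k * minor₂ u v i j

/-- The generalized cross product of three vectors in dimension four. -/
def crossVec (c u v : Fin 4 → ℤ) : Fin 4 → ℤ :=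
  ![-intMinor₃ c u v 1 2 3, intMinor₃ c u v 0 2 3, -intMinor₃ c u v 0 1 3, intMinor₃ c u v 0 1 2]

theorem minor₂_mul_sum_eq (c u v r : Fin 4 → ℤ) (hu : ∑ i, r i * u i = 0)
    (hv : ∑ i, r i * v i = 0) (a b : Fin 4) :
    minor₂ u v a b * ∑ i, r i * c i = ∑ k, r k * intMinor₃ c u v a b k := by
  simp only [Fin.sum_univ_four, minor₂, intMinor₃] at *
  linear_combination c a * (v b * hu - u b * hv) - c b * (v a * hu - u a * hv)

/-- A vector `r` orthogonal to `u` and `v` but not to `c` shows that `c` is outside their span, so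
the three vectors are independent. -/
theorem crossVec_ne_zero {c u v r : Fin 4 → ℤ} (hu : ∑ i, r i * u i = 0)
    (hv : ∑ i, r i * v i = 0) (hc : ∑ i, r i * c i ≠ 0) (h : ∃ i j, minor₂ u v i j ≠ 0) :
    crossVec c u v ≠ 0 := by
  intro h0
  have h1 : intMinor₃ c u v 1 2 3 = 0 := neg_eq_zero.mp (congrFun h0 0)
  have h2 : intMinor₃ c u v 0 2 3 = 0 := congrFun h0 1
  have h3 : intMinor₃ c u v 0 1 3 = 0 := neg_eq_zero.mp (congrFun h0 2)
  have h4 : intMinor₃ c u v 0 1 2 = 0 := congrFun h0 3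
  -- The minors alternate in their indices, so the four with increasing indices decide.
  have hz : ∀ i j k, intMinor₃ c u v i j k = 0 := by
    have hswap : ∀ i j k, intMinor₃ c u v i j k = -intMinor₃ c u v j i k := fun i j k => by
      simp only [intMinor₃, minor₂]; ring
    have hrot : ∀ i j k, intMinor₃ c u v i j k = intMinor₃ c u v j k i := fun i j k => by
      simp only [intMinor₃, minor₂]; ring
    have hdiag : ∀ i k, intMinor₃ c u v i i k = 0 := fun i k => by
      have := hswap i i k; omega
    have hlt : ∀ i j k : Fin 4, i < j → j < k → intMinor₃ c u v i j k = 0 := by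
      intro i j k hij hjk
      fin_cases i <;> fin_cases j <;> fin_cases k <;> first | assumption | simp at hij hjk
    have hlt' : ∀ i j k : Fin 4, i < j → i < k → intMinor₃ c u v i j k = 0 := by
      intro i j k hij hik
      rcases lt_trichotomy j k with h | h | h
      · exact hlt i j k hij h
      · rw [hrot, h]; exact hdiag _ _
      · rw [hrot, hswap, ← hrot i k j, hlt i k j hik h, neg_zero]
    intro i j k
    rcases eq_or_ne i j with h | hij
    · rw [h]; exact hdiag _ _
    rcases eq_or_ne j k with h | hjk
    · rw [hrot, h]; exact hdiag _ _
    rcases eq_or_ne i k with h | hik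
    · rw [hrot, hrot, h]; exact hdiag _ _
    rcases lt_or_gt_of_ne hij with h | h
    · rcases lt_or_gt_of_ne hik with h' | h'
      · exact hlt' i j k h h'
      · rw [hrot, hrot]; exact hlt' k i j h' (h'.trans h)
    · rcases lt_or_gt_of_ne hjk with h' | h'
      · rw [hrot]; exact hlt' j k i h' h
      · rw [hrot, hrot]; exact hlt' k i j (h'.trans h) h'
  obtain ⟨i, j, hij⟩ := h
  have key := minor₂_mul_sum_eq c u v r hu hv i j
  simp only [hz, mul_zero, Finset.sum_const_zero] at key
  exact mul_ne_zero hij hc key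

/-- The value at `z` is the determinant of `z, c, u, v` up to sign; the part of `c` along `z`
contributes nothing. -/
theorem sum_crossVec_mul (c u v : Fin 4 → ℤ) (z e : Fin 4 → ℝ) (t : ℝ)
    (h : ∀ i, (c i : ℝ) = t * z i - e i) :
    ∑ i, (crossVec c u v i : ℝ) * z i =
      -(e 0 * minor₃ z u v 1 2 3 - e 1 * minor₃ z u v 0 2 3 + e 2 * minor₃ z u v 0 1 3
        - e 3 * minor₃ z u v 0 1 2) := by
  simp only [Fin.sum_univ_four, crossVec, intMinor₃, minor₃, Matrix.cons_val]
  push_cast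
  rw [h 0, h 1, h 2, h 3]
  ring

theorem intMinor₃_eq (c u v : Fin 4 → ℤ) (z e : Fin 4 → ℝ) (t : ℝ)
    (h : ∀ i, (c i : ℝ) = t * z i - e i) (i j k : Fin 4) :
    (intMinor₃ c u v i j k : ℝ) = t * minor₃ z u v i j k
      - (e i * minor₂ u v j k - e j * minor₂ u v i k + e k * minor₂ u v i j) := by
  simp only [intMinor₃, minor₃]
  push_cast
  rw [h i, h j, h k]
  ring

/-! ### Consecutive minimal points -/

/-- The nearest integers to `ξ ^ i * q`. -/
noncomputable def nearest (ξ : ℝ) (q : ℤ) (i : ℕ) : ℤ := round (ξ ^ i * q)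

/-- The largest distance of `ξ ^ i * q` with `i ≤ 4` to the nearest integer. -/
noncomputable def approxError (ξ : ℝ) (q : ℤ) : ℝ :=
  (Finset.range 5).sup' ⟨0, by simp⟩ fun i => |ξ ^ i * q - nearest ξ q i|

theorem nearest_zero (ξ : ℝ) (q : ℤ) : nearest ξ q 0 = q := by simp [nearest]

theorem isApprox_nearest (ξ : ℝ) {q : ℤ} (hq : 1 ≤ q) :
    IsApprox ξ (nearest ξ q) (approxError ξ q) := by
  refine ⟨by rwa [nearest_zero], fun i hi => ?_⟩
  rw [nearest_zero]
  exact Finset.le_sup' (fun i => |ξ ^ i * q - nearest ξ q i|) (Finset.mem_range.mpr hi)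

theorem IsApprox.approxError_le {ξ L : ℝ} {x : ℕ → ℤ} (h : IsApprox ξ x L) :
    approxError ξ (x 0) ≤ L :=
  Finset.sup'_le _ _ fun i hi => (round_le _ _).trans (h.2 i (Finset.mem_range.mp hi))

theorem approxError_pos {ξ : ℝ} (hξ : Transcendental ℚ ξ) {q : ℤ} (hq : 1 ≤ q) :
    0 < approxError ξ q := by
  have h1 := (isApprox_nearest ξ hq).2 1 (by norm_num)
  refine lt_of_lt_of_le ?_ h1
  rw [nearest_zero, pow_one, ← aeval_linear]
  exact abs_pos.mpr (aeval_int_ne_zero hξ (linear_ne_zero _ (by omega)))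

/-- The main part of `x'` meets a minor of size `O(L^2)`. Its errors meet minors of size `O(x 0 *
L)`, which is no worse since `L' ≤ L` and `x 0 ≤ x' 0`. -/
theorem abs_intMinor₃_le {ξ L L' : ℝ} {x x' : ℕ → ℤ} (hx : IsApprox ξ x L) (hx' : IsApprox ξ x' L')
    (hL : L ≤ 1) (hL' : L' ≤ L) (hxx : x 0 ≤ x' 0) {s : ℕ} (hs : s < 2) (i j k : Fin 4) :
    |(intMinor₃ (fun i : Fin 4 => x' (i + s)) (fun i : Fin 4 => x i) (fun i : Fin 4 => x (i + 1)) i j k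
      : ℝ)| ≤ 24 * ((1 + |ξ|) ^ 4) ^ 2 * (x' 0 * L ^ 2) := by
  set B := (1 + |ξ|) ^ 4 with hB
  have hB1 : 1 ≤ B := one_le_pow₀ (by linarith [abs_nonneg ξ])
  have hL0 := hx.nonneg
  have hL'0 := hx'.nonneg
  have hx1 : (1 : ℝ) ≤ x 0 := by exact_mod_cast hx.1
  have hxxR : (x 0 : ℝ) ≤ x' 0 := by exact_mod_cast hxx
  have hc : ∀ i : Fin 4, ((x' (i + s) : ℤ) : ℝ)
      = (ξ ^ s * x' 0) * ξ ^ (i : ℕ) - (ξ ^ ((i : ℕ) + s) * x' 0 - x' (i + s)) := fun i => by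
    rw [pow_add]; ring
  have he : ∀ i : Fin 4, |ξ ^ ((i : ℕ) + s) * x' 0 - x' (i + s)| ≤ L' := fun i =>
    hx'.2 _ (by omega)
  rw [intMinor₃_eq _ _ _ (fun i : Fin 4 => ξ ^ (i : ℕ)) _ _ hc]
  have hm3 := hx.abs_minor₃_le i j k
  have ht : |ξ ^ s * (x' 0 : ℝ)| ≤ B * x' 0 := by
    rw [abs_mul, abs_pow, abs_of_pos (show (0 : ℝ) < x' 0 by linarith)]
    have := abs_pow_le_one_add ξ (show s ≤ 4 by omega)
    have hx'0 : (0 : ℝ) ≤ x' 0 := by linarith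
    gcongr
  have hterm : ∀ i j k : Fin 4, |(ξ ^ ((i : ℕ) + s) * x' 0 - x' (i + s))
      * (minor₂ (fun i : Fin 4 => x i) (fun i : Fin 4 => x (i + 1)) j k : ℝ)|
      ≤ L' * (6 * B * (x 0 * L)) := by
    intro i j k
    rw [abs_mul]
    exact mul_le_mul (he i) (hx.abs_minor₂_le hL j k) (abs_nonneg _) hL'0
  have h1 := hterm i j k
  have h2 := hterm j i k
  have h3 := hterm k i j
  have h4 : L' * (6 * B * (x 0 * L)) ≤ 6 * B ^ 2 * (x' 0 * L ^ 2) := by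
    calc L' * (6 * B * (x 0 * L)) ≤ L * (6 * B * (x' 0 * L)) := by gcongr
      _ = 6 * B * (x' 0 * L ^ 2) := by ring
      _ ≤ 6 * B ^ 2 * (x' 0 * L ^ 2) := by
        have : B ≤ B ^ 2 := by nlinarith
        have : 0 ≤ (x' 0 : ℝ) * L ^ 2 := mul_nonneg (by linarith) (by positivity)
        gcongr
  have h5 := mul_le_mul ht hm3 (abs_nonneg _) (by nlinarith)
  rw [← abs_mul] at h5
  have habs : ∀ a b c d : ℝ, |a - (b - c + d)| ≤ |a| + |b| + |c| + |d| := by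
    intro a b c d
    have := abs_sub a (b - c + d)
    have := abs_add_le (b - c) d
    have := abs_sub b c
    linarith
  refine (habs _ _ _ _).trans ?_
  nlinarith

theorem abs_sum_crossVec_le {ξ L L' : ℝ} {x x' : ℕ → ℤ} (hx : IsApprox ξ x L)
    (hx' : IsApprox ξ x' L') {s : ℕ} (hs : s < 2) :
    |∑ i : Fin 4, (crossVec (fun i : Fin 4 => x' (i + s)) (fun i : Fin 4 => x i)
      (fun i : Fin 4 => x (i + 1)) i : ℝ) * ξ ^ (i : ℕ)| ≤ 24 * (1 + |ξ|) ^ 4 * (L' * L ^ 2) := by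
  have hc : ∀ i : Fin 4, ((x' (i + s) : ℤ) : ℝ)
      = (ξ ^ s * x' 0) * ξ ^ (i : ℕ) - (ξ ^ ((i : ℕ) + s) * x' 0 - x' (i + s)) := fun i => by
    rw [pow_add]; ring
  rw [sum_crossVec_mul _ _ _ (fun i : Fin 4 => ξ ^ (i : ℕ)) _ _ hc, abs_neg]
  have hterm : ∀ a i j k : Fin 4, |(ξ ^ ((a : ℕ) + s) * x' 0 - x' (a + s))
      * minor₃ (fun i : Fin 4 => ξ ^ (i : ℕ)) (fun i : Fin 4 => x i) (fun i : Fin 4 => x (i + 1)) i j k|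
      ≤ L' * (6 * (1 + |ξ|) ^ 4 * L ^ 2) := by
    intro a i j k
    rw [abs_mul]
    exact mul_le_mul (hx'.2 _ (by omega)) (hx.abs_minor₃_le i j k) (abs_nonneg _) hx'.nonneg
  have h0 := hterm 0 1 2 3
  have h1 := hterm 1 0 2 3
  have h2 := hterm 2 0 1 3
  have h3 := hterm 3 0 1 2
  have habs : ∀ a b c d : ℝ, |a - b + c - d| ≤ |a| + |b| + |c| + |d| := by
    intro a b c d
    have := abs_sub (a - b + c) d
    have := abs_add_le (a - b) c
    have := abs_sub a b
    linarith
  refine (habs _ _ _ _).trans ?_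
  linarith

/-- `k` minimizes the error up to `Y` and `q` is the first denominator doing strictly better; it
exists because errors become arbitrarily small while that of `k` is positive. -/
theorem exists_next_approximation {ξ l : ℝ} (hξ : Transcendental ℚ ξ) (hl : 0 < l)
    (hS : ∀ᶠ X in atTop, SimultaneousSolvable 4 ξ l X) {Y : ℝ} (hY : 1 ≤ Y) :
    ∃ k q : ℤ, 1 ≤ k ∧ (k : ℝ) ≤ Y ∧ Y < q ∧ approxError ξ q < approxError ξ k ∧
      (∀ j : ℤ, 1 ≤ j → (j : ℝ) ≤ Y → approxError ξ k ≤ approxError ξ j) ∧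
      ∀ j : ℤ, 1 ≤ j → j < q → approxError ξ k ≤ approxError ξ j := by
  obtain ⟨k, hk, hmin⟩ := Finset.exists_min_image (Finset.Icc 1 ⌊Y⌋) (approxError ξ)
    ⟨1, Finset.mem_Icc.mpr ⟨le_rfl, Int.le_floor.mpr (by simpa using hY)⟩⟩
  obtain ⟨hk1, hk2⟩ := Finset.mem_Icc.mp hk
  have hmin' : ∀ j : ℤ, 1 ≤ j → (j : ℝ) ≤ Y → approxError ξ k ≤ approxError ξ j := fun j h1 h2 =>
    hmin j (Finset.mem_Icc.mpr ⟨h1, Int.le_floor.mpr h2⟩)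
  obtain ⟨X, hX, h1, hX1⟩ := (hS.and ((eventually_mul_rpow_neg_lt 1 hl (approxError_pos hξ hk1)).and
    (eventually_ge_atTop 1))).exists
  obtain ⟨x, -, hx⟩ := exists_isApprox_of_solvable hX1 hX
  obtain ⟨q, ⟨hq1, hq2⟩, hq3⟩ := Int.exists_least_of_bdd
    (P := fun q => 1 ≤ q ∧ approxError ξ q < approxError ξ k) ⟨1, fun z hz => hz.1⟩
    ⟨x 0, hx.1, hx.approxError_le.trans_lt (by linarith)⟩
  refine ⟨k, q, hk1, Int.le_floor.mp hk2, ?_, hq2, hmin', fun j hj1 hjq => ?_⟩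
  · by_contra! h
    exact absurd (hmin' q hq1 h) (not_le.mpr hq2)
  · by_contra! h
    exact absurd (hq3 j ⟨hj1, h⟩) (not_le.mpr hjq)

/-- If `x'` is a better approximation than `x` with a larger denominator, then it is not orthogonal
to all of `P, X P, Q, X Q` when `x` is. -/
theorem exists_pairing_ne_zero {ξ : ℝ} {P Q : ℤ[X]} {k q : ℤ} (hk : 1 ≤ k) (hkq : k < q)
    (herr : approxError ξ q < approxError ξ k)
    (hc : IsCoprime (P.map (Int.castRingHom ℚ)) (Q.map (Int.castRingHom ℚ)))
    (hPd : P.natDegree = 3) (hQd : Q.natDegree ≤ 3)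
    (hz : ∀ j < 2, pairing (nearest ξ k) (X ^ j * P) = 0 ∧ pairing (nearest ξ k) (X ^ j * Q) = 0) :
    ∃ j < 2, ∃ R : ℤ[X], (R = P ∨ R = Q) ∧ pairing (nearest ξ q) (X ^ j * R) ≠ 0 := by
  by_contra! hcon
  have hkR : (0 : ℝ) < k := by exact_mod_cast hk
  have hkqR : (k : ℝ) < q := by exact_mod_cast hkq
  have hprop : ∀ i < 5, k * nearest ξ q i = q * nearest ξ k i := by
    intro i hi
    have := mul_eq_mul_of_pairing_eq_zero (x := nearest ξ k) (x' := nearest ξ q) hc hPd hQd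
      (by rw [nearest_zero]; omega) (fun j hj => (hz j hj).1) (fun j hj => (hz j hj).2)
      (fun j hj => hcon j hj P (Or.inl rfl)) (fun j hj => hcon j hj Q (Or.inr rfl)) hi
    rwa [nearest_zero, nearest_zero] at this
  -- Proportional points have errors in the ratio `q / k > 1`, so the error at `q` could not be
  -- smaller.
  refine absurd herr (not_lt.mpr (Finset.sup'_le _ _ fun i hi => ?_))
  have hi5 := Finset.mem_range.mp hi
  have h1 : (k : ℝ) * nearest ξ q i = q * nearest ξ k i := by exact_mod_cast hprop i hi5
  have h2 : (q : ℝ) * |ξ ^ i * k - nearest ξ k i| = k * |ξ ^ i * q - nearest ξ q i| := by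
    rw [← abs_of_pos hkR, ← abs_of_pos (hkR.trans hkqR), ← abs_mul, ← abs_mul,
      abs_of_pos hkR, abs_of_pos (hkR.trans hkqR)]
    congr 1
    linear_combination h1
  have h3 : |ξ ^ i * q - nearest ξ q i| ≤ approxError ξ q := by
    have := (isApprox_nearest ξ (show 1 ≤ q by omega)).2 i hi5
    rwa [nearest_zero] at this
  refine le_trans ?_ h3
  have h4 := abs_nonneg (ξ ^ i * k - nearest ξ k i)
  have h5 : (k : ℝ) * |ξ ^ i * k - nearest ξ k i| ≤ k * |ξ ^ i * q - nearest ξ q i| := by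
    rw [← h2]; gcongr
  exact le_of_mul_le_mul_left h5 hkR

-- The point of `k` kills `P, XP, Q, XQ` and the next one, of `q`, does not. So some shift of the
-- latter is independent of the two shifts of the former. Their cross product is a nonzero cubic of
-- height `≪ q L^2 ≪ q^(1-2l)` and value `≪ L^3 ≪ q^(-3l)`.
set_option maxHeartbeats 1000000 in
theorem frequently_linearFormSolvable_of_uniform {ξ l w : ℝ} (hξ : Transcendental ℚ ξ)
    (hl : 1 / 3 < l) (hl2 : l < 1 / 2) (hS : ∀ᶠ X in atTop, SimultaneousSolvable 4 ξ l X)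
    (hw : w * (1 - 2 * l) < 3 * l) : ∃ᶠ X in atTop, LinearFormSolvable 3 ξ w X := by
  have hl0 : 0 < l := by linarith
  have h12 : 0 < 1 - 2 * l := by linarith
  obtain ⟨K, hK, hev⟩ := exists_goodPair hξ hl hS
  set B := (1 + |ξ|) ^ 4 with hB
  have hB1 : 1 ≤ B := one_le_pow₀ (by linarith [abs_nonneg ξ])
  set b := (2 : ℝ) ^ l with hb
  have hb1 : 1 ≤ b := Real.one_le_rpow (by norm_num) hl0.le
  set A := 24 * B ^ 2 * b ^ 3 with hA
  have hA0 : 0 < A := by positivity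
  obtain ⟨T₁, hT₁⟩ := eventually_atTop.mp hS
  have ev1 := eventually_mul_rpow_neg_lt (A * A ^ w) (δ := 3 * l - w * (1 - 2 * l)) (ε := 1)
    (by linarith) one_pos
  have ev2 := eventually_mul_rpow_neg_lt A (δ := 3 * l) (ε := 1) (by linarith) one_pos
  have ev3 := (tendsto_rpow_atTop h12).const_mul_atTop hA0
  rw [frequently_atTop]
  intro T
  obtain ⟨T₂, hT₂⟩ := eventually_atTop.mp ((ev1.and ev2).and (ev3.eventually_ge_atTop T))
  obtain ⟨N, ⟨Y, P, Q, h⟩, hN⟩ := (hev.and (eventually_ge_atTop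
    (max (max T₂ 2) (max T₁ (2 * T₁))))).exists
  simp only [max_le_iff] at hN
  obtain ⟨⟨hNT₂, hN2⟩, hNT₁, hNT₁'⟩ := hN
  have hNY := h.le_bound
  obtain ⟨k, q, hk1, hkY, hYq, herr, hmin, hmin'⟩ :=
    exists_next_approximation hξ hl0 hS (show 1 ≤ Y by linarith)
  have hkq : k < q := by exact_mod_cast hkY.trans_lt hYq
  have hq1 : 1 ≤ q := by omega
  set L := approxError ξ k with hL
  have hL0 : 0 < L := approxError_pos hξ hk1
  have hxk : IsApprox ξ (nearest ξ k) L := isApprox_nearest ξ hk1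
  have hxq : IsApprox ξ (nearest ξ q) (approxError ξ q) := isApprox_nearest ξ hq1
  obtain ⟨x, hxY, hx⟩ := exists_isApprox_of_solvable (by linarith) (hT₁ Y (by linarith))
  have hLY : L ≤ Y ^ (-l) := (hmin _ hx.1 hxY).trans hx.approxError_le
  have hL1 : L ≤ 1 := hLY.trans (Real.rpow_le_one_of_one_le_of_nonpos (by linarith) (by linarith))
  set y : ℝ := (q : ℝ) with hy
  have hy0 : 0 < y := by linarith
  have hLy : L ≤ b * y ^ (-l) := by
    -- Solving at `q / 2` ensures `x 0 < q` strictly, where `k` is still optimal; the cost is the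
    -- factor `b = 2 ^ l`.
    obtain ⟨x, hxY, hx⟩ := exists_isApprox_of_solvable (X := y / 2) (by linarith)
      (hT₁ (y / 2) (by linarith))
    have hxq : x 0 < q := by
      have : (x 0 : ℝ) < q := by linarith
      exact_mod_cast this
    refine ((hmin' _ hx.1 hxq).trans hx.approxError_le).trans (le_of_eq ?_)
    rw [Real.div_rpow hy0.le (by norm_num), hb, Real.rpow_neg (by norm_num : (0 : ℝ) ≤ 2), div_inv_eq_mul,
      mul_comm]
  have hz := h.pairing_eq_zero _ (hxk.mono hLY) (by rwa [nearest_zero])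
  obtain ⟨s, hs, R, hR, hne⟩ := exists_pairing_ne_zero hk1 hkq herr h.coprime h.left_natDegree
    h.right_natDegree_le hz
  have hRd : R.natDegree ≤ 3 := by
    rcases hR with rfl | rfl
    · exact h.left_natDegree.le
    · exact h.right_natDegree_le
  have hRz : ∀ j < 2, pairing (nearest ξ k) (X ^ j * R) = 0 := by
    intro j hj
    rcases hR with rfl | rfl
    · exact (hz j hj).1
    · exact (hz j hj).2
  have hRk := pairing_X_pow_mul (x := nearest ξ k) hRd
  have hRq := pairing_X_pow_mul (x := nearest ξ q) hRd
  have hRs : ∑ i : Fin 4, R.coeff i * nearest ξ q (i + s) ≠ 0 := by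
    interval_cases s
    · rwa [hRq.1] at hne
    · rwa [hRq.2] at hne
  set D := crossVec (fun i : Fin 4 => nearest ξ q (i + s)) (fun i : Fin 4 => nearest ξ k i)
    (fun i : Fin 4 => nearest ξ k (i + 1)) with hD
  have hD0 : D ≠ 0 := by
    refine crossVec_ne_zero (r := fun i => R.coeff i) ?_ ?_ hRs ?_
    · rw [← hRk.1]; exact hRz 0 (by norm_num)
    · rw [← hRk.2]; exact hRz 1 (by norm_num)
    · exact exists_minor₂_ne_zero (by rw [nearest_zero]; omega) h.coprime h.left_natDegree.le
        h.right_natDegree_le (hz 0 (by norm_num)).1 (hz 0 (by norm_num)).2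
  have hL2 : L ^ 2 ≤ b ^ 2 * y ^ (-(2 * l)) := by
    calc L ^ 2 ≤ (b * y ^ (-l)) ^ 2 := by gcongr
      _ = b ^ 2 * y ^ (-(2 * l)) := by
        rw [mul_pow, ← Real.rpow_natCast (y ^ (-l)), ← Real.rpow_mul hy0.le]
        congr 2
        push_cast
        ring
  have hyl : y * y ^ (-(2 * l)) = y ^ (1 - 2 * l) := by
    nth_rewrite 1 [← Real.rpow_one y]
    rw [← Real.rpow_add hy0]
    congr 1
  have hyl' : y ^ (-l) * y ^ (-(2 * l)) = y ^ (-(3 * l)) := by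
    rw [← Real.rpow_add hy0]
    congr 1
    ring
  have hDsup : (ofFn 4 D).supNorm ≤ A * y ^ (1 - 2 * l) := by
    have hbound : ∀ i j k' : Fin 4, |(intMinor₃ (fun i : Fin 4 => nearest ξ q (i + s))
        (fun i : Fin 4 => nearest ξ k i) (fun i : Fin 4 => nearest ξ k (i + 1)) i j k' : ℝ)|
        ≤ A * y ^ (1 - 2 * l) := by
      intro i j k'
      have h1 := abs_intMinor₃_le hxk hxq hL1 herr.le (by rw [nearest_zero, nearest_zero]; exact hkq.le)
        hs i j k'
      rw [nearest_zero, ← hy, ← hB] at h1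
      refine h1.trans ?_
      calc 24 * B ^ 2 * (y * L ^ 2) ≤ 24 * B ^ 2 * (y * (b ^ 2 * y ^ (-(2 * l)))) := by gcongr
        _ = 24 * B ^ 2 * b ^ 2 * y ^ (1 - 2 * l) := by rw [← hyl]; ring
        _ ≤ A * y ^ (1 - 2 * l) := by
          rw [hA]
          have : b ^ 2 ≤ b ^ 3 := pow_le_pow_right₀ hb1 (by norm_num)
          gcongr
    refine supNorm_ofFn_le fun i => ?_
    fin_cases i
    · change |((-intMinor₃ _ _ _ 1 2 3 : ℤ) : ℝ)| ≤ _
      rw [Int.cast_neg, abs_neg]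
      exact hbound _ _ _
    · exact hbound 0 2 3
    · change |((-intMinor₃ _ _ _ 0 1 3 : ℤ) : ℝ)| ≤ _
      rw [Int.cast_neg, abs_neg]
      exact hbound _ _ _
    · exact hbound 0 1 2
  have hDval : |aeval ξ (ofFn 4 D)| ≤ A * y ^ (-(3 * l)) := by
    rw [aeval_ofFn]
    refine (abs_sum_crossVec_le hxk hxq hs).trans ?_
    rw [← hB]
    calc 24 * B * (approxError ξ q * L ^ 2) ≤ 24 * B * ((b * y ^ (-l)) * (b ^ 2 * y ^ (-(2 * l)))) := by
          have := herr.le.trans hLy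
          gcongr
      _ = 24 * B * b ^ 3 * (y ^ (-l) * y ^ (-(2 * l))) := by ring
      _ ≤ A * y ^ (-(3 * l)) := by
        rw [hyl', hA]
        have : B ≤ B ^ 2 := by nlinarith
        gcongr
  obtain ⟨⟨e1, e2⟩, e3⟩ := hT₂ y (by linarith)
  refine ⟨A * y ^ (1 - 2 * l), e3, linearFormSolvable_of_polynomial (ofFn_ne_zero hD0)
    (natDegree_ofFn_le D) hDsup (hDval.trans ?_) (hDval.trans_lt e2)⟩
  rw [Real.mul_rpow hA0.le (by positivity), ← Real.rpow_mul hy0.le, Real.rpow_neg hA0.le,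
    le_inv_mul_iff₀ (by positivity)]
  have e : A ^ w * (A * y ^ (-(3 * l)))
      = A * A ^ w * y ^ (-(3 * l - w * (1 - 2 * l))) * y ^ ((1 - 2 * l) * -w) := by
    rw [mul_assoc (A * A ^ w), ← Real.rpow_add hy0,
      show -(3 * l - w * (1 - 2 * l)) + (1 - 2 * l) * -w = -(3 * l) by ring]
    ring
  rw [e]
  have : 0 < y ^ ((1 - 2 * l) * -w) := by positivity
  nlinarith

/-! ### Passage to the suprema -/

/-- The bound `1/(1-2a)` exceeds the claimed one, since `(3a+1)(1-2a) - (1-a) = 2a(1-3a) < 0`. -/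
theorem mul_one_sub_two_mul_lt_one {a w : ℝ} (ha : 1 / 3 < a) (ha2 : a < 1 / 2)
    (hw : w < (3 * a + 1) / (1 - a)) : w * (1 - 2 * a) < 1 := by
  rw [lt_div_iff₀ (by linarith)] at hw
  have h1 : 0 < 1 - 2 * a := by linarith
  have h2 : 0 < 1 - a := by linarith
  have h3 : w * (1 - a) * (1 - 2 * a) < (3 * a + 1) * (1 - 2 * a) := by gcongr
  by_contra! h
  nlinarith [mul_le_mul_of_nonneg_right h h2.le]

/-- A continuous strict inequality at `a` persists at some point of `S` to the left of `a`. -/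
theorem exists_mem_of_isLUB {S : Set ℝ} {a : ℝ} (hne : S.Nonempty) (ha : IsLUB S a) {f : ℝ → ℝ} (hf : Continuous f)
    {c : ℝ} (hc : c < a) (h : 0 < f a) : ∃ l ∈ S, c < l ∧ 0 < f l := by
  have hev : ∀ᶠ t in nhds a, c < t ∧ 0 < f t :=
    (eventually_gt_nhds hc).and (hf.continuousAt.eventually (lt_mem_nhds h))
  exact ((ha.frequently_nhds_mem hne).and_eventually hev).exists

theorem sSup_image_coe {S : Set ℝ} (hne : S.Nonempty) (hb : BddAbove S) :
    sSup ((fun l : ℝ => (l : EReal)) '' S) = ((sSup S : ℝ) : EReal) := by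
  have h := isLUB_csSup hne hb
  refine IsLUB.sSup_eq ⟨?_, fun u hu => ?_⟩
  · rintro _ ⟨l, hl, rfl⟩
    exact EReal.coe_le_coe_iff.mpr (h.1 hl)
  · induction u with
    | bot =>
      obtain ⟨l, hl⟩ := hne
      exact absurd (hu ⟨l, hl, rfl⟩) (not_le.mpr (EReal.bot_lt_coe l))
    | top => exact le_top
    | coe u => exact EReal.coe_le_coe_iff.mpr (h.2 fun l hl => EReal.coe_le_coe_iff.mp (hu ⟨l, hl, rfl⟩))

theorem coe_le_sSup_of_forall_lt {S : Set ℝ} {c : ℝ} (h : ∀ w < c, w ∈ S) :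
    (c : EReal) ≤ sSup ((fun l : ℝ => (l : EReal)) '' S) := by
  refine EReal.ge_of_forall_gt_iff_ge.mp fun z hz => ?_
  exact le_sSup ⟨z, h z (EReal.coe_lt_coe_iff.mp hz), rfl⟩

theorem sSup_le_coe {S : Set ℝ} {c : ℝ} (h : ∀ w ∈ S, w ≤ c) :
    sSup ((fun l : ℝ => (l : EReal)) '' S) ≤ (c : EReal) := by
  refine sSup_le ?_
  rintro _ ⟨w, hw, rfl⟩
  exact EReal.coe_le_coe_iff.mpr (h w hw)

/-- Solve `(3m+1)/(1-m) ≤ w_3 ≤ W` for `m`. The right side is below 1, which later gives `λ_4 < 1`.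
-/
theorem ordinary_exponent_le {ξ l m : ℝ} (hξ : Transcendental ℚ ξ) (hl : 1 / 3 < l)
    (hS : ∀ᶠ X in atTop, SimultaneousSolvable 4 ξ l X)
    (hF : ∃ᶠ X in atTop, SimultaneousSolvable 4 ξ m X) :
    m ≤ (1 / (3 * l - 1) - 1) / (1 / (3 * l - 1) + 3) := by
  set W := 1 / (3 * l - 1) with hW
  have hW1 : 1 < W := by
    have := uniform_exponent_le hξ hS
    rw [hW, lt_div_iff₀ (by linarith)]
    linarith
  -- `m` itself might be at least 1, where the lower bound for `w_3` is unavailable; smaller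
  -- exponents `m'` are tested instead.
  have key : ∀ m', 0 < m' → m' < 1 → m' ≤ m → m' ≤ (W - 1) / (W + 3) := by
    intro m' h0 h1 hm
    have h2 : (3 * m' + 1) / (1 - m') ≤ W := le_of_forall_lt_imp_le_of_dense fun w hw =>
      cubic_exponent_le hξ hl hS (frequently_linearFormSolvable_of_ordinary hξ hl hS h0 h1
        (frequently_solvable_mono hF hm) ((lt_div_iff₀ (by linarith)).mp hw))
    rw [div_le_iff₀ (by linarith)] at h2
    rw [le_div_iff₀ (by linarith)]
    linarith
  by_contra! h
  have hq1 : (W - 1) / (W + 3) < 1 := by rw [div_lt_one (by linarith)]; linarith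
  have hq0 : 0 < (W - 1) / (W + 3) := div_pos (by linarith) (by linarith)
  obtain ⟨m', h1, h2⟩ := exists_between (lt_min h hq1)
  have h3 := key m' (hq0.trans h1) (h2.trans_le (min_le_right _ _)) (h2.le.trans (min_le_left _ _))
  linarith

theorem corollary2p2 (ξ : ℝ) (hξ : Transcendental ℚ ξ)
    (h : ((1 / 3 : ℝ) : EReal) < uniformLambda 4 ξ) :
    ∃ a b : ℝ, uniformLambda 4 ξ = (a : EReal) ∧ ordinaryLambda 4 ξ = (b : EReal) ∧
      a < 1 / 2 ∧ b < 1 ∧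
      ordinaryW 3 ξ ≤ (((3 * a + 1) / (3 * a - 1) : ℝ) : EReal) ∧
      ((max (3 * a / (1 - 2 * a)) ((3 * b + 1) / (1 - b)) : ℝ) : EReal) ≤ ordinaryW 3 ξ ∧
      (((3 * a + 1) / (1 - a) : ℝ) : EReal) ≤ uniformW 3 ξ ∧
      ordinaryW 2 ξ ≤ ((1 / a : ℝ) : EReal) ∧ 1 / a < 3 := by
  set S := {l : ℝ | ∀ᶠ X in atTop, SimultaneousSolvable 4 ξ l X} with hS
  set F := {l : ℝ | ∃ᶠ X in atTop, SimultaneousSolvable 4 ξ l X} with hF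
  have hSF : S ⊆ F := fun l hl => Eventually.frequently hl
  obtain ⟨_, ⟨l₀, hl₀S, rfl⟩, hl₀⟩ := lt_sSup_iff.mp h
  have hl₀3 : 1 / 3 < l₀ := EReal.coe_lt_coe_iff.mp hl₀
  have hSne : S.Nonempty := ⟨l₀, hl₀S⟩
  have hSb : BddAbove S := ⟨2 / 5, fun l hl => uniform_exponent_le hξ hl⟩
  set W := 1 / (3 * l₀ - 1) with hW
  have hFle : ∀ m ∈ F, m ≤ (W - 1) / (W + 3) := fun m hm => ordinary_exponent_le hξ hl₀3 hl₀S hm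
  have hFne : F.Nonempty := hSne.mono hSF
  have hFb : BddAbove F := ⟨_, hFle⟩
  have haS := isLUB_csSup hSne hSb
  have hbF := isLUB_csSup hFne hFb
  have hua : uniformLambda 4 ξ = ((sSup S : ℝ) : EReal) := sSup_image_coe hSne hSb
  have hob : ordinaryLambda 4 ξ = ((sSup F : ℝ) : EReal) := sSup_image_coe hFne hFb
  set a := sSup S with ha
  set b := sSup F with hb
  have ha3 : 1 / 3 < a := hl₀3.trans_le (haS.1 hl₀S)
  have ha5 : a ≤ 2 / 5 := haS.2 fun l hl => uniform_exponent_le hξ hl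
  have hab : a ≤ b := haS.2 fun l hl => hbF.1 (hSF hl)
  have hW0 : 0 < W := div_pos one_pos (by linarith)
  have hb1 : b < 1 := (hbF.2 hFle).trans_lt (by rw [div_lt_one (by linarith)]; linarith)
  have hSlt : ∀ l ∈ S, l < 1 / 2 := fun l hl => by
    linarith [haS.1 hl]
  have hFlt : ∀ m ∈ F, m < 1 := fun m hm => (hbF.1 hm).trans_lt hb1
  -- The supremum need not be attained: each inequality is made strict at `a` and then moved to some
  -- `l ∈ S`.
  have hnear : ∀ f : ℝ → ℝ, Continuous f → 0 < f a → ∃ l ∈ S, 1 / 3 < l ∧ 0 < f l :=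
    fun f hf h => exists_mem_of_isLUB hSne haS hf ha3 h
  refine ⟨a, b, hua, hob, by linarith, hb1, ?_, ?_, ?_, ?_, ?_⟩
  -- The strict inequality `1/(3a-1) < (3a+1)/(3a-1)` leaves room to replace `a` by `l` on the left.
  · obtain ⟨l, hl, hl3, hfl⟩ := hnear (fun l => (3 * a + 1) * (3 * l - 1) - (3 * a - 1))
      (by fun_prop) (by nlinarith)
    refine sSup_le_coe fun w hw => (cubic_exponent_le hξ hl3 hl hw).trans ?_
    rw [div_le_div_iff₀ (by linarith) (by linarith)]
    linarith
  · rw [EReal.coe_strictMono.monotone.map_max]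
    refine max_le (coe_le_sSup_of_forall_lt fun w hw => ?_)
      (coe_le_sSup_of_forall_lt fun w hw => ?_)
    · rw [lt_div_iff₀ (by linarith)] at hw
      obtain ⟨l, hl, hl3, hfl⟩ := hnear (fun l => 3 * l - w * (1 - 2 * l)) (by fun_prop)
        (sub_pos.mpr hw)
      exact frequently_linearFormSolvable_of_uniform hξ hl3 (hSlt l hl) hl (sub_pos.mp hfl)
    · rw [lt_div_iff₀ (by linarith)] at hw
      obtain ⟨m, hm, hm0, hfm⟩ := exists_mem_of_isLUB hFne hbF
        (f := fun m => 3 * m + 1 - w * (1 - m)) (by fun_prop) (show (0 : ℝ) < b by linarith)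
        (sub_pos.mpr hw)
      exact frequently_linearFormSolvable_of_ordinary hξ hl₀3 hl₀S hm0 (hFlt m hm) hm
        (sub_pos.mp hfm)
  · refine coe_le_sSup_of_forall_lt fun w hw => ?_
    have hw' := mul_one_sub_two_mul_lt_one ha3 (by linarith) hw
    obtain ⟨l, hl, hl3, hfl⟩ := hnear (fun l => 1 - w * (1 - 2 * l)) (by fun_prop)
      (sub_pos.mpr hw')
    exact eventually_linearFormSolvable hξ hl3 (hSlt l hl) hl (sub_pos.mp hfl)
  · refine sSup_le_coe fun w hw => ?_
    rw [le_div_iff₀ (by linarith)]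
    by_contra! hcon
    obtain ⟨l, hl, hl3, hfl⟩ := hnear (fun l => w * l - 1) (by fun_prop) (sub_pos.mpr hcon)
    have h1 := quadratic_exponent_le hξ hl3 hl hw
    rw [le_div_iff₀ (by linarith)] at h1
    linarith
  · rw [div_lt_iff₀ (by linarith)]
    linarith
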